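/- Fix arbitrary norms on $\mathbb{R}^{d_1}$ and $\mathbb{R}^{d_2}$ (all denoted $\|\cdot\|$), contraction factors $\lambda,\mu\in[0,1)$ and an exponent $\mathfrak a\in(1/2,1)$. Consider $$x_{n+1}=x_n+\alpha_n\big(f(x_n,y_n,Z_n)-x_n+M_{n+1}\big),\qquad y_{n+1}=y_n+\beta_n\big(g(x_n,y_n,Z_n)-y_n+M'_{n+1}\big),$$ with $\alpha_n=\alpha_0/(n+1)^{\mathfrak a}$, $0<\alpha_0<1$, and $\beta_n=\beta_0/(n+1)$, $\beta_0>0$. Let $\mathcal F_n=\sigma(x_0,y_0,Z_k,M_k,M'_k : k\le n)$ and assume the following. (1) $Z_n$ takes values in a finite set $\mathcal S$ and $P(Z_{n+1}=j\mid\mathcal F_n)=p(j\mid Z_n)$ for all $n$ and $j$, where $p$ is the transition matrix of an irreducible Markov chain with stationary distribution $\pi$. Put $\bar f(x,y)=\sum_i\pi(i)f(x,y,i)$ and $\bar g(x,y)=\sum_i\pi(i)g(x,y,i)$. (2) $\|\bar f(x_1,y)-\bar f(x_2,y)\|\le\lambda\|x_1-x_2\|$ for all $x_1,x_2,y$. Let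 $x^*(y)$ be the unique fixed point of $\bar f(\cdot,y)$. (3) $\|\bar g(x^*(y_1),y_1)-\bar g(x^*(y_2),y_2)\|\le\mu\|y_1-y_2\|$ for all $y_1,y_2$. Let $y^*$ be the unique fixed point of $y\mapsto\bar g(x^*(y),y)$, and let $x^*=x^*(y^*)$. (4) $M_{n+1}$ and $M'_{n+1}$ are integrable, $E[M_{n+1}\mid\mathcal F_n]=E[M'_{n+1}\mid\mathcal F_n]=0$, and $\|M_{n+1}\|+\|M'_{n+1}\|\le K(1+\|x_n\|+\|y_n\|)$ almost surely, for all $n\ge0$, where $K>0$. (5) For every $i\in\mathcal S$ the maps $f(\cdot,\cdot,i)$ and $g(\cdot,\cdot,i)$ are $L$-Lipschitz with respect to $\|x_1-x_2\|+\|y_1-y_2\|$, and $\|f(x,y,i)\|+\|g(x,y,i)\|\le K(1+\|x\|+\|y\|)$. Then $(x_n,y_n)\to(x^*,y^*)$ almost surely. Moreover, there is a constant $C_3>0$, depending only on the two normed spaces, $\lambda$, $\mu$ and $\mathfrak a$, such that if $\beta_0\ge C_3$ and $E\|x_0\|^2+E\|y_0\|^2\le R<\infty$, then for all $n\ge n_0$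 $$E\big[\|x_n-x^*\|^2\big]\le C_1\Big(\alpha_n+\frac{\beta_n^2}{\alpha_n^2}\Big)\quad\text{and}\quad E\big[\|y_n-y^*\|^2\big]\le C_2\Big(\alpha_n+\frac{\beta_n^2}{\alpha_n^2}\Big).$$ Here $n_0$ depends only on the step sizes, the contraction factors and the two normed spaces, and $C_1,C_2>0$ depend only on these data and on $\mathcal S,p,K,L,R$. In particular, if $\mathfrak a=2/3$, both expectations are at most $C_4(n+1)^{-2/3}$ for all $n\ge n_0$, with $C_4>0$ depending on the same data as $C_1,C_2$. -/

import Mathlib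

open MeasureTheory Filter Topology
open scoped Matrix

universe uX uY uS uO

noncomputable section

namespace TwoTimeScale

/-- The fixed point of a self-map `T`. It is the unique one when `T` is a contraction of a
complete space (see `fixedPt_spec`); if `T` has no fixed point, the value is arbitrary. -/
def fixedPt {E : Type*} [Nonempty E] (T : E → E) : E :=
  Classical.epsilon fun e => T e = e

/-- For a contraction `T` of a finite-dimensional normed space, `fixedPt T` is the unique fixed
point of `T`. -/
theorem fixedPt_spec {E : Type*} [NormedAddCommGroup E] [NormedSpace ℝ E] [FiniteDimensional ℝ E]
    {c : ℝ} (hc0 : 0 ≤ c) (hc1 : c < 1) {T : E → E}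
    (hT : ∀ e₁ e₂, ‖T e₁ - T e₂‖ ≤ c * ‖e₁ - e₂‖) :
    T (fixedPt T) = fixedPt T ∧ ∀ e, T e = e → e = fixedPt T := by
  have : CompleteSpace E := FiniteDimensional.complete ℝ E
  have hK : ContractingWith ⟨c, hc0⟩ T := by
    refine ⟨?_, LipschitzWith.of_dist_le_mul fun a b => ?_⟩
    · exact_mod_cast hc1
    · rw [dist_eq_norm, dist_eq_norm]
      exact hT a b
  have h1 : T (fixedPt T) = fixedPt T :=
    Classical.epsilon_spec (p := fun e => T e = e) ⟨_, hK.fixedPoint_isFixedPt⟩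
  exact ⟨h1, fun e he => hK.fixedPoint_unique' he h1⟩

section Maps

variable {X : Type*} {Y : Type*} {S : Type*} [Fintype S]
  [NormedAddCommGroup X] [NormedSpace ℝ X] [NormedAddCommGroup Y] [NormedSpace ℝ Y]

/-- The average `h̄(x, y) = ∑ i, π(i) h(x, y, i)`. -/
def avg {E : Type*} [AddCommMonoid E] [Module ℝ E]
    (π : S → ℝ) (h : X → Y → S → E) (x : X) (y : Y) : E :=
  ∑ i, π i • h x y i

/-- `x*(y)`, the fixed point of `f̄(·, y)`. -/
def xStarOf (π : S → ℝ) (f : X → Y → S → X) (y : Y) : X :=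
  fixedPt fun x => avg π f x y

/-- `y*`, the fixed point of `y ↦ ḡ(x*(y), y)`. -/
def yStar (π : S → ℝ) (f : X → Y → S → X) (g : X → Y → S → Y) : Y :=
  fixedPt fun y => avg π g (xStarOf π f y) y

/-- `x* = x*(y*)`. -/
def xStar (π : S → ℝ) (f : X → Y → S → X) (g : X → Y → S → Y) : X :=
  xStarOf π f (yStar π f g)

/-- `P i j = p(j | i)` is the transition matrix of an irreducible Markov chain on the finite
set `S`, and `π` is its stationary distribution. -/
structure IsIrreducibleChain (P : Matrix S S ℝ) (π : S → ℝ) : Prop where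
  row_sum : ∀ i, ∑ j, P i j = 1
  irreducible : P.IsIrreducible
  π_nonneg : ∀ i, 0 ≤ π i
  π_sum : ∑ i, π i = 1
  π_stationary : π ᵥ* P = π

/-- The assumptions on the maps `f` and `g`: contractivity of `f̄(·, y)` and of `ḡ(x*(·), ·)`,
Lipschitz continuity, and linear growth. -/
structure IsContractiveSystem (π : S → ℝ) (lam mu K L : ℝ)
    (f : X → Y → S → X) (g : X → Y → S → Y) : Prop where
  contractive_f : ∀ x₁ x₂ y, ‖avg π f x₁ y - avg π f x₂ y‖ ≤ lam * ‖x₁ - x₂‖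
  contractive_g : ∀ y₁ y₂,
    ‖avg π g (xStarOf π f y₁) y₁ - avg π g (xStarOf π f y₂) y₂‖ ≤ mu * ‖y₁ - y₂‖
  lipschitz_f : ∀ x₁ x₂ y₁ y₂ i, ‖f x₁ y₁ i - f x₂ y₂ i‖ ≤ L * (‖x₁ - x₂‖ + ‖y₁ - y₂‖)
  lipschitz_g : ∀ x₁ x₂ y₁ y₂ i, ‖g x₁ y₁ i - g x₂ y₂ i‖ ≤ L * (‖x₁ - x₂‖ + ‖y₁ - y₂‖)
  growth : ∀ x y i, ‖f x y i‖ + ‖g x y i‖ ≤ K * (1 + ‖x‖ + ‖y‖)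

end Maps

/-- The fast step sizes `α_n = α₀ / (n + 1) ^ a`. -/
def alphaStep (α₀ a : ℝ) (n : ℕ) : ℝ := α₀ / ((n : ℝ) + 1) ^ a

/-- The slow step sizes `β_n = β₀ / (n + 1)`. -/
def betaStep (β₀ : ℝ) (n : ℕ) : ℝ := β₀ / ((n : ℝ) + 1)

section Iterates

variable {X : Type*} {Y : Type*} {S : Type*} {Ω : Type*}
  [MeasurableSpace X] [MeasurableSpace Y] [MeasurableSpace S]

/-- `F_n = σ(x₀, y₀, Z_k, M_k, M'_k : k ≤ n)`. -/
abbrev history (x₀ : Ω → X) (y₀ : Ω → Y) (Z : ℕ → Ω → S) (M : ℕ → Ω → X) (M' : ℕ → Ω → Y)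
    (n : ℕ) : MeasurableSpace Ω :=
  MeasurableSpace.comap x₀ inferInstance ⊔ MeasurableSpace.comap y₀ inferInstance ⊔
    ⨆ k : ℕ, ⨆ _ : k ≤ n,
      (MeasurableSpace.comap (Z k) inferInstance ⊔ MeasurableSpace.comap (M k) inferInstance ⊔
        MeasurableSpace.comap (M' k) inferInstance)

/-- `(x_n, y_n)` are the iterates of the two-time-scale stochastic approximation driven by the
Markov chain `Z` with transition matrix `P` and by the martingale differences `M`, `M'`. -/
structure IsIteration [NormedAddCommGroup X] [NormedSpace ℝ X]
    [NormedAddCommGroup Y] [NormedSpace ℝ Y] [MeasurableSpace Ω] (Pr : Measure Ω)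
    (P : Matrix S S ℝ) (f : X → Y → S → X) (g : X → Y → S → Y) (K : ℝ) (α β : ℕ → ℝ)
    (Z : ℕ → Ω → S) (M : ℕ → Ω → X) (M' : ℕ → Ω → Y) (x : ℕ → Ω → X) (y : ℕ → Ω → Y) :
    Prop where
  measurable_x₀ : Measurable (x 0)
  measurable_y₀ : Measurable (y 0)
  measurable_Z : ∀ n, Measurable (Z n)
  measurable_M : ∀ n, Measurable (M n)
  measurable_M' : ∀ n, Measurable (M' n)
  /-- `P(Z_{n+1} = j | F_n) = p(j | Z_n)`. -/
  markov : ∀ n j,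
    Pr[(Z (n + 1) ⁻¹' {j}).indicator (fun _ => (1 : ℝ)) | history (x 0) (y 0) Z M M' n]
      =ᵐ[Pr] fun ω => P (Z n ω) j
  integrable_M : ∀ n, Integrable (M (n + 1)) Pr
  integrable_M' : ∀ n, Integrable (M' (n + 1)) Pr
  /-- `E[M_{n+1} | F_n] = 0`. -/
  condExp_M : ∀ n, Pr[M (n + 1) | history (x 0) (y 0) Z M M' n] =ᵐ[Pr] 0
  /-- `E[M'_{n+1} | F_n] = 0`. -/
  condExp_M' : ∀ n, Pr[M' (n + 1) | history (x 0) (y 0) Z M M' n] =ᵐ[Pr] 0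
  noise_growth : ∀ n, ∀ᵐ ω ∂Pr,
    ‖M (n + 1) ω‖ + ‖M' (n + 1) ω‖ ≤ K * (1 + ‖x n ω‖ + ‖y n ω‖)
  step_x : ∀ n ω,
    x (n + 1) ω = x n ω + α n • (f (x n ω) (y n ω) (Z n ω) - x n ω + M (n + 1) ω)
  step_y : ∀ n ω,
    y (n + 1) ω = y n ω + β n • (g (x n ω) (y n ω) (Z n ω) - y n ω + M' (n + 1) ω)

end Iterates

end TwoTimeScale

end

/-!
The usual proofs smooth the norm into a Lyapunov function. Here the noise is averaged instead, so
that only the triangle inequality is needed and an arbitrary norm is no obstacle.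

*Removing the noise.* The Poisson equation `w - π w = Q w - P Q w` of the chain
(`IsIrreducibleChain.exists_poisson`) turns the deviation of `f(x, y, Z n)` from its average into a
martingale difference plus the difference of `Hf = Q f` before and after one step of the chain.
Together with `M` the martingale difference forms a noise `ξ n` (`totalNoise`), which is fed into a
running average `D (n + 1) = (1 - α n) D n + α n ξ n` (`runAvg`). The slow variable has a noise
`ξ'` of its own, also averaged with the fast step sizes, to `D'`. With `ρ = β / α`, the corrected
iterates `p = x + α Hf - D` and `q = y + β Hg - ρ D'` satisfy
`p (n + 1) ≈ (1 - α n) p n + α n f̄(x n, y n)` and `q (n + 1) ≈ (1 - β n) q n + β n ḡ(x n, y n)`,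
where the error is at most of the order of the step size times the sum of `‖D‖`, `‖D'‖` and `α`
times the size of the iterates (`norm_corrected_step_le`). Contractivity then gives linear
inequalities for `u = ‖p - x*(q)‖`, `v = ‖q - y*‖`, `d = ‖D‖ + ‖D'‖` and `G = 1 + ‖x‖ + ‖y‖`,
collected in `ErrorRecursion`; the drift of `x*(q)` contributes a forcing of relative size `ρ`. They
hold along almost every path (`IsPath.errorRecursion`) and, by Minkowski's inequality, for the
mean-square norms as well (`ErrorRecursion.lpNorm`).

*Solving the recursion.* If `d` is of vanishing size relative to the running maximum of `G`, this
maximum can be absorbed, and `G` stays bounded (`ErrorRecursion.exists_bound`); then the errors tend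
to zero if `d` does (`ErrorRecursion.tendsto_zero`), and they inherit any rate of `d` and `α + ρ`
that the contractions can follow (`ErrorRecursion.exists_rate`).

*The averaged noise.* By orthogonality of martingale differences in Euclidean coordinates, the
mean-square norm of `D n` is of order `√(α n)` times the largest mean-square size of the iterates so
far (`exists_lpNorm_runAvg_le`). This gives mean-square boundedness, and with it the rate
`√α + β / α` for mean-square norms, whose square is the rate of the theorem. Bounded second moments
also make `∑ α ξ` converge almost surely, so that `D n → 0` (`ae_tendsto_runAvg`), and the pathwise
recursion gives almost sure convergence. As the almost sure statement does not assume
square integrable initial values, it is proved on the events `‖x 0‖ + ‖y 0‖ ≤ N`, by restriction of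
the probability measure (`IsIteration.restrict`).

The lower bound on `β₀` makes the slow contraction, of strength `c β n` with
`c = min (1 - λ) (1 - μ)`, beat the polynomial decrease of the rate; `1 / c` suffices. The bounds
hold from time zero on.
-/

noncomputable section

/-! ### Scalar recursions -/

namespace TwoTimeScale

/-- A contractive recursion with forcing of relative size `e → 0` tends to zero, provided the
steps have infinite sum. -/
theorem tendsto_zero_of_recursion {a γ e : ℕ → ℝ} {c : ℝ} (hc : 0 < c) (ha : ∀ n, 0 ≤ a n)
    (hγ : ∀ n, 0 ≤ γ n) (hγc : ∀ᶠ n in atTop, c * γ n ≤ 1)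
    (hsum : Tendsto (fun n => ∑ k ∈ Finset.range n, γ k) atTop atTop)
    (he : Tendsto e atTop (𝓝 0))
    (hrec : ∀ᶠ n in atTop, a (n + 1) ≤ (1 - c * γ n) * a n + γ n * e n) :
    Tendsto a atTop (𝓝 0) := by
  refine tendsto_order.2 ⟨fun b hb => Eventually.of_forall fun n => hb.trans_le (ha n), ?_⟩
  intro η hη
  have hη2 : 0 < η / 2 := by positivity
  have he' : ∀ᶠ n in atTop, e n < c * (η / 2) := he.eventually_lt_const (by positivity)
  obtain ⟨m, hm⟩ := eventually_atTop.1 (hγc.and (he'.and hrec))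
  have key : ∀ n, m ≤ n → a n - η / 2 ≤
      a m * Real.exp (-c * (∑ k ∈ Finset.range n, γ k - ∑ k ∈ Finset.range m, γ k)) := by
    intro n hn
    induction n, hn using Nat.le_induction with
    | base => simp; linarith
    | succ n hn ih =>
      obtain ⟨h1, h2, h3⟩ := hm n hn
      have h4 : a (n + 1) - η / 2 ≤ (1 - c * γ n) * (a n - η / 2) := by
        nlinarith [mul_le_mul_of_nonneg_left h2.le (hγ n)]
      have h5 : 1 - c * γ n ≤ Real.exp (-c * γ n) := by
        have := Real.add_one_le_exp (-c * γ n); linarith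
      refine h4.trans ((mul_le_mul_of_nonneg_left ih (by linarith)).trans ?_)
      rw [Finset.sum_range_succ]
      have h6 : -c * (∑ k ∈ Finset.range n, γ k + γ n - ∑ k ∈ Finset.range m, γ k)
          = -c * (∑ k ∈ Finset.range n, γ k - ∑ k ∈ Finset.range m, γ k) + -c * γ n := by ring
      rw [h6, Real.exp_add]
      have := mul_le_mul_of_nonneg_right h5 (mul_nonneg (ha m) (Real.exp_nonneg
        (-c * (∑ k ∈ Finset.range n, γ k - ∑ k ∈ Finset.range m, γ k))))
      linarith
  have hlim : Tendsto (fun n => a m * Real.exp (-c * (∑ k ∈ Finset.range n, γ k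
      - ∑ k ∈ Finset.range m, γ k))) atTop (𝓝 (a m * 0)) := by
    refine Tendsto.const_mul _ (Real.tendsto_exp_atBot.comp ?_)
    refine Tendsto.const_mul_atTop_of_neg (by linarith) ?_
    exact tendsto_atTop_add_const_right _ _ hsum
  rw [mul_zero] at hlim
  filter_upwards [hlim.eventually_lt_const hη2, eventually_ge_atTop m] with n h1 h2
  have := key n h2
  linarith

/-- A contractive recursion with forcing of relative size `b * e n` is of size `e n`, provided `e`
decays more slowly than the contraction allows. The horizon `N` is finite so that `b` may be a
bound that is only known up to time `N`. -/
theorem le_mul_of_recursion {a γ e : ℕ → ℝ} {c b B : ℝ} {m N : ℕ} (hγ : ∀ n, 0 ≤ γ n)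
    (he : ∀ n, 0 ≤ e n) (hγc : ∀ n, m ≤ n → c * γ n ≤ 1)
    (hratio : ∀ n, m ≤ n → (1 - c / 2 * γ n) * e n ≤ e (n + 1)) (hB : 0 ≤ B) (hbB : b ≤ c / 2 * B)
    (ham : a m ≤ B * e m)
    (hrec : ∀ n, m ≤ n → n < N → a (n + 1) ≤ (1 - c * γ n) * a n + γ n * (b * e n)) :
    ∀ n, m ≤ n → n ≤ N → a n ≤ B * e n := by
  intro n hn
  induction n, hn using Nat.le_induction with
  | base => exact fun _ => ham
  | succ n hn ih =>
    intro hN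
    have h1 := ih (by omega)
    have h2 := hrec n hn (by omega)
    have h3 := mul_le_mul_of_nonneg_left h1 (sub_nonneg.2 (hγc n hn))
    have h4 := mul_le_mul_of_nonneg_left (hratio n hn) hB
    have h5 := mul_le_mul_of_nonneg_right hbB (mul_nonneg (hγ n) (he n))
    nlinarith

/-- The scalar inequalities behind the two-time-scale scheme, satisfied both pathwise and by
mean-square norms: `u` and `v` are the errors of the corrected fast and slow iterates, `d` is the
size of the averaged noise, `G` is the size of the iterates, and `κ` is a vanishing weight. -/
structure ErrorRecursion (c C : ℝ) (α β κ u v d G : ℕ → ℝ) : Prop where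
  u_nonneg : ∀ n, 0 ≤ u n
  v_nonneg : ∀ n, 0 ≤ v n
  d_nonneg : ∀ n, 0 ≤ d n
  one_le_G : ∀ n, 1 ≤ G n
  u_step : ∀ n, u (n + 1) ≤ (1 - c * α n) * u n + C * α n * (d n + d (n + 1) + κ n * G n)
  v_step : ∀ n, β n ≤ 1 →
    v (n + 1) ≤ (1 - c * β n) * v n + C * β n * (u n + d n + d (n + 1) + κ n * G n)
  G_le : ∀ n, G n ≤ C * (1 + u n + v n + d n + κ n * G n)
  uv_le : ∀ n, u n + v n ≤ C * (G n + d n)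
  G_step : ∀ n, G (n + 1) ≤ C * G n

namespace ErrorRecursion

variable {c C : ℝ} {α β κ u v d G : ℕ → ℝ}

theorem G_le_pow (h : ErrorRecursion c C α β κ u v d G) (hC : 1 ≤ C) {n m : ℕ} (hnm : n ≤ m) :
    G n ≤ C ^ m * G 0 := by
  have h0 : 0 ≤ G 0 := by linarith [h.one_le_G 0]
  have h1 : G n ≤ C ^ n * G 0 := by
    clear hnm
    induction n with
    | zero => simp
    | succ n ih =>
      calc G (n + 1) ≤ C * G n := h.G_step n
        _ ≤ C * (C ^ n * G 0) := by gcongr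
        _ = _ := by ring
  exact h1.trans (mul_le_mul_of_nonneg_right (pow_le_pow_right₀ hC hnm) h0)

/-- The iterates stay bounded, with a bound that depends on `u`, `v`, `d`, `G` only through
`G 0`, if the averaged noise is of vanishing size relative to the running maximum of the
iterates. -/
theorem exists_bound {ε : ℕ → ℝ} (hc : 0 < c) (hc1 : c ≤ 1) (hC : 1 ≤ C) (hα : ∀ n, 0 < α n)
    (hα1 : ∀ n, α n ≤ 1) (hβ : ∀ n, 0 < β n) (hβ0 : Tendsto β atTop (𝓝 0))
    (hκ0 : ∀ n, 0 ≤ κ n) (hκ : Tendsto κ atTop (𝓝 0))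
    (hε0 : ∀ n, 0 ≤ ε n) (hε : Tendsto ε atTop (𝓝 0)) :
    ∃ B : ℝ, 1 ≤ B ∧ ∀ u v d G : ℕ → ℝ, ErrorRecursion c C α β κ u v d G →
      (∀ n b, (∀ k ≤ n, G k ≤ b) → d n ≤ ε n * b) → ∀ n, G n ≤ B * G 0 := by
  -- Beyond time `m` the forcing is at most `η` times the running maximum, with `η` so small that
  -- the running maximum can be absorbed.
  set Γ : ℝ := C * (C / c + C / c * (C / c + 1) + 1) with hΓ
  have hΓ0 : 0 < Γ := by positivity
  set η : ℝ := 1 / (2 * Γ) with hη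
  have hη0 : 0 < η := by positivity
  have hsmall : Tendsto (fun n => ε n + ε (n + 1) + κ n) atTop (𝓝 0) := by
    simpa using (hε.add (hε.comp (tendsto_add_atTop_nat 1))).add hκ
  obtain ⟨m, hm⟩ := eventually_atTop.1
    ((hsmall.eventually_lt_const hη0).and (hβ0.eventually_lt_const one_pos))
  set A : ℝ := C * (1 + (1 + C / c) * (C * (1 + ε m) * C ^ m)) with hA
  have hA0 : 0 ≤ A := by have := hε0 m; positivity
  refine ⟨2 * A + C ^ m, ?_, ?_⟩
  · have : 1 ≤ C ^ m := one_le_pow₀ hC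
    linarith
  intro u v d G h hd N
  have hG0 := h.one_le_G 0
  have hpow : ∀ n ≤ m, G n ≤ C ^ m * G 0 := fun n hn => h.G_le_pow hC hn
  obtain ⟨b, hb, kb, hkb, hkbG⟩ : ∃ b, (∀ k ≤ N, G k ≤ b) ∧ ∃ k ≤ N, G k = b := by
    obtain ⟨k, hk, hmax⟩ := Finset.exists_max_image (Finset.range (N + 1)) G ⟨0, by simp⟩
    exact ⟨G k, fun j hj => hmax j (by simp; omega), k, by simp at hk; omega, rfl⟩
  have hb1 : 1 ≤ b := hG0.trans (hb 0 (Nat.zero_le _))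
  refine (hb N le_rfl).trans ?_
  by_cases hkm : kb ≤ m
  · rw [← hkbG]
    refine (hpow kb hkm).trans ?_
    nlinarith
  push Not at hkm
  have hdb : ∀ n ≤ N, d n ≤ ε n * b := fun n hn => hd n b fun k hk => hb k (hk.trans hn)
  have hforce : ∀ n, m ≤ n → n < N → d n + d (n + 1) + κ n * G n ≤ η * b := by
    intro n hmn hnN
    have h1 := hdb n hnN.le
    have h2 := hdb (n + 1) hnN
    have h3 := mul_le_mul_of_nonneg_left (hb n hnN.le) (hκ0 n)
    have h4 := mul_le_mul_of_nonneg_right (hm n hmn).1.le (zero_le_one.trans hb1)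
    nlinarith
  have hcα : ∀ n, c * α n ≤ 1 := fun n => by nlinarith [hα n, hα1 n]
  have hu : ∀ n, m ≤ n → n ≤ N → u n ≤ u m + C / c * (η * b) := by
    intro n hmn
    induction n, hmn using Nat.le_induction with
    | base =>
      intro _
      have : 0 ≤ C / c * (η * b) := by positivity
      linarith
    | succ n hmn ih =>
      intro hnN
      have h1 := ih (by omega)
      have h2 := mul_le_mul_of_nonneg_left (hforce n hmn hnN)
        (mul_nonneg (zero_le_one.trans hC) (hα n).le)
      have h3 := mul_le_mul_of_nonneg_left h1 (sub_nonneg.2 (hcα n))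
      have h4 : c * α n * (C / c * (η * b)) = C * α n * (η * b) := by field_simp
      have h5 := mul_nonneg (mul_nonneg hc.le (hα n).le) (h.u_nonneg m)
      have h6 := h.u_step n
      nlinarith
  set w : ℝ := C / c * (u m + C / c * (η * b) + η * b) with hw
  have hw0 : 0 ≤ w := by have := h.u_nonneg m; positivity
  have hv : ∀ n, m ≤ n → n ≤ N → v n ≤ v m + w := by
    intro n hmn
    induction n, hmn using Nat.le_induction with
    | base => intro _; linarith
    | succ n hmn ih =>
      intro hnN
      have hβn : β n ≤ 1 := (hm n hmn).2.le
      have h1 := ih (by omega)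
      have h2 := mul_le_mul_of_nonneg_left (add_le_add (hu n hmn (by omega)) (hforce n hmn hnN))
        (mul_nonneg (zero_le_one.trans hC) (hβ n).le)
      have hcβ : c * β n ≤ 1 := by nlinarith [hβ n]
      have h3 := mul_le_mul_of_nonneg_left h1 (sub_nonneg.2 hcβ)
      have h4 : c * β n * w = C * β n * (u m + C / c * (η * b) + η * b) := by
        rw [hw]; field_simp
      have h5 := mul_nonneg (mul_nonneg hc.le (hβ n).le) (h.v_nonneg m)
      have h6 := h.v_step n hβn
      nlinarith
  have hmk := hkm.le
  have h1 := hu kb hmk hkb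
  have h2 := hv kb hmk hkb
  have h3 : d kb + κ kb * G kb ≤ η * b := by
    have e1 := hdb kb hkb
    have e3 := mul_le_mul_of_nonneg_left (hb kb hkb) (hκ0 kb)
    have e4 := mul_le_mul_of_nonneg_right (hm kb hmk).1.le (zero_le_one.trans hb1)
    have e5 := mul_nonneg (hε0 (kb + 1)) (zero_le_one.trans hb1)
    nlinarith
  have h4 : u m + v m ≤ C * (1 + ε m) * C ^ m * G 0 := by
    have e1 := h.uv_le m
    have e2 := hd m (C ^ m * G 0) hpow
    have e3 : C * (G m + d m) ≤ C * (C ^ m * G 0 + ε m * (C ^ m * G 0)) := by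
      have := hpow m le_rfl
      gcongr
    linarith
  have hum := h.u_nonneg m
  have hvm := h.v_nonneg m
  have h5 : b ≤ C * (1 + (u m + C / c * (η * b)) + (v m + w) + η * b) := by
    calc b = G kb := hkbG.symm
      _ ≤ C * (1 + u kb + v kb + d kb + κ kb * G kb) := h.G_le kb
      _ ≤ _ := by
        apply mul_le_mul_of_nonneg_left _ (by linarith)
        linarith
  have h6 : C * (1 + (u m + C / c * (η * b)) + (v m + w) + η * b)
      = C * (1 + ((1 + C / c) * u m + v m)) + Γ * η * b := by
    rw [hw, hΓ]; ring
  have h7 : Γ * η = 1 / 2 := by rw [hη]; field_simp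
  have h8 : C * (1 + ((1 + C / c) * u m + v m)) ≤ A * G 0 := by
    have hCc : 0 ≤ C / c := by positivity
    have e1 : (1 + C / c) * u m + v m ≤ (1 + C / c) * (C * (1 + ε m) * C ^ m * G 0) := by
      nlinarith [mul_le_mul_of_nonneg_left h4 (by linarith : 0 ≤ 1 + C / c),
        mul_nonneg hCc hvm]
    calc C * (1 + ((1 + C / c) * u m + v m))
        ≤ C * (G 0 + (1 + C / c) * (C * (1 + ε m) * C ^ m * G 0)) := by gcongr
      _ = A * G 0 := by rw [hA]; ring
  rw [h6, h7] at h5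
  have : 0 ≤ C ^ m * G 0 := by positivity
  nlinarith

/-- Convergence of the errors when the averaged noise vanishes. -/
theorem tendsto_zero (h : ErrorRecursion c C α β κ u v d G) (hc : 0 < c) (hc1 : c ≤ 1)
    (hC : 1 ≤ C) (hα : ∀ n, 0 < α n) (hα1 : ∀ n, α n ≤ 1)
    (hαsum : Tendsto (fun n => ∑ k ∈ Finset.range n, α k) atTop atTop)
    (hβ : ∀ n, 0 < β n) (hβ0 : Tendsto β atTop (𝓝 0))
    (hβsum : Tendsto (fun n => ∑ k ∈ Finset.range n, β k) atTop atTop)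
    (hκ0 : ∀ n, 0 ≤ κ n) (hκ : Tendsto κ atTop (𝓝 0)) (hd : Tendsto d atTop (𝓝 0)) :
    Tendsto u atTop (𝓝 0) ∧ Tendsto v atTop (𝓝 0) ∧
      Tendsto (fun n => κ n * G n) atTop (𝓝 0) := by
  obtain ⟨B, -, hB⟩ := exists_bound hc hc1 hC hα hα1 hβ hβ0 hκ0 hκ h.d_nonneg hd
  have hG := hB u v d G h fun n b hb =>
    le_mul_of_one_le_right (h.d_nonneg n) ((h.one_le_G 0).trans (hb 0 (Nat.zero_le _)))
  have hκG : Tendsto (fun n => κ n * G n) atTop (𝓝 0) := by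
    refine squeeze_zero (fun n => mul_nonneg (hκ0 n) (zero_le_one.trans (h.one_le_G n)))
      (fun n => mul_le_mul_of_nonneg_left (hG n) (hκ0 n)) ?_
    simpa using hκ.mul_const (B * G 0)
  have hforce : Tendsto (fun n => d n + d (n + 1) + κ n * G n) atTop (𝓝 0) := by
    simpa using (hd.add (hd.comp (tendsto_add_atTop_nat 1))).add hκG
  have hu : Tendsto u atTop (𝓝 0) := by
    refine tendsto_zero_of_recursion hc h.u_nonneg (fun n => (hα n).le)
      (Eventually.of_forall fun n => by nlinarith [hα n, hα1 n]) hαsum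
      (e := fun n => C * (d n + d (n + 1) + κ n * G n)) (by simpa using hforce.const_mul C)
      (Eventually.of_forall fun n => (h.u_step n).trans_eq (by ring))
  refine ⟨hu, ?_, hκG⟩
  have hβ1 : ∀ᶠ n in atTop, β n ≤ 1 := by
    filter_upwards [hβ0.eventually_lt_const one_pos] with n hn using hn.le
  refine tendsto_zero_of_recursion hc h.v_nonneg (fun n => (hβ n).le)
    (by filter_upwards [hβ1] with n hn; nlinarith [hβ n]) hβsum
    (e := fun n => C * (u n + (d n + d (n + 1) + κ n * G n)))
    (by simpa using (hu.add hforce).const_mul C)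
    (by filter_upwards [hβ1] with n hn; exact (h.v_step n hn).trans_eq (by ring))

/-- Rates: if the averaged noise and `κ` are of size `e`, where `e` decays more slowly than both
contractions allow, then so are the errors, with a constant that depends on `u`, `v`, `d`, `G` only
through `G 0`. -/
theorem exists_rate {e : ℕ → ℝ} {A : ℝ} (hc : 0 < c) (hc1 : c ≤ 1) (hC : 1 ≤ C)
    (hα : ∀ n, 0 < α n) (hα1 : ∀ n, α n ≤ 1) (hβ : ∀ n, 0 < β n) (hβ0 : Tendsto β atTop (𝓝 0))
    (he : ∀ n, 0 < e n) (hanti : Antitone e) (he0 : Tendsto e atTop (𝓝 0)) (hA : 0 ≤ A)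
    (hκ0 : ∀ n, 0 ≤ κ n) (hκA : ∀ n, κ n ≤ A * e n)
    (hratα : ∀ᶠ n in atTop, (1 - c / 2 * α n) * e n ≤ e (n + 1))
    (hratβ : ∀ᶠ n in atTop, (1 - c / 2 * β n) * e n ≤ e (n + 1)) :
    ∃ B : ℝ, 1 ≤ B ∧ ∀ u v d G : ℕ → ℝ, ErrorRecursion c C α β κ u v d G →
      (∀ n b, (∀ k ≤ n, G k ≤ b) → d n ≤ A * e n * b) →
      ∀ n, u n + v n + d n + κ n * G n ≤ B * G 0 * e n := by
  have hAe : Tendsto (fun n => A * e n) atTop (𝓝 0) := by simpa using he0.const_mul A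
  have hκ : Tendsto κ atTop (𝓝 0) := squeeze_zero hκ0 hκA hAe
  obtain ⟨B, hB1, hB⟩ := exists_bound hc hc1 hC hα hα1 hβ hβ0 hκ0 hκ
    (fun n => mul_nonneg hA (he n).le) hAe
  obtain ⟨m, hm⟩ := eventually_atTop.1
    ((hratα.and hratβ).and (hβ0.eventually_lt_const one_pos))
  -- `B₀ G 0` bounds the errors up to time `m`, relative to `e`.
  set B₀ : ℝ := C * (B + A * e 0 * B) / e m with hB₀
  have hem := he m
  have he00 := he 0
  have hB₀0 : 0 ≤ B₀ := by positivity
  set F : ℝ := 3 * A * B with hF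
  have hF0 : 0 ≤ F := by positivity
  set Bu : ℝ := B₀ + 2 / c * (C * F) with hBu
  set Bv : ℝ := B₀ + 2 / c * (C * (Bu + F)) with hBv
  have hBu0 : 0 ≤ Bu := by positivity
  have hBv0 : 0 ≤ Bv := by positivity
  refine ⟨Bu + Bv + F + 1, by linarith, ?_⟩
  intro u v d G h hd
  have hG := hB u v d G h hd
  have hG0 : 1 ≤ G 0 := h.one_le_G 0
  have hG0' : 0 ≤ G 0 := by linarith
  have hdn : ∀ n, d n ≤ A * B * G 0 * e n := fun n =>
    (hd n (B * G 0) fun k _ => hG k).trans_eq (by ring)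
  have hκn : ∀ n, κ n * G n ≤ A * B * G 0 * e n := fun n => by
    calc κ n * G n ≤ (A * e n) * (B * G 0) :=
          mul_le_mul (hκA n) (hG n) (zero_le_one.trans (h.one_le_G n)) (mul_nonneg hA (he n).le)
      _ = _ := by ring
  have hforce : ∀ n, d n + d (n + 1) + κ n * G n ≤ F * G 0 * e n := by
    intro n
    have h1 := hdn (n + 1)
    have h2 := mul_le_mul_of_nonneg_left (hanti (Nat.le_succ n))
      (by positivity : 0 ≤ A * B * G 0)
    have := hdn n
    have := hκn n
    rw [hF]
    simp only [Nat.succ_eq_add_one] at h2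
    linarith
  have huv : ∀ n ≤ m, u n + v n ≤ B₀ * G 0 * e n := by
    intro n hn
    have h1 : d n ≤ A * B * G 0 * e 0 :=
      (hdn n).trans (mul_le_mul_of_nonneg_left (hanti (Nat.zero_le n)) (by positivity))
    calc u n + v n ≤ C * (G n + d n) := h.uv_le n
      _ ≤ C * (B * G 0 + A * B * G 0 * e 0) := by
        have := hG n
        gcongr
      _ = B₀ * G 0 * e m := by rw [hB₀]; field_simp
      _ ≤ B₀ * G 0 * e n := mul_le_mul_of_nonneg_left (hanti hn) (by positivity)
  have hcα : ∀ n, c * α n ≤ 1 := fun n => by nlinarith [hα n, hα1 n]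
  have hBule : B₀ * G 0 ≤ Bu * G 0 := by
    have : 0 ≤ 2 / c * (C * F) := by positivity
    gcongr
    linarith
  have hBvle : B₀ * G 0 ≤ Bv * G 0 := by
    have : 0 ≤ 2 / c * (C * (Bu + F)) := by positivity
    gcongr
    linarith
  have hu : ∀ n, u n ≤ Bu * G 0 * e n := by
    intro n
    rcases le_total n m with hn | hn
    · have h1 := huv n hn
      have h2 := mul_le_mul_of_nonneg_right hBule (he n).le
      linarith [h.v_nonneg n]
    refine le_mul_of_recursion (fun n => (hα n).le) (fun n => (he n).le) (fun n _ => hcα n)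
      (fun n hn => (hm n hn).1.1) (by positivity) (b := C * F * G 0) ?_ ?_ ?_ n hn le_rfl
    · have : c / 2 * (Bu * G 0) = c / 2 * (B₀ * G 0) + C * F * G 0 := by
        rw [hBu]; field_simp
      have : 0 ≤ c / 2 * (B₀ * G 0) := by positivity
      linarith
    · have h1 := huv m le_rfl
      have h2 := mul_le_mul_of_nonneg_right hBule (he m).le
      linarith [h.v_nonneg m]
    · intro k _ _
      have := mul_le_mul_of_nonneg_left (hforce k)
        (mul_nonneg (zero_le_one.trans hC) (hα k).le)
      linarith [h.u_step k]
  have hv : ∀ n, v n ≤ Bv * G 0 * e n := by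
    intro n
    rcases le_total n m with hn | hn
    · have h1 := huv n hn
      have h2 := mul_le_mul_of_nonneg_right hBvle (he n).le
      linarith [h.u_nonneg n]
    refine le_mul_of_recursion (fun n => (hβ n).le) (fun n => (he n).le)
      (fun n hn => by nlinarith [hβ n, (hm n hn).2])
      (fun n hn => (hm n hn).1.2) (by positivity) (b := C * (Bu + F) * G 0) ?_ ?_ ?_ n hn le_rfl
    · have : c / 2 * (Bv * G 0) = c / 2 * (B₀ * G 0) + C * (Bu + F) * G 0 := by
        rw [hBv]; field_simp
      have : 0 ≤ c / 2 * (B₀ * G 0) := by positivity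
      linarith
    · have h1 := huv m le_rfl
      have h2 := mul_le_mul_of_nonneg_right hBvle (he m).le
      linarith [h.u_nonneg m]
    · intro k hk _
      have := mul_le_mul_of_nonneg_left (add_le_add (hu k) (hforce k))
        (mul_nonneg (zero_le_one.trans hC) (hβ k).le)
      linarith [h.v_step k (hm k hk).2.le]
  intro n
  have h1 := hu n
  have h2 := hv n
  have h3 := hdn n
  have h4 := hκn n
  have h5 : 0 ≤ A * B * G 0 * e n := by have := he n; positivity
  have h6 : 0 ≤ G 0 * e n := by have := he n; positivity
  rw [hF]
  nlinarith

end ErrorRecursion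

end TwoTimeScale

/-! ### Polynomial step sizes -/

namespace TwoTimeScale

/-- The sequence `(n + 1) ^ (-s)`, of which all step sizes and rates are multiples. -/
def decay (s : ℝ) (n : ℕ) : ℝ := ((n : ℝ) + 1) ^ (-s)

theorem decay_pos (s : ℝ) (n : ℕ) : 0 < decay s n := by unfold decay; positivity

theorem decay_add (s t : ℝ) (n : ℕ) : decay (s + t) n = decay s n * decay t n := by
  unfold decay
  rw [← Real.rpow_add (by positivity)]
  congr 1
  ring

theorem decay_one (n : ℕ) : decay 1 n = 1 / ((n : ℝ) + 1) := by
  unfold decay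
  rw [Real.rpow_neg_one, one_div]

theorem decay_le_decay {s t : ℝ} (h : s ≤ t) (n : ℕ) : decay t n ≤ decay s n :=
  Real.rpow_le_rpow_of_exponent_le (by linarith [(Nat.cast_nonneg n : (0 : ℝ) ≤ n)]) (by linarith)

theorem decay_le_one {s : ℝ} (h : 0 ≤ s) (n : ℕ) : decay s n ≤ 1 := by
  simpa [decay] using decay_le_decay h n

theorem decay_antitone {s : ℝ} (h : 0 ≤ s) : Antitone (decay s) := by
  intro m n hmn
  have : (m : ℝ) ≤ n := by exact_mod_cast hmn
  exact Real.rpow_le_rpow_of_nonpos (by positivity) (by linarith) (by linarith)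

theorem tendsto_decay {s : ℝ} (h : 0 < s) : Tendsto (decay s) atTop (𝓝 0) :=
  (tendsto_rpow_neg_atTop h).comp
    (tendsto_atTop_add_const_right _ _ tendsto_natCast_atTop_atTop)

theorem sq_decay (s : ℝ) (n : ℕ) : decay s n ^ 2 = decay (2 * s) n := by
  rw [two_mul, decay_add, sq]

theorem summable_decay {s : ℝ} (h : 1 < s) : Summable (decay s) := by
  have h1 : Summable fun n : ℕ => (n : ℝ) ^ (-s) := Real.summable_nat_rpow.2 (by linarith)
  have h2 := (summable_nat_add_iff 1).2 h1
  refine h2.congr fun n => ?_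
  simp [decay]

theorem tendsto_sum_decay {s : ℝ} (h : s ≤ 1) :
    Tendsto (fun n => ∑ k ∈ Finset.range n, decay s k) atTop atTop := by
  refine (not_summable_iff_tendsto_nat_atTop_of_nonneg fun n => (decay_pos s n).le).1 ?_
  intro h1
  have h2 : Summable fun n : ℕ => ((n + 1 : ℕ) : ℝ) ^ (-s) := h1.congr fun n => by simp [decay]
  have h3 := (summable_nat_add_iff (f := fun n : ℕ => (n : ℝ) ^ (-s)) 1).1 h2
  rw [Real.summable_nat_rpow] at h3
  linarith

/-- Bernoulli's inequality for the relative decrease of `decay s`. -/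
theorem decay_ratio {s : ℝ} (h0 : 0 ≤ s) (h1 : s ≤ 1) (n : ℕ) :
    (1 - s * decay 1 n) * decay s n ≤ decay s (n + 1) := by
  have hn : (0 : ℝ) < (n : ℝ) + 1 := by positivity
  set t : ℝ := 1 / ((n : ℝ) + 1) with ht
  have ht0 : 0 < t := by positivity
  have e1 : ((n + 1 : ℕ) : ℝ) + 1 = ((n : ℝ) + 1) * (1 + t) := by
    rw [ht]; push_cast; field_simp
  have e2 : (1 + t) ^ s ≤ 1 + s * t :=
    rpow_one_add_le_one_add_mul_self (by linarith) h0 h1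
  have e3 : (0 : ℝ) < (1 + t) ^ s := by positivity
  have e4 : 1 - s * t ≤ (1 + t) ^ (-s) := by
    rw [Real.rpow_neg (by positivity)]
    rw [← one_div, le_div_iff₀ e3]
    rcases le_or_gt (1 - s * t) 0 with h | h
    · nlinarith
    · nlinarith [mul_nonneg (mul_nonneg h0 ht0.le) (mul_nonneg h0 ht0.le)]
  have e5 : decay s (n + 1) = decay s n * (1 + t) ^ (-s) := by
    unfold decay
    rw [e1, Real.mul_rpow hn.le (by positivity)]
  rw [e5, decay_one, mul_comm]
  exact mul_le_mul_of_nonneg_left e4 (decay_pos s n).le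

theorem decay_sub_le {s : ℝ} (h0 : 0 ≤ s) (h1 : s ≤ 1) (n : ℕ) :
    |decay s (n + 1) - decay s n| ≤ decay 1 n * decay s n := by
  rw [abs_le]
  have e1 := decay_ratio h0 h1 n
  have e2 := decay_antitone h0 (Nat.le_succ n)
  have e3 := mul_nonneg (decay_pos 1 n).le (decay_pos s n).le
  simp only [Nat.succ_eq_add_one] at e2
  constructor <;> nlinarith

/-- If `s ≤ 1` and `t < 1`, a contraction with steps of size `decay t` is faster than the
decrease of `decay s`. -/
theorem eventually_ratio {s t c : ℝ} (hc : 0 < c) (h0 : 0 ≤ s) (h1 : s ≤ 1) (ht : t < 1) :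
    ∀ᶠ n in atTop, (1 - c * decay t n) * decay s n ≤ decay s (n + 1) := by
  have h := (tendsto_decay (sub_pos.2 ht)).eventually_lt_const hc
  filter_upwards [h] with n hn
  refine le_trans (mul_le_mul_of_nonneg_right ?_ (decay_pos s n).le) (decay_ratio h0 h1 n)
  have e1 : decay 1 n = decay (1 - t) n * decay t n := by rw [← decay_add]; congr 1; ring
  have := decay_pos t n
  have := decay_pos (1 - t) n
  have e2 : s * decay 1 n ≤ 1 * decay 1 n :=
    mul_le_mul_of_nonneg_right h1 (decay_pos 1 n).le
  rw [e1] at e2 ⊢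
  nlinarith

theorem alphaStep_eq (α₀ a : ℝ) : alphaStep α₀ a = fun n => α₀ * decay a n := by
  funext n
  unfold alphaStep decay
  rw [Real.rpow_neg (by positivity), div_eq_mul_inv]

theorem betaStep_eq (β₀ : ℝ) : betaStep β₀ = fun n => β₀ * decay 1 n := by
  funext n
  rw [decay_one]
  unfold betaStep
  ring

/-- The ratio `β_n / α_n` of the step sizes. -/
def stepRatio (α₀ β₀ a : ℝ) (n : ℕ) : ℝ := β₀ / α₀ * decay (1 - a) n

theorem betaStep_eq_ratio_mul {α₀ : ℝ} (β₀ a : ℝ) (h : α₀ ≠ 0) (n : ℕ) :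
    betaStep β₀ n = stepRatio α₀ β₀ a n * alphaStep α₀ a n := by
  rw [alphaStep_eq, betaStep_eq]
  have : decay 1 n = decay (1 - a) n * decay a n := by rw [← decay_add]; congr 1; ring
  simp only [stepRatio, this]
  field_simp

end TwoTimeScale

/-! ### Averaged martingale noise -/

namespace TwoTimeScale

/-- The running average `D` of the noise `ξ`: `D 0 = 0` and
`D (n + 1) = (1 - α n) D n + α n ξ n`. -/
def runAvg {E : Type*} [AddCommGroup E] [Module ℝ E] (α : ℕ → ℝ) (ξ : ℕ → E) : ℕ → E
  | 0 => 0
  | n + 1 => (1 - α n) • runAvg α ξ n + α n • ξ n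

theorem runAvg_apply {Ω E : Type*} [AddCommGroup E] [Module ℝ E] (α : ℕ → ℝ) (ξ : ℕ → Ω → E)
    (n : ℕ) (ω : Ω) : runAvg α ξ n ω = runAvg α (fun k => ξ k ω) n := by
  induction n with
  | zero => rfl
  | succ n ih => simp [runAvg, ih]

theorem map_runAvg {E F : Type*} [AddCommGroup E] [Module ℝ E] [AddCommGroup F] [Module ℝ F]
    (T : E →ₗ[ℝ] F) (α : ℕ → ℝ) (ξ : ℕ → E) (n : ℕ) :
    T (runAvg α ξ n) = runAvg α (fun k => T (ξ k)) n := by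
  induction n with
  | zero => simp [runAvg]
  | succ n ih => simp [runAvg, ih]

/-- A square integrable martingale difference sequence; `ξ n` is revealed at time `n + 1`. -/
structure IsMartingaleNoise {Ω E : Type*} [NormedAddCommGroup E] [NormedSpace ℝ E]
    [CompleteSpace E] {m0 : MeasurableSpace Ω} (μ : Measure Ω) (ℱ : Filtration ℕ m0)
    (ξ : ℕ → Ω → E) : Prop where
  adapted : ∀ n, StronglyMeasurable[ℱ (n + 1)] (ξ n)
  memLp : ∀ n, MemLp (ξ n) 2 μ
  condExp_eq_zero : ∀ n, μ[ξ n | ℱ n] =ᵐ[μ] 0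

variable {Ω : Type*} {m0 : MeasurableSpace Ω} {μ : Measure Ω} {ℱ : Filtration ℕ m0}

theorem sq_lpNorm_two {E : Type*} [NormedAddCommGroup E] {f : Ω → E} (hf : MemLp f 2 μ) :
    lpNorm f 2 μ ^ 2 = ∫ ω, ‖f ω‖ ^ 2 ∂μ := by
  rw [lpNorm_eq_integral_norm_rpow_toReal (by simp) (by simp) hf.aestronglyMeasurable,
    ← Real.rpow_natCast, ← Real.rpow_mul (integral_nonneg fun ω => by positivity)]
  simp

theorem lpNorm_le_of_ae_le {E F : Type*} [NormedAddCommGroup E] [NormedAddCommGroup F]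
    {f : Ω → E} {g : Ω → F} (hg : MemLp g 2 μ) (h : ∀ᵐ ω ∂μ, ‖f ω‖ ≤ ‖g ω‖) :
    lpNorm f 2 μ ≤ lpNorm g 2 μ := by
  by_cases hf : AEStronglyMeasurable f μ
  · rw [← toReal_eLpNorm hf, ← toReal_eLpNorm hg.aestronglyMeasurable]
    exact ENNReal.toReal_mono hg.eLpNorm_ne_top (eLpNorm_mono_ae h)
  · simp [hf]

theorem lpNorm_two_le_of_integral_le {E : Type*} [NormedAddCommGroup E] {f : Ω → E} {b : ℝ}
    (hf : MemLp f 2 μ) (hb : 0 ≤ b) (h : ∫ ω, ‖f ω‖ ^ 2 ∂μ ≤ b ^ 2) : lpNorm f 2 μ ≤ b := by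
  rw [← sq_lpNorm_two hf] at h
  exact abs_le_of_sq_le_sq' h hb |>.2

theorem integral_le_of_lpNorm_le {E : Type*} [NormedAddCommGroup E] {f : Ω → E} {b : ℝ}
    (hf : MemLp f 2 μ) (h : lpNorm f 2 μ ≤ b) : ∫ ω, ‖f ω‖ ^ 2 ∂μ ≤ b ^ 2 := by
  rw [← sq_lpNorm_two hf]
  exact pow_le_pow_left₀ lpNorm_nonneg h 2

theorem lpNorm_clm_le {E F : Type*} [NormedAddCommGroup E] [NormedSpace ℝ E]
    [NormedAddCommGroup F] [NormedSpace ℝ F] (T : E →L[ℝ] F) {f : Ω → E} (hf : MemLp f 2 μ) :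
    lpNorm (fun ω => T (f ω)) 2 μ ≤ ‖T‖ * lpNorm f 2 μ := by
  have h1 : lpNorm (‖T‖ • f) 2 μ = ‖T‖ * lpNorm f 2 μ := by
    rw [lpNorm_const_smul]
    simp
  rw [← h1]
  refine lpNorm_le_of_ae_le (hf.const_smul _) (Eventually.of_forall fun ω => ?_)
  simpa [norm_smul] using T.le_opNorm (f ω)

/-- Orthogonality of a martingale difference to the past. -/
theorem integral_norm_add_sq_of_condExp_eq_zero {F : Type*} [NormedAddCommGroup F]
    [InnerProductSpace ℝ F] [CompleteSpace F] [IsFiniteMeasure μ] {m : MeasurableSpace Ω}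
    (hm : m ≤ m0) {A B : Ω → F} (hAm : StronglyMeasurable[m] A) (hA : MemLp A 2 μ)
    (hB : MemLp B 2 μ) (h : μ[B | m] =ᵐ[μ] 0) :
    ∫ ω, ‖A ω + B ω‖ ^ 2 ∂μ = ∫ ω, ‖A ω‖ ^ 2 ∂μ + ∫ ω, ‖B ω‖ ^ 2 ∂μ := by
  have hint : Integrable (fun ω => inner ℝ (A ω) (B ω)) μ := by
    refine (hA.integrable_norm_pow (by norm_num)).add (hB.integrable_norm_pow (by norm_num))
      |>.mono (hA.aestronglyMeasurable.inner hB.aestronglyMeasurable)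
      (Eventually.of_forall fun ω => ?_)
    simp only [Pi.add_apply]
    refine (norm_inner_le_norm (𝕜 := ℝ) (A ω) (B ω)).trans (le_trans ?_ (le_abs_self _))
    nlinarith [sq_nonneg (‖A ω‖ - ‖B ω‖), sq_nonneg (‖A ω‖ + ‖B ω‖)]
  have h0 : ∫ ω, inner ℝ (A ω) (B ω) ∂μ = 0 := by
    have h1 := condExp_bilin_of_aestronglyMeasurable_left (innerSL ℝ)
      hAm.aestronglyMeasurable hint (hB.integrable (by norm_num))
    rw [← integral_condExp hm (μ := μ)]
    refine integral_eq_zero_of_ae (h1.trans ?_)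
    filter_upwards [h] with ω hω
    simp [hω]
  have h2 : ∀ ω, ‖A ω + B ω‖ ^ 2 = ‖A ω‖ ^ 2 + 2 * inner ℝ (A ω) (B ω) + ‖B ω‖ ^ 2 :=
    fun ω => norm_add_sq_real _ _
  simp_rw [h2]
  have i1 := hA.integrable_norm_pow (by norm_num)
  have i2 := hB.integrable_norm_pow (by norm_num)
  rw [integral_add (by exact i1.add (hint.const_mul 2)) i2,
    integral_add i1 (hint.const_mul 2), integral_const_mul, h0]
  simp

namespace IsMartingaleNoise

variable {E : Type*} [NormedAddCommGroup E] [NormedSpace ℝ E] [CompleteSpace E] {ξ : ℕ → Ω → E}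

theorem map {F : Type*} [NormedAddCommGroup F] [NormedSpace ℝ F] [CompleteSpace F]
    [IsFiniteMeasure μ] (h : IsMartingaleNoise μ ℱ ξ) (T : E →L[ℝ] F) :
    IsMartingaleNoise μ ℱ fun n ω => T (ξ n ω) where
  adapted n := T.continuous.comp_stronglyMeasurable (h.adapted n)
  memLp n := (T.comp_memLp' (h.memLp n))
  condExp_eq_zero n := by
    have h1 := T.comp_condExp_comm (m := ℱ n) ((h.memLp n).integrable (by norm_num))
    refine h1.symm.trans ?_
    filter_upwards [h.condExp_eq_zero n] with ω hω
    simp [hω]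

theorem stronglyMeasurable_runAvg (h : IsMartingaleNoise μ ℱ ξ) (α : ℕ → ℝ) (n : ℕ) :
    StronglyMeasurable[ℱ n] (runAvg α ξ n) := by
  induction n with
  | zero => exact stronglyMeasurable_const
  | succ n ih =>
    exact ((ih.mono (ℱ.mono (Nat.le_succ n))).const_smul _).add ((h.adapted n).const_smul _)

theorem memLp_runAvg (h : IsMartingaleNoise μ ℱ ξ) (α : ℕ → ℝ) (n : ℕ) :
    MemLp (runAvg α ξ n) 2 μ := by
  induction n with
  | zero => exact MemLp.zero
  | succ n ih => exact (ih.const_smul _).add ((h.memLp n).const_smul _)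

theorem integral_runAvg_succ {F : Type*} [NormedAddCommGroup F] [InnerProductSpace ℝ F]
    [CompleteSpace F] [IsFiniteMeasure μ] {ξ : ℕ → Ω → F} (h : IsMartingaleNoise μ ℱ ξ)
    (α : ℕ → ℝ) (n : ℕ) :
    ∫ ω, ‖runAvg α ξ (n + 1) ω‖ ^ 2 ∂μ =
      (1 - α n) ^ 2 * ∫ ω, ‖runAvg α ξ n ω‖ ^ 2 ∂μ + α n ^ 2 * ∫ ω, ‖ξ n ω‖ ^ 2 ∂μ := by
  have h1 := integral_norm_add_sq_of_condExp_eq_zero (ℱ.le n)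
    ((h.stronglyMeasurable_runAvg α n).const_smul (1 - α n))
    ((h.memLp_runAvg α n).const_smul (1 - α n)) ((h.memLp n).const_smul (α n)) (μ := μ) (by
      refine (condExp_smul (α n) (ξ n) (ℱ n)).trans ?_
      filter_upwards [h.condExp_eq_zero n] with ω hω
      simp [hω])
  simp only [Pi.smul_apply, norm_smul, mul_pow, Real.norm_eq_abs, sq_abs, integral_const_mul] at h1
  exact h1

end IsMartingaleNoise

/-- The averaged noise has mean-square norm of order `√α`, relative to the largest mean-square norm
of the noise so far. Euclidean coordinates make martingale differences orthogonal, at the cost of a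
constant that depends on the norm of `E`. -/
theorem exists_lpNorm_runAvg_le (E : Type*) [NormedAddCommGroup E] [NormedSpace ℝ E]
    [FiniteDimensional ℝ E] [CompleteSpace E] {α₀ a : ℝ} (hα₀ : 0 < α₀) (hα1 : α₀ < 1)
    (ha0 : 0 ≤ a) (ha1 : a < 1) :
    ∃ C : ℝ, 0 ≤ C ∧ ∀ {Ω : Type*} {m0 : MeasurableSpace Ω} (μ : Measure Ω) [IsFiniteMeasure μ]
      (ℱ : Filtration ℕ m0) (ξ : ℕ → Ω → E), IsMartingaleNoise μ ℱ ξ →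
      ∀ n b, (∀ k < n, lpNorm (ξ k) 2 μ ≤ b) → 0 ≤ b →
        lpNorm (runAvg (alphaStep α₀ a) ξ n) 2 μ ≤ C * decay (a / 2) n * b := by
  obtain ⟨m, hm⟩ := eventually_atTop.1 (eventually_ratio (half_pos hα₀) ha0 ha1.le ha1)
  set T := toEuclidean (E := E) with hT
  set Φ : E →L[ℝ] EuclideanSpace ℝ (Fin (Module.finrank ℝ E)) := T.toContinuousLinearMap with hΦ
  set Ψ : EuclideanSpace ℝ (Fin (Module.finrank ℝ E)) →L[ℝ] E := T.symm.toContinuousLinearMap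
    with hΨ
  set τ := ‖Φ‖ with hτ
  set τ' := ‖Ψ‖ with hτ'
  have hdm := decay_pos a m
  refine ⟨τ' * (√(m / decay a m + 2 * α₀) * τ), by positivity, ?_⟩
  intro Ω m0 μ _ ℱ ξ h N b hb hb0
  have hTξ := h.map Φ
  set ζ := fun n ω => Φ (ξ n ω) with hζ
  set α := alphaStep α₀ a with hα
  have hαeq : ∀ n, α n = α₀ * decay a n := fun n => by rw [hα, alphaStep_eq]
  have hα_nonneg : ∀ n, 0 ≤ α n := fun n => by rw [hαeq]; have := decay_pos a n; positivity
  have hα_le : ∀ n, α n ≤ 1 := fun n => by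
    rw [hαeq]; nlinarith [decay_pos a n, decay_le_one ha0 n]
  set A : ℕ → ℝ := fun n => ∫ ω, ‖runAvg α ζ n ω‖ ^ 2 ∂μ with hA
  have hA0 : ∀ n, 0 ≤ A n := fun n => integral_nonneg fun ω => by positivity
  have hζb : ∀ k < N, ∫ ω, ‖ζ k ω‖ ^ 2 ∂μ ≤ (τ * b) ^ 2 := fun k hk =>
    integral_le_of_lpNorm_le (hTξ.memLp k) ((lpNorm_clm_le _ (h.memLp k)).trans
      (mul_le_mul_of_nonneg_left (hb k hk) (norm_nonneg _)))
  have hstep : ∀ k < N, A (k + 1) ≤ (1 - α k) * A k + α k ^ 2 * (τ * b) ^ 2 := by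
    intro k hk
    have e1 : A (k + 1) = (1 - α k) ^ 2 * A k + α k ^ 2 * ∫ ω, ‖ζ k ω‖ ^ 2 ∂μ :=
      hTξ.integral_runAvg_succ α k
    have e2 := mul_le_mul_of_nonneg_left (hζb k hk) (sq_nonneg (α k))
    have e3 : (1 - α k) ^ 2 * A k ≤ (1 - α k) * A k :=
      mul_le_mul_of_nonneg_right (by nlinarith [hα_nonneg k, hα_le k]) (hA0 k)
    linarith
  have hAzero : A 0 = 0 := by simp [hA, runAvg]
  have hlin : ∀ k ≤ N, A k ≤ k * (τ * b) ^ 2 := by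
    intro k
    induction k with
    | zero => intro _; simp [hAzero]
    | succ k ih =>
      intro hk
      have e1 := hstep k (by omega)
      have e2 := ih (by omega)
      have e3 : α k ^ 2 * (τ * b) ^ 2 ≤ 1 * (τ * b) ^ 2 :=
        mul_le_mul_of_nonneg_right (pow_le_one₀ (hα_nonneg k) (hα_le k)) (sq_nonneg _)
      push_cast
      nlinarith [mul_nonneg (hα_nonneg k) (hA0 k)]
  have hfin : A N ≤ (m / decay a m + 2 * α₀) * (τ * b) ^ 2 * decay a N := by
    have hsq := sq_nonneg (τ * b)
    have hearly : ∀ k ≤ m, k ≤ N →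
        A k ≤ (m / decay a m + 2 * α₀) * (τ * b) ^ 2 * decay a k := by
      intro k hk hkN
      have e1 : (k : ℝ) ≤ m := by exact_mod_cast hk
      have e2 : (m : ℝ) ≤ (m / decay a m + 2 * α₀) * decay a k := by
        have := decay_antitone ha0 hk
        have e3 : (m : ℝ) / decay a m * decay a m ≤ m / decay a m * decay a k := by gcongr
        rw [div_mul_cancel₀ _ hdm.ne'] at e3
        nlinarith [decay_pos a k]
      calc A k ≤ k * (τ * b) ^ 2 := hlin k hkN
        _ ≤ ((m / decay a m + 2 * α₀) * decay a k) * (τ * b) ^ 2 := by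
          gcongr; linarith
        _ = _ := by ring
    rcases le_total N m with hN | hN
    · exact hearly N hN le_rfl
    · refine le_mul_of_recursion (c := 1) (γ := α) (b := α₀ * (τ * b) ^ 2) hα_nonneg
        (fun n => (decay_pos a n).le) (fun n _ => by linarith [hα_le n]) ?_ (by positivity) ?_
        (hearly m le_rfl hN) ?_ N hN le_rfl
      · intro n hn
        refine le_trans (le_of_eq ?_) (hm n hn)
        rw [hαeq]; ring
      · have : 0 ≤ (m : ℝ) / decay a m * (τ * b) ^ 2 := by positivity
        nlinarith
      · intro n _ hn
        refine (hstep n hn).trans (le_of_eq ?_)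
        rw [hαeq]; ring
  have hsqrt : lpNorm (runAvg α ζ N) 2 μ
      ≤ √(m / decay a m + 2 * α₀) * τ * decay (a / 2) N * b := by
    have := decay_pos (a / 2) N
    refine lpNorm_two_le_of_integral_le (hTξ.memLp_runAvg α N) (by positivity) (hfin.trans ?_)
    have e1 : decay a N = decay (a / 2) N ^ 2 := by rw [sq_decay]; congr 1; ring
    rw [e1]
    simp only [mul_pow]
    rw [Real.sq_sqrt (by positivity)]
    exact le_of_eq (by ring)
  have hback : runAvg α ξ N = fun ω => Ψ (runAvg α ζ N ω) := by
    funext ω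
    rw [runAvg_apply, runAvg_apply]
    have := map_runAvg (Ψ : _ →ₗ[ℝ] E) α (fun k => ζ k ω) N
    simp only [ContinuousLinearMap.coe_coe] at this
    rw [this]
    simp [hζ, hΦ, hΨ]
  rw [hback]
  refine (lpNorm_clm_le _ (hTξ.memLp_runAvg α N)).trans ?_
  exact (mul_le_mul_of_nonneg_left hsqrt (norm_nonneg _)).trans_eq (by ring)

/-- Real martingale noise with bounded second moments: its running average vanishes almost surely.
The series `∑ α k ξ k` converges by the martingale convergence theorem, and the running average
forgets the tail of a convergent series. -/
theorem ae_tendsto_runAvg_real [IsFiniteMeasure μ] {ξ : ℕ → Ω → ℝ} (h : IsMartingaleNoise μ ℱ ξ)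
    {α : ℕ → ℝ} (hα0 : ∀ n, 0 ≤ α n) (hα1 : ∀ n, α n ≤ 1)
    (hαsum : Tendsto (fun n => ∑ k ∈ Finset.range n, α k) atTop atTop)
    (hαsq : Summable fun n => α n ^ 2) {b : ℝ} (hb : ∀ n, lpNorm (ξ n) 2 μ ≤ b) :
    ∀ᵐ ω ∂μ, Tendsto (fun n => runAvg α ξ n ω) atTop (𝓝 0) := by
  have hb0 : 0 ≤ b := lpNorm_nonneg.trans (hb 0)
  set s : ℕ → Ω → ℝ := fun n => ∑ k ∈ Finset.range n, α k • ξ k with hs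
  have hs_succ : ∀ n, s (n + 1) = s n + α n • ξ n := fun n => Finset.sum_range_succ _ _
  have hs_meas : ∀ n, StronglyMeasurable[ℱ n] (s n) := by
    intro n
    induction n with
    | zero => exact stronglyMeasurable_const (b := (0 : ℝ))
    | succ n ih =>
      rw [hs_succ]
      exact (ih.mono (ℱ.mono (Nat.le_succ n))).add ((h.adapted n).const_smul _)
  have hs_mem : ∀ n, MemLp (s n) 2 μ := by
    intro n
    induction n with
    | zero => simp [hs]
    | succ n ih =>
      rw [hs_succ]
      exact ih.add ((h.memLp n).const_smul _)
  have hcond : ∀ n, μ[α n • ξ n | ℱ n] =ᵐ[μ] 0 := fun n => by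
    refine (condExp_smul (α n) (ξ n) (ℱ n)).trans ?_
    filter_upwards [h.condExp_eq_zero n] with ω hω
    simp [hω]
  have hmart : Martingale s ℱ μ := by
    refine martingale_of_condExp_sub_eq_zero_nat hs_meas
      (fun n => (hs_mem n).integrable (by norm_num)) fun n => ?_
    rw [hs_succ, add_sub_cancel_left]
    exact hcond n
  have hsq : ∀ n, ∫ ω, ‖s n ω‖ ^ 2 ∂μ ≤ (∑ k ∈ Finset.range n, α k ^ 2) * b ^ 2 := by
    intro n
    induction n with
    | zero => simp [hs]
    | succ n ih =>
      have e1 := integral_norm_add_sq_of_condExp_eq_zero (ℱ.le n) (hs_meas n) (hs_mem n)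
        ((h.memLp n).const_smul (α n)) (hcond n)
      have e2 : ∫ ω, ‖(α n • ξ n) ω‖ ^ 2 ∂μ = α n ^ 2 * ∫ ω, ‖ξ n ω‖ ^ 2 ∂μ := by
        rw [← integral_const_mul]
        congr 1
        funext ω
        rw [Pi.smul_apply, norm_smul, mul_pow, Real.norm_eq_abs, sq_abs]
      have e3 := mul_le_mul_of_nonneg_left (integral_le_of_lpNorm_le (h.memLp n) (hb n))
        (sq_nonneg (α n))
      rw [hs_succ, Finset.sum_range_succ, add_mul]
      simp only [Pi.add_apply]
      linarith
  have hlp : ∀ n, lpNorm (s n) 2 μ ≤ √(∑' k, α k ^ 2) * b := by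
    intro n
    refine lpNorm_two_le_of_integral_le (hs_mem n) (by positivity) ((hsq n).trans ?_)
    rw [mul_pow, Real.sq_sqrt (tsum_nonneg fun k => sq_nonneg _)]
    gcongr
    exact hαsq.sum_le_tsum _ fun k _ => sq_nonneg _
  obtain ⟨R, hR⟩ : ∃ R : NNReal, ∀ n, eLpNorm (s n) 1 μ ≤ R := by
    set R := ENNReal.ofReal (√(∑' k, α k ^ 2) * b) * μ Set.univ ^ (1 / (1 : ENNReal).toReal
        - 1 / (2 : ENNReal).toReal) with hR
    have hfin : R ≠ ⊤ := by
      refine ENNReal.mul_ne_top ENNReal.ofReal_ne_top (ENNReal.rpow_ne_top_of_nonneg ?_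
        (measure_ne_top μ _))
      norm_num
    refine ⟨R.toNNReal, fun n => ?_⟩
    rw [ENNReal.coe_toNNReal hfin, hR]
    refine (eLpNorm_le_eLpNorm_mul_rpow_measure_univ (q := 2) (by norm_num)
      (hs_mem n).aestronglyMeasurable).trans ?_
    gcongr
    rw [← ofReal_lpNorm (hs_mem n)]
    exact ENNReal.ofReal_le_ofReal (hlp n)
  filter_upwards [hmart.submartingale.exists_ae_tendsto_of_bdd hR] with ω ⟨ℓ, hω⟩
  have hdiff : Tendsto (fun n => s n ω - ℓ) atTop (𝓝 0) := by
    simpa using hω.sub_const ℓ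
  have hB : Tendsto (fun n => |runAvg α ξ n ω - (s n ω - ℓ)|) atTop (𝓝 0) := by
    refine tendsto_zero_of_recursion one_pos (fun n => abs_nonneg _) hα0
      (Eventually.of_forall fun n => by linarith [hα1 n]) hαsum (e := fun n => |s n ω - ℓ|)
      (by simpa using hdiff.abs) (Eventually.of_forall fun n => ?_)
    have e1 : runAvg α ξ (n + 1) ω - (s (n + 1) ω - ℓ)
        = (1 - α n) * (runAvg α ξ n ω - (s n ω - ℓ)) + -(α n * (s n ω - ℓ)) := by
      simp only [runAvg, hs_succ, Pi.add_apply, Pi.smul_apply, smul_eq_mul]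
      ring
    rw [e1, one_mul]
    refine (abs_add_le _ _).trans (le_of_eq ?_)
    rw [abs_mul, abs_neg, abs_mul, abs_of_nonneg (hα0 n),
      abs_of_nonneg (sub_nonneg.2 (hα1 n))]
  have := ((tendsto_zero_iff_abs_tendsto_zero _).2 hB).add hdiff
  simpa using this

theorem ae_tendsto_runAvg {E : Type*} [NormedAddCommGroup E] [NormedSpace ℝ E]
    [FiniteDimensional ℝ E] [CompleteSpace E] [IsFiniteMeasure μ] {ξ : ℕ → Ω → E}
    (h : IsMartingaleNoise μ ℱ ξ)
    {α : ℕ → ℝ} (hα0 : ∀ n, 0 ≤ α n) (hα1 : ∀ n, α n ≤ 1)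
    (hαsum : Tendsto (fun n => ∑ k ∈ Finset.range n, α k) atTop atTop)
    (hαsq : Summable fun n => α n ^ 2) {b : ℝ} (hb : ∀ n, lpNorm (ξ n) 2 μ ≤ b) :
    ∀ᵐ ω ∂μ, Tendsto (fun n => runAvg α ξ n ω) atTop (𝓝 0) := by
  set T := Module.finBasis ℝ E |>.equivFunL with hT
  have hcoord : ∀ i, ∀ᵐ ω ∂μ, Tendsto (fun n => T (runAvg α ξ n ω) i) atTop (𝓝 0) := by
    intro i
    set φ : E →L[ℝ] ℝ := (ContinuousLinearMap.proj i).comp T.toContinuousLinearMap with hφ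
    have h1 := ae_tendsto_runAvg_real (h.map φ) hα0 hα1 hαsum hαsq (b := ‖φ‖ * b)
      fun n => (lpNorm_clm_le φ (h.memLp n)).trans
        (mul_le_mul_of_nonneg_left (hb n) (norm_nonneg _))
    filter_upwards [h1] with ω hω
    refine hω.congr fun n => ?_
    rw [runAvg_apply, runAvg_apply]
    exact (map_runAvg (φ : E →ₗ[ℝ] ℝ) α (fun k => ξ k ω) n).symm
  filter_upwards [ae_all_iff.2 hcoord] with ω hω
  have h1 : Tendsto (fun n => T (runAvg α ξ n ω)) atTop (𝓝 0) := tendsto_pi_nhds.2 hω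
  have h2 := (T.symm.continuous.tendsto 0).comp h1
  simpa [Function.comp_def] using h2

end TwoTimeScale

/-! ### The Poisson equation of the chain -/

namespace TwoTimeScale

variable {S : Type*} [Fintype S]

/-- Harmonic functions of an irreducible chain are constant (maximum principle). -/
theorem IsIrreducibleChain.harmonic_const {P : Matrix S S ℝ} {π : S → ℝ}
    (h : IsIrreducibleChain P π) {v : S → ℝ} (hv : P *ᵥ v = v) (i j : S) : v i = v j := by
  classical
  have hnn := h.irreducible.nonneg
  have hpow := (Matrix.isIrreducible_iff_exists_pow_pos hnn).1 h.irreducible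
  have h1 : P *ᵥ (1 : S → ℝ) = 1 := by
    funext i
    simpa [Matrix.mulVec, dotProduct] using h.row_sum i
  have hvk : ∀ k : ℕ, (P ^ k) *ᵥ v = v := fun k => by
    induction k with
    | zero => simp
    | succ k ih => rw [pow_succ, ← Matrix.mulVec_mulVec, hv, ih]
  have h1k : ∀ k : ℕ, (P ^ k) *ᵥ (1 : S → ℝ) = 1 := fun k => by
    induction k with
    | zero => simp
    | succ k ih => rw [pow_succ, ← Matrix.mulVec_mulVec, h1, ih]
  have hnnk : ∀ (k : ℕ) (i j : S), 0 ≤ (P ^ k) i j := fun k => by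
    induction k with
    | zero => intro i j; rw [pow_zero, Matrix.one_apply]; split_ifs <;> norm_num
    | succ k ih =>
      intro i j
      rw [pow_succ, Matrix.mul_apply]
      exact Finset.sum_nonneg fun l _ => mul_nonneg (ih i l) (hnn l j)
  obtain ⟨m, -, hm⟩ := Finset.exists_max_image Finset.univ v ⟨i, Finset.mem_univ i⟩
  have key : ∀ j, v j = v m := by
    intro j
    obtain ⟨k, -, hk⟩ := hpow m j
    have e1 : ∑ l, (P ^ k) m l * (v m - v l) = 0 := by
      have a1 := congrFun (hvk k) m
      have a2 := congrFun (h1k k) m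
      simp only [Matrix.mulVec, dotProduct, Pi.one_apply, mul_one] at a1 a2
      simp_rw [mul_sub]
      rw [Finset.sum_sub_distrib, ← Finset.sum_mul, a2, a1]
      ring
    have e2 := (Finset.sum_eq_zero_iff_of_nonneg fun l _ => mul_nonneg (hnnk k m l)
      (sub_nonneg.2 (hm l (Finset.mem_univ l)))).1 e1 j (Finset.mem_univ j)
    rcases mul_eq_zero.1 e2 with e3 | e3
    · exact absurd e3 hk.ne'
    · linarith
  rw [key i, key j]

/-- A matrix `Q` such that `Q h` solves the Poisson equation of the chain with right-hand side
`h - π h`, namely `Q = (1 - P + 𝟙 πᵀ)⁻¹`. -/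
theorem IsIrreducibleChain.exists_poisson {P : Matrix S S ℝ} {π : S → ℝ}
    (h : IsIrreducibleChain P π) : ∃ Q : Matrix S S ℝ, ∀ (E : Type*) [AddCommGroup E]
      [Module ℝ E] (w : S → E) (i : S),
      w i - ∑ j, π j • w j = (∑ k, Q i k • w k) - ∑ j, P i j • ∑ k, Q j k • w k := by
  classical
  set W : Matrix S S ℝ := Matrix.of fun _ j => π j with hW
  set A : Matrix S S ℝ := 1 - P + W with hA
  have hπP : ∀ j, ∑ i, π i * P i j = π j := fun j => by
    simpa [Matrix.vecMul, dotProduct] using congrFun h.π_stationary j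
  have hWv : ∀ (v : S → ℝ) i, (W *ᵥ v) i = ∑ j, π j * v j := fun v i => by
    simp [hW, Matrix.mulVec, dotProduct]
  have hπW : π ᵥ* W = π := by
    funext j
    simp [hW, Matrix.vecMul, dotProduct, ← Finset.sum_mul, h.π_sum]
  have hπA : π ᵥ* A = π := by
    rw [hA, Matrix.vecMul_add, Matrix.vecMul_sub, Matrix.vecMul_one, h.π_stationary, hπW, sub_self,
      zero_add]
  have hinj : Function.Injective A.mulVec := by
    rw [← Matrix.coe_mulVecLin, injective_iff_map_eq_zero]
    intro v hv
    rw [Matrix.mulVecLin_apply] at hv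
    have hπv : π ⬝ᵥ v = 0 := by
      rw [← hπA, ← Matrix.dotProduct_mulVec, hv, dotProduct_zero]
    have hWv0 : W *ᵥ v = 0 := by
      funext i
      rw [hWv]
      exact hπv
    have hPv : P *ᵥ v = v := by
      rw [hA, Matrix.add_mulVec, Matrix.sub_mulVec, Matrix.one_mulVec, hWv0, add_zero,
        sub_eq_zero] at hv
      exact hv.symm
    have hconst := h.harmonic_const hPv
    funext i
    have e1 : π ⬝ᵥ v = v i := by
      simp only [dotProduct]
      rw [Finset.sum_congr rfl fun j _ => by rw [hconst j i], ← Finset.sum_mul, h.π_sum, one_mul]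
    rw [← e1, hπv]
    rfl
  have hunit : IsUnit A := Matrix.mulVec_injective_iff_isUnit.1 hinj
  set Q := A⁻¹ with hQ
  have hAQ : A * Q = 1 := Matrix.mul_nonsing_inv _ ((Matrix.isUnit_iff_isUnit_det A).1 hunit)
  have hπQ : π ᵥ* Q = π := by
    have : π ᵥ* (A * Q) = π := by rw [hAQ, Matrix.vecMul_one]
    rwa [← Matrix.vecMul_vecMul, hπA] at this
  have hWQ : W * Q = W := by
    ext i j
    have := congrFun hπQ j
    simpa [hW, Matrix.mul_apply, Matrix.vecMul, dotProduct] using this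
  have hmain : Q - P * Q = 1 - W := by
    have : A * Q = Q - P * Q + W := by rw [hA, add_mul, sub_mul, one_mul, hWQ]
    rw [hAQ] at this
    rw [this]
    abel
  refine ⟨Q, fun E _ _ w i => ?_⟩
  have e1 : ∑ j, P i j • ∑ k, Q j k • w k = ∑ k, (P * Q) i k • w k := by
    simp_rw [Finset.smul_sum, smul_smul, Matrix.mul_apply, Finset.sum_smul]
    exact Finset.sum_comm
  have e2 : ∑ k, (1 - W) i k • w k = w i - ∑ j, π j • w j := by
    simp [hW, sub_smul, Matrix.one_apply, Finset.sum_sub_distrib, ite_smul]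
  rw [e1, ← e2, ← hmain, ← Finset.sum_sub_distrib]
  exact Finset.sum_congr rfl fun k _ => by rw [Matrix.sub_apply, sub_smul]

end TwoTimeScale

/-! ### Pathwise error recursion -/

namespace TwoTimeScale

/-- The properties of the step sizes that enter the pathwise analysis; `ρ = β / α`. -/
structure StepBounds (T : ℝ) (α β ρ : ℕ → ℝ) : Prop where
  α_pos : ∀ n, 0 < α n
  α_le : ∀ n, α n ≤ 1
  ρ_pos : ∀ n, 0 < ρ n
  ρ_le : ∀ n, ρ n ≤ T
  β_eq : ∀ n, β n = ρ n * α n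
  α_diff : ∀ n, |α (n + 1) - α n| ≤ T * α n * α n
  β_diff : ∀ n, |β (n + 1) - β n| ≤ T * β n * α n
  ρ_diff : ∀ n, |ρ n - ρ (n + 1)| ≤ T * β n

/-- The slow step replaced by the fast one: this is the sense in which one estimate covers both
time scales. -/
theorem StepBounds.fast {T : ℝ} {α β ρ : ℕ → ℝ} (h : StepBounds T α β ρ) (hT : 1 ≤ T) :
    StepBounds T α α fun _ => 1 where
  α_pos := h.α_pos
  α_le := h.α_le
  ρ_pos _ := one_pos
  ρ_le _ := hT
  β_eq _ := (one_mul _).symm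
  α_diff := h.α_diff
  β_diff := h.α_diff
  ρ_diff n := by
    have := h.α_pos n
    simp only [sub_self, abs_zero]
    positivity

section

set_option linter.unusedSectionVars false

variable {X Y S : Type*} [NormedAddCommGroup X] [NormedSpace ℝ X] [NormedAddCommGroup Y]
  [NormedSpace ℝ Y]

/-- Quantitative properties of the averaged maps `fb`, `gb`, of the fixed points `xs y` and `ys`,
and of the Poisson solutions `Hf`, `Hg`, all with one constant `T`; `1 - c` is the contraction
factor. -/
structure MeanField (c T : ℝ) (fb : X → Y → X) (gb : X → Y → Y) (xs : Y → X) (ys : Y)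
    (Hf : X → Y → S → X) (Hg : X → Y → S → Y) : Prop where
  contr_f : ∀ x y, ‖fb x y - xs y‖ ≤ (1 - c) * ‖x - xs y‖
  contr_g : ∀ y, ‖gb (xs y) y - ys‖ ≤ (1 - c) * ‖y - ys‖
  lip_f : ∀ x₁ x₂ y₁ y₂, ‖fb x₁ y₁ - fb x₂ y₂‖ ≤ T * (‖x₁ - x₂‖ + ‖y₁ - y₂‖)
  lip_g : ∀ x₁ x₂ y₁ y₂, ‖gb x₁ y₁ - gb x₂ y₂‖ ≤ T * (‖x₁ - x₂‖ + ‖y₁ - y₂‖)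
  growth_f : ∀ x y, ‖fb x y‖ ≤ T * (1 + ‖x‖ + ‖y‖)
  growth_g : ∀ x y, ‖gb x y‖ ≤ T * (1 + ‖x‖ + ‖y‖)
  lip_xs : ∀ y₁ y₂, ‖xs y₁ - xs y₂‖ ≤ T * ‖y₁ - y₂‖
  norm_xs : ‖xs ys‖ ≤ T
  norm_ys : ‖ys‖ ≤ T
  lip_Hf : ∀ x₁ x₂ y₁ y₂ i, ‖Hf x₁ y₁ i - Hf x₂ y₂ i‖ ≤ T * (‖x₁ - x₂‖ + ‖y₁ - y₂‖)
  lip_Hg : ∀ x₁ x₂ y₁ y₂ i, ‖Hg x₁ y₁ i - Hg x₂ y₂ i‖ ≤ T * (‖x₁ - x₂‖ + ‖y₁ - y₂‖)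
  growth_Hf : ∀ x y i, ‖Hf x y i‖ ≤ T * (1 + ‖x‖ + ‖y‖)
  growth_Hg : ∀ x y i, ‖Hg x y i‖ ≤ T * (1 + ‖x‖ + ‖y‖)

/-- A path of the scheme after the Poisson equation has been used: the noise is the sum of the
martingale difference `ξ` and the increment `H(x_n, y_n, Z_n) - H(x_n, y_n, Z_{n+1})`. -/
structure IsPath (T : ℝ) (α β : ℕ → ℝ) (fb : X → Y → X) (gb : X → Y → Y)
    (Hf : X → Y → S → X) (Hg : X → Y → S → Y) (x : ℕ → X) (y : ℕ → Y) (z : ℕ → S)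
    (ξ : ℕ → X) (ξ' : ℕ → Y) : Prop where
  step_x : ∀ n, x (n + 1) = x n + α n • (fb (x n) (y n) + ξ n + Hf (x n) (y n) (z n)
    - Hf (x n) (y n) (z (n + 1)) - x n)
  step_y : ∀ n, y (n + 1) = y n + β n • (gb (x n) (y n) + ξ' n + Hg (x n) (y n) (z n)
    - Hg (x n) (y n) (z (n + 1)) - y n)
  norm_ξ : ∀ n, ‖ξ n‖ ≤ T * (1 + ‖x n‖ + ‖y n‖)
  norm_ξ' : ∀ n, ‖ξ' n‖ ≤ T * (1 + ‖x n‖ + ‖y n‖)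

/-- One step of an iterate `w`, corrected by the Poisson solution `h` and the averaged noise `D`.
Here `h₁` is the Poisson solution with only the chain advanced. The noise `ξ` cancels, since the
increment of `ρ D` contains it with weight `ρ α = γ`. -/
theorem norm_corrected_step_le {E : Type*} [NormedAddCommGroup E] [NormedSpace ℝ E]
    {T G : ℝ} {α γ ρ : ℕ → ℝ} (hs : StepBounds T α γ ρ) (hT : 1 ≤ T) (hG : 0 ≤ G) (n : ℕ)
    {w w' F ξ h h₁ h' D D' : E} (hw : w' = w + γ n • (F + ξ + h - h₁ - w))
    (hD : D' = (1 - α n) • D + α n • ξ) (hh : ‖h‖ ≤ T * G) (hh' : ‖h'‖ ≤ 11 * T ^ 3 * G)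
    (hh₁ : ‖h' - h₁‖ ≤ 10 * T ^ 3 * α n * G) :
    ‖(w' + γ (n + 1) • h' - ρ (n + 1) • D') - (1 - γ n) • (w + γ n • h - ρ n • D) - γ n • F‖
      ≤ 22 * T ^ 4 * γ n * (‖D‖ + ‖D'‖ + α n * G) := by
  have hα := hs.α_pos n
  have hα1 := hs.α_le n
  have hρ := hs.ρ_pos n
  have hρT := hs.ρ_le n
  have hγ := hs.β_eq n
  have hγ0 : 0 ≤ γ n := by rw [hγ]; positivity
  have hid : (w' + γ (n + 1) • h' - ρ (n + 1) • D') - (1 - γ n) • (w + γ n • h - ρ n • D) - γ n • F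
      = γ n • (h' - h₁) + (γ n * γ n) • h + (γ (n + 1) - γ n) • h' + (γ n * (1 - ρ n)) • D
        + (ρ n - ρ (n + 1)) • D' := by
    rw [hw, hD, hγ]
    module
  rw [hid]
  have hT0 : 0 ≤ T := by linarith
  have e1 : ‖γ n • (h' - h₁)‖ ≤ γ n * (10 * T ^ 3 * α n * G) := by
    rw [norm_smul, Real.norm_eq_abs, abs_of_nonneg hγ0]
    gcongr
  have e2 : ‖(γ n * γ n) • h‖ ≤ γ n * (T * α n) * (T * G) := by
    rw [norm_smul, Real.norm_eq_abs, abs_of_nonneg (by positivity)]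
    have : γ n ≤ T * α n := by rw [hγ]; gcongr
    gcongr
  have e3 : ‖(γ (n + 1) - γ n) • h'‖ ≤ (T * γ n * α n) * (11 * T ^ 3 * G) := by
    rw [norm_smul, Real.norm_eq_abs]
    have := hs.β_diff n
    gcongr
  have e4 : ‖(γ n * (1 - ρ n)) • D‖ ≤ γ n * T * ‖D‖ := by
    rw [norm_smul, Real.norm_eq_abs, abs_mul, abs_of_nonneg hγ0]
    have : |1 - ρ n| ≤ T := abs_le.2 ⟨by linarith, by linarith⟩
    gcongr
  have e5 : ‖(ρ n - ρ (n + 1)) • D'‖ ≤ (T * γ n) * ‖D'‖ := by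
    rw [norm_smul, Real.norm_eq_abs]
    have := hs.ρ_diff n
    gcongr
  have e6 := norm_add_le (γ n • (h' - h₁) + (γ n * γ n) • h + (γ (n + 1) - γ n) • h'
    + (γ n * (1 - ρ n)) • D) ((ρ n - ρ (n + 1)) • D')
  have e7 := norm_add_le (γ n • (h' - h₁) + (γ n * γ n) • h + (γ (n + 1) - γ n) • h')
    ((γ n * (1 - ρ n)) • D)
  have e8 := norm_add₃_le (a := γ n • (h' - h₁)) (b := (γ n * γ n) • h)
    (c := (γ (n + 1) - γ n) • h')
  have t1 : T ≤ T ^ 4 := le_self_pow₀ hT (by norm_num)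
  have t2 : T ^ 2 ≤ T ^ 4 := pow_le_pow_right₀ hT (by norm_num)
  have t3 : T ^ 3 ≤ T ^ 4 := pow_le_pow_right₀ hT (by norm_num)
  have f1 : γ n * T * ‖D‖ ≤ 22 * T ^ 4 * γ n * ‖D‖ := by
    have : γ n * ‖D‖ * T ≤ γ n * ‖D‖ * (22 * T ^ 4) := by gcongr; linarith [pow_nonneg hT0 4]
    linarith
  have f2 : (T * γ n) * ‖D'‖ ≤ 22 * T ^ 4 * γ n * ‖D'‖ := by
    have : γ n * ‖D'‖ * T ≤ γ n * ‖D'‖ * (22 * T ^ 4) := by gcongr; linarith [pow_nonneg hT0 4]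
    linarith
  have f3 : γ n * (10 * T ^ 3 * α n * G) + γ n * (T * α n) * (T * G)
      + (T * γ n * α n) * (11 * T ^ 3 * G) ≤ 22 * T ^ 4 * γ n * (α n * G) := by
    have : γ n * (α n * G) * (10 * T ^ 3 + T ^ 2 + 11 * T ^ 4)
        ≤ γ n * (α n * G) * (22 * T ^ 4) := by gcongr; linarith
    nlinarith
  nlinarith

variable {c T : ℝ} {α β ρ : ℕ → ℝ} {fb : X → Y → X} {gb : X → Y → Y} {xs : Y → X} {ys : Y}
  {Hf : X → Y → S → X} {Hg : X → Y → S → Y} {x : ℕ → X} {y : ℕ → Y} {z : ℕ → S} {ξ : ℕ → X}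
  {ξ' : ℕ → Y}

/-- A step of either iterate is at most of the order of its step size times the size of the
iterates. -/
theorem norm_step_le {E : Type*} [NormedAddCommGroup E] [NormedSpace ℝ E] {T G γ : ℝ}
    (hγ : 0 ≤ γ) (hT : 1 ≤ T) {w w' F ξ h h₁ : E} (hw' : w' = w + γ • (F + ξ + h - h₁ - w))
    (hF : ‖F‖ ≤ T * G) (hξ : ‖ξ‖ ≤ T * G) (hh : ‖h‖ ≤ T * G) (hh₁ : ‖h₁‖ ≤ T * G)
    (hwG : ‖w‖ ≤ G) : ‖w' - w‖ ≤ 5 * T * γ * G := by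
  rw [hw', add_sub_cancel_left, norm_smul, Real.norm_eq_abs, abs_of_nonneg hγ]
  have h1 := norm_sub_le (F + ξ + h - h₁) w
  have h2 := norm_sub_le (F + ξ + h) h₁
  have h3 := norm_add₃_le (a := F) (b := ξ) (c := h)
  have h4 : G ≤ T * G := le_mul_of_one_le_left ((norm_nonneg w).trans hwG) hT
  have h5 : ‖F + ξ + h - h₁ - w‖ ≤ 5 * T * G := by linarith
  nlinarith

theorem IsPath.norm_step_x_le (hp : IsPath T α β fb gb Hf Hg x y z ξ ξ')
    (hm : MeanField c T fb gb xs ys Hf Hg) (hs : StepBounds T α β ρ) (hT : 1 ≤ T) (n : ℕ) :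
    ‖x (n + 1) - x n‖ ≤ 5 * T * α n * (1 + ‖x n‖ + ‖y n‖) :=
  norm_step_le (hs.α_pos n).le hT (hp.step_x n) (hm.growth_f _ _) (hp.norm_ξ n)
    (hm.growth_Hf _ _ _) (hm.growth_Hf _ _ _) (by linarith [norm_nonneg (y n)])

theorem IsPath.norm_step_y_le (hp : IsPath T α β fb gb Hf Hg x y z ξ ξ')
    (hm : MeanField c T fb gb xs ys Hf Hg) (hs : StepBounds T α β ρ) (hT : 1 ≤ T) (n : ℕ) :
    ‖y (n + 1) - y n‖ ≤ 5 * T ^ 2 * α n * (1 + ‖x n‖ + ‖y n‖) := by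
  have hα := hs.α_pos n
  have hρ := hs.ρ_pos n
  have hβ : 0 ≤ β n := by rw [hs.β_eq]; positivity
  have h1 := norm_step_le hβ hT (hp.step_y n) (hm.growth_g _ _) (hp.norm_ξ' n)
    (hm.growth_Hg _ _ _) (hm.growth_Hg _ _ _)
    (by linarith [norm_nonneg (x n)] : ‖y n‖ ≤ 1 + ‖x n‖ + ‖y n‖)
  have h2 : β n ≤ T * α n := by rw [hs.β_eq]; gcongr; exact hs.ρ_le n
  calc _ ≤ 5 * T * β n * (1 + ‖x n‖ + ‖y n‖) := h1
    _ ≤ 5 * T * (T * α n) * (1 + ‖x n‖ + ‖y n‖) := by gcongr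
    _ = _ := by ring

theorem IsPath.size_step_le (hp : IsPath T α β fb gb Hf Hg x y z ξ ξ')
    (hm : MeanField c T fb gb xs ys Hf Hg) (hs : StepBounds T α β ρ) (hT : 1 ≤ T) (n : ℕ) :
    1 + ‖x (n + 1)‖ + ‖y (n + 1)‖ ≤ 11 * T ^ 2 * (1 + ‖x n‖ + ‖y n‖) := by
  have h1 := hp.norm_step_x_le hm hs hT n
  have h2 := hp.norm_step_y_le hm hs hT n
  have h3 := norm_le_norm_add_norm_sub (x n) (x (n + 1))
  have h4 := norm_le_norm_add_norm_sub (y n) (y (n + 1))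
  rw [norm_sub_rev] at h3 h4
  set G := 1 + ‖x n‖ + ‖y n‖ with hG
  have hG0 : 0 ≤ G := by positivity
  have t1 : T ≤ T ^ 2 := le_self_pow₀ hT (by norm_num)
  have t2 : 1 ≤ T ^ 2 := one_le_pow₀ hT
  have hα := hs.α_le n
  have hα0 := (hs.α_pos n).le
  have h5 : 5 * T * α n * G ≤ 5 * T ^ 2 * 1 * G := by gcongr
  have h6 : 5 * T ^ 2 * α n * G ≤ 5 * T ^ 2 * 1 * G := by gcongr
  nlinarith

/-- The corrected fast iterate. -/
def correctedX (α : ℕ → ℝ) (Hf : X → Y → S → X) (x : ℕ → X) (y : ℕ → Y) (z : ℕ → S) (ξ : ℕ → X)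
    (n : ℕ) : X :=
  x n + α n • Hf (x n) (y n) (z n) - runAvg α ξ n

/-- The corrected slow iterate. Its noise is averaged with the fast step sizes, then weighted with
`ρ = β / α`. -/
def correctedY (α β ρ : ℕ → ℝ) (Hg : X → Y → S → Y) (x : ℕ → X) (y : ℕ → Y) (z : ℕ → S)
    (ξ' : ℕ → Y) (n : ℕ) : Y :=
  y n + β n • Hg (x n) (y n) (z n) - ρ n • runAvg α ξ' n

/-- The corrected iterates follow the averaged maps, up to errors relative to the step sizes. -/
theorem IsPath.corrected_estimates (hp : IsPath T α β fb gb Hf Hg x y z ξ ξ')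
    (hm : MeanField c T fb gb xs ys Hf Hg) (hs : StepBounds T α β ρ) (hT : 1 ≤ T) (n : ℕ) :
    (‖correctedX α Hf x y z ξ (n + 1) - (1 - α n) • correctedX α Hf x y z ξ n
        - α n • fb (x n) (y n)‖ ≤ 22 * T ^ 4 * α n *
        (‖runAvg α ξ n‖ + ‖runAvg α ξ (n + 1)‖ + α n * (1 + ‖x n‖ + ‖y n‖))) ∧
    (‖correctedY α β ρ Hg x y z ξ' (n + 1) - (1 - β n) • correctedY α β ρ Hg x y z ξ' n
        - β n • gb (x n) (y n)‖ ≤ 22 * T ^ 4 * β n *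
        (‖runAvg α ξ' n‖ + ‖runAvg α ξ' (n + 1)‖ + α n * (1 + ‖x n‖ + ‖y n‖))) := by
  have hG : 0 ≤ 1 + ‖x n‖ + ‖y n‖ := by positivity
  have hinc : T * (‖x (n + 1) - x n‖ + ‖y (n + 1) - y n‖)
      ≤ 10 * T ^ 3 * α n * (1 + ‖x n‖ + ‖y n‖) := by
    have h1 := hp.norm_step_x_le hm hs hT n
    have h2 := hp.norm_step_y_le hm hs hT n
    have hα0 := (hs.α_pos n).le
    have t1 : T ≤ T ^ 2 := le_self_pow₀ hT (by norm_num)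
    have h3 : 5 * T * α n * (1 + ‖x n‖ + ‖y n‖) ≤ 5 * T ^ 2 * α n * (1 + ‖x n‖ + ‖y n‖) := by
      gcongr
    calc _ ≤ T * (5 * T ^ 2 * α n * (1 + ‖x n‖ + ‖y n‖)
          + 5 * T ^ 2 * α n * (1 + ‖x n‖ + ‖y n‖)) := by gcongr; linarith
      _ = _ := by ring
  have hsize : T * (1 + ‖x (n + 1)‖ + ‖y (n + 1)‖) ≤ 11 * T ^ 3 * (1 + ‖x n‖ + ‖y n‖) := by
    calc _ ≤ T * (11 * T ^ 2 * (1 + ‖x n‖ + ‖y n‖)) := by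
          gcongr; exact hp.size_step_le hm hs hT n
      _ = _ := by ring
  constructor
  · have := norm_corrected_step_le (hs.fast hT) hT hG n (hp.step_x n)
      (rfl : runAvg α ξ (n + 1) = _) (hm.growth_Hf _ _ _)
      ((hm.growth_Hf _ _ (z (n + 1))).trans hsize)
      ((hm.lip_Hf _ _ _ _ _).trans hinc)
    simpa only [correctedX, one_smul] using this
  · exact norm_corrected_step_le hs hT hG n (hp.step_y n)
      (rfl : runAvg α ξ' (n + 1) = _) (hm.growth_Hg _ _ _)
      ((hm.growth_Hg _ _ (z (n + 1))).trans hsize)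
      ((hm.lip_Hg _ _ _ _ _).trans hinc)

theorem norm_sub_correctedX_le (hm : MeanField c T fb gb xs ys Hf Hg) (hs : StepBounds T α β ρ)
    (hT : 1 ≤ T) (n : ℕ) : ‖x n - correctedX α Hf x y z ξ n‖
      ≤ T ^ 2 * (‖runAvg α ξ n‖ + α n * (1 + ‖x n‖ + ‖y n‖)) := by
  have h0 : x n - correctedX α Hf x y z ξ n = runAvg α ξ n - α n • Hf (x n) (y n) (z n) := by
    unfold correctedX; abel
  have hα0 := (hs.α_pos n).le
  rw [h0]
  refine (norm_sub_le _ _).trans ?_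
  rw [norm_smul, Real.norm_eq_abs, abs_of_nonneg hα0]
  have t1 : T ≤ T ^ 2 := le_self_pow₀ hT (by norm_num)
  have t2 : 1 ≤ T ^ 2 := one_le_pow₀ hT
  calc _ ≤ 1 * ‖runAvg α ξ n‖ + α n * (T * (1 + ‖x n‖ + ‖y n‖)) := by
        rw [one_mul]; gcongr; exact hm.growth_Hf _ _ _
    _ = 1 * ‖runAvg α ξ n‖ + T * (α n * (1 + ‖x n‖ + ‖y n‖)) := by ring
    _ ≤ T ^ 2 * ‖runAvg α ξ n‖ + T ^ 2 * (α n * (1 + ‖x n‖ + ‖y n‖)) := by gcongr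
    _ = _ := by ring

theorem norm_sub_correctedY_le (hm : MeanField c T fb gb xs ys Hf Hg) (hs : StepBounds T α β ρ)
    (hT : 1 ≤ T) (n : ℕ) : ‖y n - correctedY α β ρ Hg x y z ξ' n‖
      ≤ T ^ 2 * (‖runAvg α ξ' n‖ + α n * (1 + ‖x n‖ + ‖y n‖)) := by
  have h0 : y n - correctedY α β ρ Hg x y z ξ' n
      = ρ n • runAvg α ξ' n - β n • Hg (x n) (y n) (z n) := by
    unfold correctedY; abel
  have hα0 := (hs.α_pos n).le
  have hρ0 := (hs.ρ_pos n).le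
  have hβ0 : 0 ≤ β n := by rw [hs.β_eq]; positivity
  rw [h0]
  refine (norm_sub_le _ _).trans ?_
  rw [norm_smul, norm_smul, Real.norm_eq_abs, Real.norm_eq_abs, abs_of_nonneg hρ0,
    abs_of_nonneg hβ0, hs.β_eq]
  have t1 : T ≤ T ^ 2 := le_self_pow₀ hT (by norm_num)
  have hρT := hs.ρ_le n
  calc _ ≤ T * ‖runAvg α ξ' n‖ + T * α n * (T * (1 + ‖x n‖ + ‖y n‖)) := by
        gcongr; exact hm.growth_Hg _ _ _
    _ ≤ T ^ 2 * ‖runAvg α ξ' n‖ + T * α n * (T * (1 + ‖x n‖ + ‖y n‖)) := by gcongr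
    _ = _ := by ring

/-- The constant of the error recursion, for system constant `T`. -/
def recConst (T : ℝ) : ℝ :=
  11 * T ^ 2 + (2 + 3 * T + 2 * T ^ 2) + (2 + T) * (1 + T + T ^ 2) + (22 * T ^ 4 + 2 * T ^ 3 + T)
    + (22 * T ^ 4 + 2 * T ^ 3 + T * (22 * T ^ 5 + (T + 1) + T ^ 3))

/-- Each estimate below has one of the summands of `recConst` as its constant. -/
theorem le_recConst (hT : 1 ≤ T) :
    1 ≤ recConst T ∧ 11 * T ^ 2 ≤ recConst T ∧ 2 + 3 * T + 2 * T ^ 2 ≤ recConst T ∧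
      (2 + T) * (1 + T + T ^ 2) ≤ recConst T ∧ 22 * T ^ 4 + 2 * T ^ 3 + T ≤ recConst T ∧
      22 * T ^ 4 + 2 * T ^ 3 + T * (22 * T ^ 5 + (T + 1) + T ^ 3) ≤ recConst T := by
  have h0 : 0 ≤ T := by linarith
  have h1 : 0 ≤ 11 * T ^ 2 := by positivity
  have h2 : 0 ≤ 3 * T + 2 * T ^ 2 := by positivity
  have h3 : 0 ≤ (2 + T) * (1 + T + T ^ 2) := by positivity
  have h4 : 0 ≤ 22 * T ^ 4 + 2 * T ^ 3 + T := by positivity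
  have h5 : 0 ≤ 22 * T ^ 4 + 2 * T ^ 3 + T * (22 * T ^ 5 + (T + 1) + T ^ 3) := by positivity
  unfold recConst
  refine ⟨?_, ?_, ?_, ?_, ?_, ?_⟩ <;> linarith

set_option maxHeartbeats 1000000 in
/-- The errors satisfy the scalar recursion along every path. -/
theorem IsPath.errorRecursion (hp : IsPath T α β fb gb Hf Hg x y z ξ ξ')
    (hm : MeanField c T fb gb xs ys Hf Hg) (hs : StepBounds T α β ρ) (hT : 1 ≤ T) :
    ErrorRecursion c (recConst T) α β (fun n => α n + ρ n)
      (fun n => ‖correctedX α Hf x y z ξ n - xs (correctedY α β ρ Hg x y z ξ' n)‖)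
      (fun n => ‖correctedY α β ρ Hg x y z ξ' n - ys‖)
      (fun n => ‖runAvg α ξ n‖ + ‖runAvg α ξ' n‖)
      (fun n => 1 + ‖x n‖ + ‖y n‖) := by
  set p := correctedX α Hf x y z ξ with hp_def
  set q := correctedY α β ρ Hg x y z ξ' with hq_def
  set D := runAvg α ξ with hD
  set D' := runAvg α ξ' with hD'
  obtain ⟨c1, c2, c3, c4, c5, c6⟩ := le_recConst hT
  have hT0 : 0 ≤ T := by linarith
  set C := recConst T
  have hx : ∀ n, ‖x n - p n‖ ≤ T ^ 2 * (‖D n‖ + α n * (1 + ‖x n‖ + ‖y n‖)) := fun n =>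
    norm_sub_correctedX_le hm hs hT n
  have hy : ∀ n, ‖y n - q n‖ ≤ T ^ 2 * (‖D' n‖ + α n * (1 + ‖x n‖ + ‖y n‖)) := fun n =>
    norm_sub_correctedY_le hm hs hT n
  have hcoarse : ∀ n, ‖D n‖ + α n * (1 + ‖x n‖ + ‖y n‖) ≤
        ‖D n‖ + ‖D' n‖ + (α n + ρ n) * (1 + ‖x n‖ + ‖y n‖) ∧
      ‖D' n‖ + α n * (1 + ‖x n‖ + ‖y n‖) ≤
        ‖D n‖ + ‖D' n‖ + (α n + ρ n) * (1 + ‖x n‖ + ‖y n‖) ∧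
      α n * (1 + ‖x n‖ + ‖y n‖) ≤ (α n + ρ n) * (1 + ‖x n‖ + ‖y n‖) ∧
      ρ n * (1 + ‖x n‖ + ‖y n‖) ≤ (α n + ρ n) * (1 + ‖x n‖ + ‖y n‖) := by
    intro n
    have h1 := mul_nonneg (hs.ρ_pos n).le (by positivity : 0 ≤ 1 + ‖x n‖ + ‖y n‖)
    have h2 := mul_nonneg (hs.α_pos n).le (by positivity : 0 ≤ 1 + ‖x n‖ + ‖y n‖)
    have h3 := norm_nonneg (D n)
    have h4 := norm_nonneg (D' n)
    refine ⟨?_, ?_, ?_, ?_⟩ <;> linarith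
  refine ⟨fun n => norm_nonneg _, fun n => norm_nonneg _, fun n => by positivity,
    fun n => by linarith [norm_nonneg (x n), norm_nonneg (y n)], ?_, ?_, ?_, ?_, ?_⟩
  · intro n
    obtain ⟨k1, k2, k3, k4⟩ := hcoarse n
    have ex := (hx n).trans (mul_le_mul_of_nonneg_left k1 (sq_nonneg T))
    have ey := (hy n).trans (mul_le_mul_of_nonneg_left k2 (sq_nonneg T))
    obtain ⟨rx, ry⟩ := hp.corrected_estimates hm hs hT n
    rw [← hp_def, ← hD] at rx
    rw [← hq_def, ← hD'] at ry
    have hα := hs.α_pos n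
    have hα1 := hs.α_le n
    have hρ := hs.ρ_pos n
    have hρT := hs.ρ_le n
    have hβ : 0 ≤ β n := by rw [hs.β_eq]; positivity
    have hβT : β n ≤ T * α n := by rw [hs.β_eq]; gcongr
    have hG : 0 ≤ 1 + ‖x n‖ + ‖y n‖ := by positivity
    set G := 1 + ‖x n‖ + ‖y n‖ with hGdef
    have hE0 : 0 ≤ ‖D n‖ + ‖D' n‖ + (α n + ρ n) * G := by positivity
    set E := ‖D n‖ + ‖D' n‖ + (α n + ρ n) * G with hE
    set E' := ‖D n‖ + ‖D' n‖ + (‖D (n + 1)‖ + ‖D' (n + 1)‖) + (α n + ρ n) * G with hE'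
    have hEE' : E ≤ E' := by
      rw [hE, hE']; linarith [norm_nonneg (D (n + 1)), norm_nonneg (D' (n + 1))]
    have rx' : ‖p (n + 1) - (1 - α n) • p n - α n • fb (x n) (y n)‖ ≤ 22 * T ^ 4 * α n * E' := by
      refine rx.trans ?_
      gcongr
      rw [hE']
      linarith [norm_nonneg (D' (n + 1)), norm_nonneg (D' n)]
    have ry' : ‖q (n + 1) - (1 - β n) • q n - β n • gb (x n) (y n)‖ ≤ 22 * T ^ 4 * β n * E' := by
      refine ry.trans ?_
      gcongr
      rw [hE']
      linarith [norm_nonneg (D (n + 1)), norm_nonneg (D n)]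
    have hf1 : ‖fb (x n) (y n) - xs (q n)‖ ≤ 2 * T ^ 3 * E + (1 - c) * ‖p n - xs (q n)‖ := by
      have a1 := norm_sub_le_norm_sub_add_norm_sub (fb (x n) (y n)) (fb (p n) (q n)) (xs (q n))
      have a2 := hm.lip_f (x n) (p n) (y n) (q n)
      have a3 := hm.contr_f (p n) (q n)
      have a4 := mul_le_mul_of_nonneg_left (add_le_add ex ey) hT0
      linarith
    have hq1 : ‖q (n + 1) - q n‖ ≤ α n * ((22 * T ^ 5 + (T + 1) + T ^ 3) * E') := by
      have a0 : q (n + 1) - q n = (q (n + 1) - (1 - β n) • q n - β n • gb (x n) (y n))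
          + β n • (gb (x n) (y n) - q n) := by module
      have a1 : ‖gb (x n) (y n) - q n‖ ≤ (T + 1) * G + T ^ 2 * E := by
        have b1 := norm_sub_le (gb (x n) (y n)) (q n)
        have b2 := hm.growth_g (x n) (y n)
        have b3 := norm_le_norm_add_norm_sub (y n) (q n)
        have b4 := norm_nonneg (x n)
        linarith
      rw [a0]
      refine (norm_add_le _ _).trans ?_
      rw [norm_smul, Real.norm_eq_abs, abs_of_nonneg hβ]
      have a2 := mul_le_mul_of_nonneg_left a1 hβ
      have a3 : β n * G ≤ α n * E' := by
        have : β n * G = α n * (ρ n * G) := by rw [hs.β_eq]; ring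
        rw [this]
        gcongr
        linarith [norm_nonneg (D n), norm_nonneg (D' n)]
      have a4 : β n * E ≤ T * α n * E' := by gcongr
      have a5 : β n * E' ≤ T * α n * E' := by
        have := hE0.trans hEE'
        gcongr
      have a6 := mul_le_mul_of_nonneg_left a3 (by linarith : 0 ≤ T + 1)
      have a7 := mul_le_mul_of_nonneg_left a4 (sq_nonneg T)
      have a8 := mul_le_mul_of_nonneg_left a5 (by positivity : 0 ≤ 22 * T ^ 4)
      calc _ ≤ 22 * T ^ 4 * (β n * E') + (T + 1) * (β n * G) + T ^ 2 * (β n * E) := by linarith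
        _ ≤ 22 * T ^ 4 * (T * α n * E') + (T + 1) * (α n * E') + T ^ 2 * (T * α n * E') := by
          linarith
        _ = _ := by ring
    have hid : p (n + 1) - xs (q (n + 1))
        = (p (n + 1) - (1 - α n) • p n - α n • fb (x n) (y n)) + (1 - α n) • (p n - xs (q n))
          + α n • (fb (x n) (y n) - xs (q n)) + (xs (q n) - xs (q (n + 1))) := by module
    have b1 := norm_add_le ((p (n + 1) - (1 - α n) • p n - α n • fb (x n) (y n))
      + (1 - α n) • (p n - xs (q n)) + α n • (fb (x n) (y n) - xs (q n)))
      (xs (q n) - xs (q (n + 1)))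
    have b2 := norm_add₃_le (a := p (n + 1) - (1 - α n) • p n - α n • fb (x n) (y n))
      (b := (1 - α n) • (p n - xs (q n))) (c := α n • (fb (x n) (y n) - xs (q n)))
    rw [← hid] at b1
    rw [norm_smul, norm_smul, Real.norm_eq_abs, Real.norm_eq_abs, abs_of_nonneg hα.le,
      abs_of_nonneg (sub_nonneg.2 hα1)] at b2
    have b3 := mul_le_mul_of_nonneg_left hf1 hα.le
    have b4 := hm.lip_xs (q n) (q (n + 1))
    rw [norm_sub_rev (q n)] at b4
    have b5 := mul_le_mul_of_nonneg_left hq1 hT0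
    have b6 : α n * (2 * T ^ 3 * E) ≤ α n * (2 * T ^ 3 * E') := by gcongr
    have b7 : (22 * T ^ 4 + 2 * T ^ 3 + T * (22 * T ^ 5 + (T + 1) + T ^ 3)) * (α n * E')
        ≤ C * (α n * E') :=
      mul_le_mul_of_nonneg_right c6 (mul_nonneg hα.le (hE0.trans hEE'))
    linarith
  · intro n hβ1
    obtain ⟨k1, k2, k3, k4⟩ := hcoarse n
    have ex := (hx n).trans (mul_le_mul_of_nonneg_left k1 (sq_nonneg T))
    have ey := (hy n).trans (mul_le_mul_of_nonneg_left k2 (sq_nonneg T))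
    obtain ⟨-, ry⟩ := hp.corrected_estimates hm hs hT n
    rw [← hq_def, ← hD'] at ry
    have hα := hs.α_pos n
    have hρ := hs.ρ_pos n
    have hβ : 0 ≤ β n := by rw [hs.β_eq]; positivity
    have hG : 0 ≤ 1 + ‖x n‖ + ‖y n‖ := by positivity
    set G := 1 + ‖x n‖ + ‖y n‖ with hGdef
    have hE0 : 0 ≤ ‖D n‖ + ‖D' n‖ + (α n + ρ n) * G := by positivity
    set E := ‖D n‖ + ‖D' n‖ + (α n + ρ n) * G with hE
    set U := ‖p n - xs (q n)‖ with hU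
    have hU0 : 0 ≤ U := norm_nonneg _
    set E' := U + (‖D n‖ + ‖D' n‖) + (‖D (n + 1)‖ + ‖D' (n + 1)‖) + (α n + ρ n) * G with hE'
    have hEE' : U + E ≤ E' := by
      rw [hE, hE']; linarith [norm_nonneg (D (n + 1)), norm_nonneg (D' (n + 1))]
    have ry' : ‖q (n + 1) - (1 - β n) • q n - β n • gb (x n) (y n)‖ ≤ 22 * T ^ 4 * β n * E' := by
      refine ry.trans ?_
      gcongr
      rw [hE']
      linarith [norm_nonneg (D (n + 1)), norm_nonneg (D n)]
    have hg1 : ‖gb (x n) (y n) - ys‖ ≤ 2 * T ^ 3 * E + T * U + (1 - c) * ‖q n - ys‖ := by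
      have a1 := norm_sub_le_norm_sub_add_norm_sub (gb (x n) (y n)) (gb (p n) (q n)) ys
      have a2 := hm.lip_g (x n) (p n) (y n) (q n)
      have a3 := norm_sub_le_norm_sub_add_norm_sub (gb (p n) (q n)) (gb (xs (q n)) (q n)) ys
      have a4 := hm.lip_g (p n) (xs (q n)) (q n) (q n)
      have a5 := hm.contr_g (q n)
      have a6 := mul_le_mul_of_nonneg_left (add_le_add ex ey) hT0
      rw [sub_self, norm_zero, add_zero] at a4
      linarith
    have hid : q (n + 1) - ys = (q (n + 1) - (1 - β n) • q n - β n • gb (x n) (y n))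
        + (1 - β n) • (q n - ys) + β n • (gb (x n) (y n) - ys) := by module
    have b2 := norm_add₃_le (a := q (n + 1) - (1 - β n) • q n - β n • gb (x n) (y n))
      (b := (1 - β n) • (q n - ys)) (c := β n • (gb (x n) (y n) - ys))
    rw [← hid, norm_smul, norm_smul, Real.norm_eq_abs, Real.norm_eq_abs, abs_of_nonneg hβ,
      abs_of_nonneg (sub_nonneg.2 hβ1)] at b2
    have b3 := mul_le_mul_of_nonneg_left hg1 hβ
    have b4 : β n * (2 * T ^ 3 * E) ≤ β n * (2 * T ^ 3 * E') := by
      gcongr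
      linarith
    have b5 : β n * (T * U) ≤ β n * (T * E') := by
      gcongr
      linarith
    have b7 : (22 * T ^ 4 + 2 * T ^ 3 + T) * (β n * E') ≤ C * (β n * E') :=
      mul_le_mul_of_nonneg_right c5 (mul_nonneg hβ (by linarith))
    linarith
  · intro n
    obtain ⟨k1, k2, -, -⟩ := hcoarse n
    have ex := (hx n).trans (mul_le_mul_of_nonneg_left k1 (sq_nonneg T))
    have ey := (hy n).trans (mul_le_mul_of_nonneg_left k2 (sq_nonneg T))
    have hα := hs.α_pos n
    have hρ := hs.ρ_pos n
    have hE0 : 0 ≤ ‖D n‖ + ‖D' n‖ + (α n + ρ n) * (1 + ‖x n‖ + ‖y n‖) := by positivity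
    set E := ‖D n‖ + ‖D' n‖ + (α n + ρ n) * (1 + ‖x n‖ + ‖y n‖) with hE
    have hU0 := norm_nonneg (p n - xs (q n))
    have hV0 := norm_nonneg (q n - ys)
    have a1 : ‖y n‖ ≤ ‖y n - q n‖ + ‖q n - ys‖ + ‖ys‖ := by
      have : y n = (y n - q n) + (q n - ys) + ys := by abel
      calc ‖y n‖ = ‖(y n - q n) + (q n - ys) + ys‖ := by rw [← this]
        _ ≤ _ := norm_add₃_le
    have a2 : ‖x n‖ ≤ ‖x n - p n‖ + ‖p n - xs (q n)‖ + (‖xs (q n) - xs ys‖ + ‖xs ys‖) := by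
      have : x n = (x n - p n) + (p n - xs (q n)) + ((xs (q n) - xs ys) + xs ys) := by abel
      calc ‖x n‖ = ‖(x n - p n) + (p n - xs (q n)) + ((xs (q n) - xs ys) + xs ys)‖ := by
            rw [← this]
        _ ≤ ‖x n - p n‖ + ‖p n - xs (q n)‖ + ‖(xs (q n) - xs ys) + xs ys‖ := norm_add₃_le
        _ ≤ _ := by gcongr; exact norm_add_le _ _
    have a3 := hm.lip_xs (q n) ys
    have a4 := hm.norm_xs
    have a5 := hm.norm_ys
    have a6 : (2 + 3 * T + 2 * T ^ 2) * (1 + ‖p n - xs (q n)‖ + ‖q n - ys‖ + E)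
        ≤ C * (1 + ‖p n - xs (q n)‖ + ‖q n - ys‖ + E) := by gcongr
    have n1 := mul_nonneg hT0 hV0
    have n2 := mul_nonneg hT0 hU0
    have n3 := mul_nonneg hT0 hE0
    have n4 := mul_nonneg (sq_nonneg T) hU0
    have n5 := mul_nonneg (sq_nonneg T) hV0
    have n6 := mul_nonneg (sq_nonneg T) hE0
    have n7 := sq_nonneg T
    have hgoal : C * (1 + ‖p n - xs (q n)‖ + ‖q n - ys‖ + (‖D n‖ + ‖D' n‖)
        + (α n + ρ n) * (1 + ‖x n‖ + ‖y n‖))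
        = C * (1 + ‖p n - xs (q n)‖ + ‖q n - ys‖ + E) := by rw [hE]; ring
    rw [hgoal]
    refine le_trans ?_ a6
    ring_nf at *
    linarith
  · intro n
    have hα := hs.α_pos n
    have hα1 := hs.α_le n
    have hG : 0 ≤ 1 + ‖x n‖ + ‖y n‖ := by positivity
    have hD0 := norm_nonneg (D n)
    have hD'0 := norm_nonneg (D' n)
    have ex : ‖x n - p n‖ ≤ T ^ 2 * ((1 + ‖x n‖ + ‖y n‖) + (‖D n‖ + ‖D' n‖)) := by
      refine (hx n).trans (mul_le_mul_of_nonneg_left ?_ (sq_nonneg T))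
      linarith [mul_le_of_le_one_left hG hα1]
    have ey : ‖y n - q n‖ ≤ T ^ 2 * ((1 + ‖x n‖ + ‖y n‖) + (‖D n‖ + ‖D' n‖)) := by
      refine (hy n).trans (mul_le_mul_of_nonneg_left ?_ (sq_nonneg T))
      linarith [mul_le_of_le_one_left hG hα1]
    set F := (1 + ‖x n‖ + ‖y n‖) + (‖D n‖ + ‖D' n‖) with hF
    have hxF : 1 + ‖x n‖ + ‖y n‖ ≤ F := by linarith
    have hF0 : 0 ≤ F := by linarith
    have a1 : ‖q n - ys‖ ≤ ‖y n - q n‖ + ‖y n‖ + ‖ys‖ := by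
      have : q n - ys = -(y n - q n) + y n + -ys := by abel
      rw [this]
      refine norm_add₃_le.trans ?_
      rw [norm_neg, norm_neg]
    have a2 : ‖p n - xs (q n)‖ ≤ ‖x n - p n‖ + ‖x n‖ + (‖xs (q n) - xs ys‖ + ‖xs ys‖) := by
      have : p n - xs (q n) = -(x n - p n) + x n + -((xs (q n) - xs ys) + xs ys) := by abel
      rw [this]
      refine norm_add₃_le.trans ?_
      rw [norm_neg, norm_neg]
      gcongr
      exact norm_add_le _ _
    have a3 := hm.lip_xs (q n) ys
    have a4 := hm.norm_xs
    have a5 := hm.norm_ys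
    have a6 : (2 + T) * (1 + T + T ^ 2) * F ≤ C * F := by gcongr
    have a7 : ‖q n - ys‖ ≤ T ^ 2 * F + ‖y n‖ + T := by linarith
    have a8 := mul_le_mul_of_nonneg_left a7 hT0
    have a9 : ‖x n‖ + (1 + T) * ‖y n‖ + (2 + T) * T ≤ (2 + T) * (1 + T) * F := by
      have b1 := mul_le_mul_of_nonneg_left hxF (by positivity : 0 ≤ (2 + T) * (1 + T))
      have b2 := norm_nonneg (x n)
      have b3 := norm_nonneg (y n)
      nlinarith [mul_nonneg hT0 b2, mul_nonneg hT0 b3, mul_nonneg (mul_nonneg hT0 hT0) b2,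
        mul_nonneg (mul_nonneg hT0 hT0) b3]
    refine le_trans ?_ a6
    linarith
  · intro n
    refine (hp.size_step_le hm hs hT n).trans ?_
    gcongr

/-- The passage back from the corrected errors to the errors of the iterates. -/
theorem norm_error_le (hm : MeanField c T fb gb xs ys Hf Hg) (hs : StepBounds T α β ρ)
    (hT : 1 ≤ T) (n : ℕ) :
    ‖x n - xs ys‖ + ‖y n - ys‖ ≤ recConst T *
      (‖correctedX α Hf x y z ξ n - xs (correctedY α β ρ Hg x y z ξ' n)‖
        + ‖correctedY α β ρ Hg x y z ξ' n - ys‖ + (‖runAvg α ξ n‖ + ‖runAvg α ξ' n‖)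
        + (α n + ρ n) * (1 + ‖x n‖ + ‖y n‖)) := by
  have hT0 : 0 ≤ T := by linarith
  obtain ⟨-, -, c3, -, -, -⟩ := le_recConst hT
  have hx := norm_sub_correctedX_le (x := x) (y := y) (z := z) (ξ := ξ) hm hs hT n
  have hy := norm_sub_correctedY_le (x := x) (y := y) (z := z) (ξ' := ξ') hm hs hT n
  set p := correctedX α Hf x y z ξ
  set q := correctedY α β ρ Hg x y z ξ'
  have a1 : ‖x n - xs ys‖ ≤ ‖x n - p n‖ + ‖p n - xs (q n)‖ + ‖xs (q n) - xs ys‖ := by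
    have : x n - xs ys = (x n - p n) + (p n - xs (q n)) + (xs (q n) - xs ys) := by abel
    rw [this]
    exact norm_add₃_le
  have a2 := norm_sub_le_norm_sub_add_norm_sub (y n) (q n) ys
  have a3 := hm.lip_xs (q n) ys
  have hU0 := norm_nonneg (p n - xs (q n))
  have hV0 := norm_nonneg (q n - ys)
  have hα := hs.α_pos n
  have hρ := hs.ρ_pos n
  have hG : 0 ≤ 1 + ‖x n‖ + ‖y n‖ := by positivity
  have hαG := mul_nonneg hα.le hG
  have hρG := mul_nonneg hρ.le hG
  have hD0 := norm_nonneg (runAvg α ξ n)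
  have hD'0 := norm_nonneg (runAvg α ξ' n)
  have e1 : ‖runAvg α ξ n‖ + α n * (1 + ‖x n‖ + ‖y n‖) + (‖runAvg α ξ' n‖
      + α n * (1 + ‖x n‖ + ‖y n‖)) ≤ 2 * (‖runAvg α ξ n‖ + ‖runAvg α ξ' n‖
        + (α n + ρ n) * (1 + ‖x n‖ + ‖y n‖)) := by linarith
  have hE0 : 0 ≤ ‖runAvg α ξ n‖ + ‖runAvg α ξ' n‖ + (α n + ρ n) * (1 + ‖x n‖ + ‖y n‖) := by
    positivity
  have e2 := mul_le_mul_of_nonneg_left e1 (sq_nonneg T)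
  have e3 := mul_le_mul_of_nonneg_right c3 (add_nonneg (add_nonneg hU0 hV0) hE0)
  set E := ‖runAvg α ξ n‖ + ‖runAvg α ξ' n‖ + (α n + ρ n) * (1 + ‖x n‖ + ‖y n‖)
  rw [add_assoc _ (‖runAvg α ξ n‖ + _)]
  refine le_trans ?_ e3
  nlinarith [mul_nonneg hT0 hU0, mul_nonneg hT0 hV0, mul_nonneg hT0 hE0,
    mul_nonneg (sq_nonneg T) hU0, mul_nonneg (sq_nonneg T) hV0]

end

end TwoTimeScale

/-! ### Constants of the scheme -/

namespace TwoTimeScale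

/-- The lower bounds imposed on the constant `T` that serves throughout the pathwise analysis; `q`
bounds the Poisson matrices and `1 - c` the contraction factors. -/
structure ConstBounds (c K L q α₀ β₀ T : ℝ) : Prop where
  one_le : 1 ≤ T
  lip : L ≤ T
  growth : K ≤ T
  poisson_lip : q * L ≤ T
  poisson_growth : q * K ≤ T
  noise : K + 2 * (q * K) ≤ T
  lip_fixed : L / c ≤ T
  norm_ys : K * (1 + K / c) / c ≤ T
  norm_xs : L / c * (K * (1 + K / c) / c) + K / c ≤ T
  ratio : β₀ / α₀ ≤ T
  inv : 1 / α₀ ≤ T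

theorem exists_constBounds {c K L q α₀ β₀ : ℝ} (hc : 0 < c) (hK : 0 < K) (hL : 0 ≤ L)
    (hq : 0 ≤ q) (hα₀ : 0 < α₀) (hβ₀ : 0 < β₀) : ∃ T, ConstBounds c K L q α₀ β₀ T := by
  have h1 : 0 ≤ q * L := by positivity
  have h2 : 0 ≤ q * K := by positivity
  have h3 : 0 ≤ L / c := by positivity
  have h4 : 0 ≤ K * (1 + K / c) / c := by positivity
  have h5 : 0 ≤ L / c * (K * (1 + K / c) / c) := by positivity
  have h6 : 0 ≤ β₀ / α₀ := by positivity
  have h7 : 0 ≤ 1 / α₀ := by positivity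
  have h8 : 0 ≤ K / c := by positivity
  refine ⟨1 + L + (K + 2 * (q * K)) + q * L + L / c + K * (1 + K / c) / c
    + (L / c * (K * (1 + K / c) / c) + K / c) + β₀ / α₀ + 1 / α₀, ?_⟩
  constructor <;> linarith

theorem stepBounds {c K L q α₀ β₀ T a : ℝ} (h : ConstBounds c K L q α₀ β₀ T) (hα₀ : 0 < α₀)
    (hα1 : α₀ < 1) (hβ₀ : 0 < β₀) (ha0 : 0 ≤ a) (ha1 : a ≤ 1) :
    StepBounds T (alphaStep α₀ a) (betaStep β₀) (stepRatio α₀ β₀ a) := by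
  have hT := h.inv
  have hρ : 0 < β₀ / α₀ := by positivity
  have hinv : ∀ n, decay 1 n ≤ T * alphaStep α₀ a n := fun n => by
    rw [alphaStep_eq]
    calc decay 1 n ≤ decay a n := decay_le_decay ha1 n
      _ = 1 / α₀ * (α₀ * decay a n) := by field_simp
      _ ≤ _ := mul_le_mul_of_nonneg_right hT (mul_nonneg hα₀.le (decay_pos a n).le)
  constructor
  · intro n; rw [alphaStep_eq]; exact mul_pos hα₀ (decay_pos a n)
  · intro n
    rw [alphaStep_eq]
    nlinarith [decay_pos a n, decay_le_one ha0 n]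
  · intro n; exact mul_pos hρ (decay_pos _ n)
  · intro n
    refine le_trans ?_ h.ratio
    exact mul_le_of_le_one_right hρ.le (decay_le_one (by linarith) n)
  · exact fun n => betaStep_eq_ratio_mul β₀ a hα₀.ne' n
  · intro n
    have h1 := mul_le_mul_of_nonneg_left (decay_sub_le ha0 ha1 n) hα₀.le
    have h2 := mul_le_mul_of_nonneg_right (hinv n) (mul_nonneg hα₀.le (decay_pos a n).le)
    simp only [alphaStep_eq] at h2 ⊢
    rw [← mul_sub, abs_mul, abs_of_pos hα₀]
    linarith
  · intro n
    have h1 := mul_le_mul_of_nonneg_left (decay_sub_le zero_le_one le_rfl n) hβ₀.le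
    have h2 := mul_le_mul_of_nonneg_right (hinv n) (mul_nonneg hβ₀.le (decay_pos 1 n).le)
    simp only [betaStep_eq] at h2 ⊢
    rw [← mul_sub, abs_mul, abs_of_pos hβ₀]
    linarith
  · intro n
    have h1 := mul_le_mul_of_nonneg_left
      (decay_sub_le (by linarith : 0 ≤ 1 - a) (by linarith) n) hρ.le
    have h2 := mul_le_mul_of_nonneg_right (hinv n) (mul_pos hρ (decay_pos (1 - a) n)).le
    rw [betaStep_eq_ratio_mul β₀ a hα₀.ne' n, abs_sub_comm]
    simp only [stepRatio] at h2 ⊢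
    rw [← mul_sub, abs_mul, abs_of_pos hρ]
    linarith

section

set_option linter.unusedSectionVars false

variable {X Y S : Type*} [Fintype S] [NormedAddCommGroup X] [NormedSpace ℝ X]
  [NormedAddCommGroup Y] [NormedSpace ℝ Y]

theorem norm_avg_le {E : Type*} [NormedAddCommGroup E] [NormedSpace ℝ E] {π : S → ℝ}
    (h0 : ∀ i, 0 ≤ π i) (h1 : ∑ i, π i = 1) {v : S → E} {b : ℝ} (hv : ∀ i, ‖v i‖ ≤ b) :
    ‖∑ i, π i • v i‖ ≤ b := by
  calc ‖∑ i, π i • v i‖ ≤ ∑ i, π i * b := by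
        refine norm_sum_le_of_le _ fun i _ => ?_
        rw [norm_smul, Real.norm_eq_abs, abs_of_nonneg (h0 i)]
        exact mul_le_mul_of_nonneg_left (hv i) (h0 i)
    _ = b := by rw [← Finset.sum_mul, h1, one_mul]

/-- The action of a Poisson matrix on a family of maps indexed by the states. -/
def poissonMap {E : Type*} [AddCommGroup E] [Module ℝ E] (Q : Matrix S S ℝ) (f : X → Y → S → E)
    (x : X) (y : Y) (i : S) : E :=
  ∑ k, Q i k • f x y k

/-- The sum of the absolute values of the entries of `Q`. -/
def entrySum (Q : Matrix S S ℝ) : ℝ := ∑ i, ∑ k, |Q i k|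

theorem entrySum_nonneg (Q : Matrix S S ℝ) : 0 ≤ entrySum Q :=
  Finset.sum_nonneg fun _ _ => Finset.sum_nonneg fun _ _ => abs_nonneg _

theorem norm_matrix_sum_le {E : Type*} [NormedAddCommGroup E] [NormedSpace ℝ E]
    (Q : Matrix S S ℝ) {v : S → E} {b : ℝ} (hb : 0 ≤ b) (hv : ∀ i, ‖v i‖ ≤ b) (i : S) :
    ‖∑ k, Q i k • v k‖ ≤ entrySum Q * b := by
  calc ‖∑ k, Q i k • v k‖ ≤ ∑ k, |Q i k| * b := by
        refine norm_sum_le_of_le _ fun k _ => ?_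
        rw [norm_smul, Real.norm_eq_abs]
        exact mul_le_mul_of_nonneg_left (hv k) (abs_nonneg _)
    _ = (∑ k, |Q i k|) * b := by rw [Finset.sum_mul]
    _ ≤ entrySum Q * b := by
      refine mul_le_mul_of_nonneg_right ?_ hb
      exact Finset.single_le_sum (f := fun i => ∑ k, |Q i k|)
        (fun _ _ => Finset.sum_nonneg fun _ _ => abs_nonneg _) (Finset.mem_univ i)

variable {c lam mu K L q α₀ β₀ T : ℝ} {P : Matrix S S ℝ} {π : S → ℝ} {f : X → Y → S → X}
  {g : X → Y → S → Y}

theorem norm_poissonMap_le {E : Type*} [NormedAddCommGroup E] [NormedSpace ℝ E]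
    {Q : Matrix S S ℝ} (hQ : entrySum Q ≤ q) (hK : 0 ≤ K) (hT : q * K ≤ T) {h : X → Y → S → E}
    (hh : ∀ x y i, ‖h x y i‖ ≤ K * (1 + ‖x‖ + ‖y‖)) (x : X) (y : Y) (i : S) :
    ‖poissonMap Q h x y i‖ ≤ T * (1 + ‖x‖ + ‖y‖) := by
  have hG : 0 ≤ 1 + ‖x‖ + ‖y‖ := by positivity
  calc _ ≤ entrySum Q * (K * (1 + ‖x‖ + ‖y‖)) :=
        norm_matrix_sum_le Q (mul_nonneg hK hG) (hh x y) i
    _ ≤ q * (K * (1 + ‖x‖ + ‖y‖)) := by gcongr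
    _ = q * K * (1 + ‖x‖ + ‖y‖) := by ring
    _ ≤ _ := by gcongr

theorem norm_poissonMap_sub_le {E : Type*} [NormedAddCommGroup E] [NormedSpace ℝ E]
    {Q : Matrix S S ℝ} (hQ : entrySum Q ≤ q) (hL : 0 ≤ L) (hT : q * L ≤ T) {h : X → Y → S → E}
    (hh : ∀ x₁ x₂ y₁ y₂ i, ‖h x₁ y₁ i - h x₂ y₂ i‖ ≤ L * (‖x₁ - x₂‖ + ‖y₁ - y₂‖))
    (x₁ x₂ : X) (y₁ y₂ : Y) (i : S) :
    ‖poissonMap Q h x₁ y₁ i - poissonMap Q h x₂ y₂ i‖ ≤ T * (‖x₁ - x₂‖ + ‖y₁ - y₂‖) := by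
  have hG : 0 ≤ ‖x₁ - x₂‖ + ‖y₁ - y₂‖ := by positivity
  have e : poissonMap Q h x₁ y₁ i - poissonMap Q h x₂ y₂ i
      = ∑ k, Q i k • (h x₁ y₁ k - h x₂ y₂ k) := by
    simp only [poissonMap, smul_sub, Finset.sum_sub_distrib]
  rw [e]
  calc _ ≤ entrySum Q * (L * (‖x₁ - x₂‖ + ‖y₁ - y₂‖)) :=
        norm_matrix_sum_le Q (mul_nonneg hL hG) (hh x₁ x₂ y₁ y₂) i
    _ ≤ q * (L * (‖x₁ - x₂‖ + ‖y₁ - y₂‖)) := by gcongr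
    _ = q * L * (‖x₁ - x₂‖ + ‖y₁ - y₂‖) := by ring
    _ ≤ _ := by gcongr

/-- A contractive system has the quantitative properties used in the pathwise analysis. -/
theorem IsContractiveSystem.meanField [FiniteDimensional ℝ X] [FiniteDimensional ℝ Y]
    (h : IsContractiveSystem π lam mu K L f g) (hch : IsIrreducibleChain P π)
    (hT : ConstBounds c K L q α₀ β₀ T) (hc : 0 < c) (hK : 0 < K) (hL : 0 ≤ L)
    (hlam0 : 0 ≤ lam) (hmu0 : 0 ≤ mu) (hlam : lam ≤ 1 - c) (hmu : mu ≤ 1 - c)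
    {Q Q' : Matrix S S ℝ} (hQ : entrySum Q ≤ q) (hQ' : entrySum Q' ≤ q) :
    MeanField c T (avg π f) (avg π g) (xStarOf π f) (yStar π f g) (poissonMap Q f)
      (poissonMap Q' g) := by
  have hfix : ∀ y, avg π f (xStarOf π f y) y = xStarOf π f y := fun y =>
    (fixedPt_spec hlam0 (by linarith : lam < 1) fun e₁ e₂ => h.contractive_f e₁ e₂ y).1
  have hfixy : avg π g (xStarOf π f (yStar π f g)) (yStar π f g) = yStar π f g :=
    (fixedPt_spec hmu0 (by linarith : mu < 1) fun e₁ e₂ => h.contractive_g e₁ e₂).1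
  have hgf : ∀ x y i, ‖f x y i‖ ≤ K * (1 + ‖x‖ + ‖y‖) := fun x y i => by
    linarith [h.growth x y i, norm_nonneg (g x y i)]
  have hgg : ∀ x y i, ‖g x y i‖ ≤ K * (1 + ‖x‖ + ‖y‖) := fun x y i => by
    linarith [h.growth x y i, norm_nonneg (f x y i)]
  have hga : ∀ x y, ‖avg π f x y‖ ≤ K * (1 + ‖x‖ + ‖y‖) := fun x y =>
    norm_avg_le hch.π_nonneg hch.π_sum (hgf x y)
  have hgb : ∀ x y, ‖avg π g x y‖ ≤ K * (1 + ‖x‖ + ‖y‖) := fun x y =>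
    norm_avg_le hch.π_nonneg hch.π_sum (hgg x y)
  have hla : ∀ x₁ x₂ y₁ y₂, ‖avg π f x₁ y₁ - avg π f x₂ y₂‖
      ≤ L * (‖x₁ - x₂‖ + ‖y₁ - y₂‖) := fun x₁ x₂ y₁ y₂ => by
    have e : avg π f x₁ y₁ - avg π f x₂ y₂ = ∑ i, π i • (f x₁ y₁ i - f x₂ y₂ i) := by
      simp only [avg, smul_sub, Finset.sum_sub_distrib]
    rw [e]
    exact norm_avg_le hch.π_nonneg hch.π_sum (h.lipschitz_f x₁ x₂ y₁ y₂)
  have hlb : ∀ x₁ x₂ y₁ y₂, ‖avg π g x₁ y₁ - avg π g x₂ y₂‖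
      ≤ L * (‖x₁ - x₂‖ + ‖y₁ - y₂‖) := fun x₁ x₂ y₁ y₂ => by
    have e : avg π g x₁ y₁ - avg π g x₂ y₂ = ∑ i, π i • (g x₁ y₁ i - g x₂ y₂ i) := by
      simp only [avg, smul_sub, Finset.sum_sub_distrib]
    rw [e]
    exact norm_avg_le hch.π_nonneg hch.π_sum (h.lipschitz_g x₁ x₂ y₁ y₂)
  have hxs : ∀ y₁ y₂, ‖xStarOf π f y₁ - xStarOf π f y₂‖ ≤ L / c * ‖y₁ - y₂‖ := fun y₁ y₂ => by
    have e1 := norm_sub_le_norm_sub_add_norm_sub (avg π f (xStarOf π f y₁) y₁)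
      (avg π f (xStarOf π f y₂) y₁) (avg π f (xStarOf π f y₂) y₂)
    have e2 := h.contractive_f (xStarOf π f y₁) (xStarOf π f y₂) y₁
    have e3 := hla (xStarOf π f y₂) (xStarOf π f y₂) y₁ y₂
    rw [hfix y₁, hfix y₂] at e1
    rw [hfix y₁] at e2
    rw [hfix y₂, sub_self, norm_zero, zero_add] at e3
    rw [div_mul_eq_mul_div, le_div_iff₀ hc]
    have e4 := mul_le_mul_of_nonneg_right hlam (norm_nonneg (xStarOf π f y₁ - xStarOf π f y₂))
    linarith
  have hxs0 : ‖xStarOf π f 0‖ ≤ K / c := by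
    have e1 := h.contractive_f (xStarOf π f 0) 0 0
    have e2 := norm_le_norm_add_norm_sub (avg π f 0 0) (avg π f (xStarOf π f 0) 0)
    have e3 := hga 0 0
    rw [norm_sub_rev, hfix] at e2
    rw [hfix, sub_zero] at e1
    rw [norm_zero, norm_zero] at e3
    rw [le_div_iff₀ hc]
    have e4 := mul_le_mul_of_nonneg_right hlam (norm_nonneg (xStarOf π f 0))
    linarith
  have hys : ‖yStar π f g‖ ≤ K * (1 + K / c) / c := by
    have e1 := h.contractive_g (yStar π f g) 0
    have e2 := norm_le_norm_add_norm_sub (avg π g (xStarOf π f 0) 0)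
      (avg π g (xStarOf π f (yStar π f g)) (yStar π f g))
    have e3 := hgb (xStarOf π f 0) 0
    rw [hfixy] at e1 e2
    rw [norm_sub_rev] at e2
    rw [sub_zero] at e1
    rw [norm_zero] at e3
    rw [le_div_iff₀ hc]
    have e4 := mul_le_mul_of_nonneg_right hmu (norm_nonneg (yStar π f g))
    have e5 := mul_le_mul_of_nonneg_left hxs0 hK.le
    linarith
  have hLc : 0 ≤ L / c := by positivity
  refine
    { contr_f := fun x y => ?_
      contr_g := fun y => ?_
      lip_f := fun x₁ x₂ y₁ y₂ => (hla x₁ x₂ y₁ y₂).trans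
        (mul_le_mul_of_nonneg_right hT.lip (by positivity))
      lip_g := fun x₁ x₂ y₁ y₂ => (hlb x₁ x₂ y₁ y₂).trans
        (mul_le_mul_of_nonneg_right hT.lip (by positivity))
      growth_f := fun x y => (hga x y).trans
        (mul_le_mul_of_nonneg_right hT.growth (by positivity))
      growth_g := fun x y => (hgb x y).trans
        (mul_le_mul_of_nonneg_right hT.growth (by positivity))
      lip_xs := fun y₁ y₂ => (hxs y₁ y₂).trans
        (mul_le_mul_of_nonneg_right hT.lip_fixed (norm_nonneg _))
      norm_xs := ?_
      norm_ys := hys.trans hT.norm_ys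
      lip_Hf := norm_poissonMap_sub_le hQ hL hT.poisson_lip h.lipschitz_f
      lip_Hg := norm_poissonMap_sub_le hQ' hL hT.poisson_lip h.lipschitz_g
      growth_Hf := norm_poissonMap_le hQ hK.le hT.poisson_growth hgf
      growth_Hg := norm_poissonMap_le hQ' hK.le hT.poisson_growth hgg }
  · have e1 := h.contractive_f x (xStarOf π f y) y
    rw [hfix] at e1
    exact e1.trans (mul_le_mul_of_nonneg_right hlam (norm_nonneg _))
  · have e1 := h.contractive_g y (yStar π f g)
    rw [hfixy] at e1
    exact e1.trans (mul_le_mul_of_nonneg_right hmu (norm_nonneg _))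
  · refine le_trans ?_ hT.norm_xs
    have e1 := norm_le_norm_add_norm_sub (xStarOf π f 0) (xStarOf π f (yStar π f g))
    have e2 := hxs (yStar π f g) 0
    rw [sub_zero] at e2
    rw [norm_sub_rev] at e1
    have e3 := mul_le_mul_of_nonneg_left hys hLc
    linarith

end

end TwoTimeScale

/-! ### The noise of the iteration is martingale noise -/

namespace TwoTimeScale

set_option linter.unusedSectionVars false

variable {X Y S Ω : Type*} [MeasurableSpace X] [MeasurableSpace Y] [MeasurableSpace S]

/-- The history of the iteration, as a filtration. -/
def historyFiltration [m0 : MeasurableSpace Ω] {x₀ : Ω → X} {y₀ : Ω → Y} {Z : ℕ → Ω → S}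
    {M : ℕ → Ω → X} {M' : ℕ → Ω → Y} (hx : Measurable x₀) (hy : Measurable y₀)
    (hZ : ∀ n, Measurable (Z n)) (hM : ∀ n, Measurable (M n)) (hM' : ∀ n, Measurable (M' n)) :
    Filtration ℕ m0 where
  seq := history x₀ y₀ Z M M'
  mono' m n hmn := by
    refine sup_le_sup le_rfl (iSup_mono fun k => ?_)
    exact iSup_le fun hk => le_iSup_of_le (hk.trans hmn) le_rfl
  le' n := by
    refine sup_le (sup_le hx.comap_le hy.comap_le) (iSup_le fun k => iSup_le fun _ => ?_)
    exact sup_le (sup_le (hZ k).comap_le (hM k).comap_le) (hM' k).comap_le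

section
variable {x₀ : Ω → X} {y₀ : Ω → Y} {Z : ℕ → Ω → S} {M : ℕ → Ω → X} {M' : ℕ → Ω → Y}

theorem measurable_history_x₀ (n : ℕ) : Measurable[history x₀ y₀ Z M M' n] x₀ :=
  (comap_measurable x₀).mono (le_sup_of_le_left le_sup_left) le_rfl

theorem measurable_history_y₀ (n : ℕ) : Measurable[history x₀ y₀ Z M M' n] y₀ :=
  (comap_measurable y₀).mono (le_sup_of_le_left le_sup_right) le_rfl

theorem measurable_history_Z (n : ℕ) : Measurable[history x₀ y₀ Z M M' n] (Z n) :=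
  (comap_measurable (Z n)).mono (le_sup_of_le_right (le_iSup₂_of_le n le_rfl
    (le_sup_of_le_left le_sup_left))) le_rfl

theorem measurable_history_M (n : ℕ) : Measurable[history x₀ y₀ Z M M' n] (M n) :=
  (comap_measurable (M n)).mono (le_sup_of_le_right (le_iSup₂_of_le n le_rfl
    (le_sup_of_le_left le_sup_right))) le_rfl

theorem measurable_history_M' (n : ℕ) : Measurable[history x₀ y₀ Z M M' n] (M' n) :=
  (comap_measurable (M' n)).mono (le_sup_of_le_right (le_iSup₂_of_le n le_rfl
    le_sup_right)) le_rfl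

end

section

variable [NormedAddCommGroup X] [NormedSpace ℝ X] [FiniteDimensional ℝ X] [BorelSpace X]
  [NormedAddCommGroup Y] [NormedSpace ℝ Y] [FiniteDimensional ℝ Y] [BorelSpace Y]
  [Fintype S] [MeasurableSingletonClass S]

theorem continuous_of_lipschitz_sum {E : Type*} [NormedAddCommGroup E] {L : ℝ}
    {h : X → Y → E}
    (hh : ∀ x₁ x₂ y₁ y₂, ‖h x₁ y₁ - h x₂ y₂‖ ≤ L * (‖x₁ - x₂‖ + ‖y₁ - y₂‖)) :
    Continuous fun w : X × Y => h w.1 w.2 := by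
  refine continuous_iff_continuousAt.2 fun w => ?_
  rw [ContinuousAt, tendsto_iff_norm_sub_tendsto_zero]
  refine squeeze_zero (fun _ => norm_nonneg _) (fun v => hh v.1 w.1 v.2 w.2) ?_
  have : Continuous fun v : X × Y => L * (‖v.1 - w.1‖ + ‖v.2 - w.2‖) := by fun_prop
  simpa using this.tendsto w

theorem measurable_comp_state {E : Type*} [MeasurableSpace E] [NormedAddCommGroup E]
    [BorelSpace E] {m : MeasurableSpace Ω} {h : X → Y → S → E}
    (hh : ∀ i, Continuous fun w : X × Y => h w.1 w.2 i) {x : Ω → X} {y : Ω → Y} {z : Ω → S}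
    (hx : Measurable x) (hy : Measurable y) (hz : Measurable z) :
    Measurable fun ω => h (x ω) (y ω) (z ω) := by
  have h1 : Measurable fun w : (X × Y) × S => h w.1.1 w.1.2 w.2 :=
    measurable_from_prod_countable_left fun i => (hh i).measurable
  exact h1.comp ((hx.prodMk hy).prodMk hz)

variable [m0 : MeasurableSpace Ω] {Pr : Measure Ω} {P : Matrix S S ℝ} {f : X → Y → S → X}
  {g : X → Y → S → Y} {K : ℝ} {α β : ℕ → ℝ} {Z : ℕ → Ω → S} {M : ℕ → Ω → X} {M' : ℕ → Ω → Y}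
  {x : ℕ → Ω → X} {y : ℕ → Ω → Y} {π : S → ℝ}

/-- The filtration of an iteration. -/
def IsIteration.filtration (h : IsIteration Pr P f g K α β Z M M' x y) : Filtration ℕ m0 :=
  historyFiltration h.measurable_x₀ h.measurable_y₀ h.measurable_Z h.measurable_M h.measurable_M'

theorem IsIteration.measurable_xy (h : IsIteration Pr P f g K α β Z M M' x y)
    (hf : ∀ i, Continuous fun w : X × Y => f w.1 w.2 i)
    (hg : ∀ i, Continuous fun w : X × Y => g w.1 w.2 i) (n : ℕ) :
    Measurable[h.filtration n] (x n) ∧ Measurable[h.filtration n] (y n) := by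
  induction n with
  | zero => exact ⟨measurable_history_x₀ 0, measurable_history_y₀ 0⟩
  | succ n ih =>
    have hle := h.filtration.mono (Nat.le_succ n)
    have hx : Measurable[h.filtration (n + 1)] (x n) := ih.1.mono hle le_rfl
    have hy : Measurable[h.filtration (n + 1)] (y n) := ih.2.mono hle le_rfl
    have hZ : Measurable[h.filtration (n + 1)] (Z n) :=
      (measurable_history_Z n).mono hle le_rfl
    have hM : Measurable[h.filtration (n + 1)] (M (n + 1)) := measurable_history_M (n + 1)
    have hM' : Measurable[h.filtration (n + 1)] (M' (n + 1)) := measurable_history_M' (n + 1)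
    have hfm := measurable_comp_state hf hx hy hZ
    have hgm := measurable_comp_state hg hx hy hZ
    refine ⟨?_, ?_⟩
    · rw [funext (h.step_x n)]
      exact hx.add (((hfm.sub hx).add hM).const_smul (α n))
    · rw [funext (h.step_y n)]
      exact hy.add (((hgm.sub hy).add hM').const_smul (β n))

theorem memLp_of_norm_le_size {E : Type*} [NormedAddCommGroup E] [IsFiniteMeasure Pr]
    {x : Ω → X} {y : Ω → Y} {w : Ω → E} {C : ℝ} (hw : AEStronglyMeasurable w Pr)
    (hx : MemLp x 2 Pr) (hy : MemLp y 2 Pr)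
    (h : ∀ᵐ ω ∂Pr, ‖w ω‖ ≤ C * (1 + ‖x ω‖ + ‖y ω‖)) : MemLp w 2 Pr := by
  have h1 : MemLp (fun ω => C * (1 + ‖x ω‖ + ‖y ω‖)) 2 Pr :=
    (((memLp_const (1 : ℝ)).add hx.norm).add hy.norm).const_mul C
  refine h1.mono hw ?_
  filter_upwards [h] with ω hω
  exact hω.trans (le_abs_self _)

theorem IsIteration.memLp_xy [IsFiniteMeasure Pr] (h : IsIteration Pr P f g K α β Z M M' x y)
    (hf : ∀ i, Continuous fun w : X × Y => f w.1 w.2 i)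
    (hg : ∀ i, Continuous fun w : X × Y => g w.1 w.2 i)
    (hgrow : ∀ x y i, ‖f x y i‖ + ‖g x y i‖ ≤ K * (1 + ‖x‖ + ‖y‖))
    (hx0 : MemLp (x 0) 2 Pr) (hy0 : MemLp (y 0) 2 Pr) (n : ℕ) :
    MemLp (x n) 2 Pr ∧ MemLp (y n) 2 Pr := by
  induction n with
  | zero => exact ⟨hx0, hy0⟩
  | succ n ih =>
    obtain ⟨ix, iy⟩ := ih
    obtain ⟨mx, my⟩ := h.measurable_xy hf hg n
    have mx' := mx.mono (h.filtration.le n) le_rfl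
    have my' := my.mono (h.filtration.le n) le_rfl
    have hfm := measurable_comp_state hf mx' my' (h.measurable_Z n)
    have hgm := measurable_comp_state hg mx' my' (h.measurable_Z n)
    have lf := memLp_of_norm_le_size (C := K) hfm.aestronglyMeasurable ix iy
      (Eventually.of_forall fun ω => by
        linarith [hgrow (x n ω) (y n ω) (Z n ω), norm_nonneg (g (x n ω) (y n ω) (Z n ω))])
    have lg := memLp_of_norm_le_size (C := K) hgm.aestronglyMeasurable ix iy
      (Eventually.of_forall fun ω => by
        linarith [hgrow (x n ω) (y n ω) (Z n ω), norm_nonneg (f (x n ω) (y n ω) (Z n ω))])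
    have lM := memLp_of_norm_le_size (h.measurable_M (n + 1)).aestronglyMeasurable ix iy
      (by filter_upwards [h.noise_growth n] with ω hω; linarith [norm_nonneg (M' (n + 1) ω)])
    have lM' := memLp_of_norm_le_size (h.measurable_M' (n + 1)).aestronglyMeasurable ix iy
      (by filter_upwards [h.noise_growth n] with ω hω; linarith [norm_nonneg (M (n + 1) ω)])
    refine ⟨?_, ?_⟩
    · rw [funext (h.step_x n)]
      exact ix.add (((lf.sub ix).add lM).const_smul (α n))
    · rw [funext (h.step_y n)]
      exact iy.add (((lg.sub iy).add lM').const_smul (β n))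

/-- The martingale difference made of the noise `N` and of the fluctuation of the Poisson solution
`H` over one transition of the chain. -/
def totalNoise {E : Type*} [AddCommGroup E] [Module ℝ E] (P : Matrix S S ℝ) (H : X → Y → S → E)
    (Z : ℕ → Ω → S) (N : ℕ → Ω → E) (x : ℕ → Ω → X) (y : ℕ → Ω → Y) (n : ℕ) (ω : Ω) : E :=
  N (n + 1) ω + (H (x n ω) (y n ω) (Z (n + 1) ω) - ∑ j, P (Z n ω) j • H (x n ω) (y n ω) j)

theorem norm_totalNoise_le {E : Type*} [NormedAddCommGroup E] [NormedSpace ℝ E]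
    (hch : IsIrreducibleChain P π) {H : X → Y → S → E} {N : ℕ → Ω → E} {B : ℝ}
    (hH : ∀ x y i, ‖H x y i‖ ≤ B * (1 + ‖x‖ + ‖y‖)) {n : ℕ} {ω : Ω}
    (hN : ‖N (n + 1) ω‖ ≤ K * (1 + ‖x n ω‖ + ‖y n ω‖)) :
    ‖totalNoise P H Z N x y n ω‖ ≤ (K + 2 * B) * (1 + ‖x n ω‖ + ‖y n ω‖) := by
  have h1 : ‖∑ j, P (Z n ω) j • H (x n ω) (y n ω) j‖ ≤ B * (1 + ‖x n ω‖ + ‖y n ω‖) :=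
    norm_avg_le (hch.irreducible.nonneg _) (hch.row_sum _) (hH _ _)
  have h2 := hH (x n ω) (y n ω) (Z (n + 1) ω)
  have h3 := norm_add_le (N (n + 1) ω) (H (x n ω) (y n ω) (Z (n + 1) ω)
    - ∑ j, P (Z n ω) j • H (x n ω) (y n ω) j)
  have h4 := norm_sub_le (H (x n ω) (y n ω) (Z (n + 1) ω))
    (∑ j, P (Z n ω) j • H (x n ω) (y n ω) j)
  unfold totalNoise
  linarith

/-- Given the past, the mean of `H(x, y, Z (n + 1))` is the transition average of `H(x, y, ·)` at
`Z n`, so that the fluctuation of `H` has conditional mean zero, as `N` does. -/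
theorem IsIteration.isMartingaleNoise [IsFiniteMeasure Pr] {E : Type*} [NormedAddCommGroup E]
    [NormedSpace ℝ E] [FiniteDimensional ℝ E] [CompleteSpace E] [MeasurableSpace E] [BorelSpace E]
    (h : IsIteration Pr P f g K α β Z M M' x y) (hch : IsIrreducibleChain P π)
    (hf : ∀ i, Continuous fun w : X × Y => f w.1 w.2 i)
    (hg : ∀ i, Continuous fun w : X × Y => g w.1 w.2 i)
    (hgrow : ∀ x y i, ‖f x y i‖ + ‖g x y i‖ ≤ K * (1 + ‖x‖ + ‖y‖))
    (hx0 : MemLp (x 0) 2 Pr) (hy0 : MemLp (y 0) 2 Pr) {H : X → Y → S → E} {N : ℕ → Ω → E} {B : ℝ}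
    (hHc : ∀ i, Continuous fun w : X × Y => H w.1 w.2 i)
    (hH : ∀ x y i, ‖H x y i‖ ≤ B * (1 + ‖x‖ + ‖y‖))
    (hNm : ∀ n, Measurable[h.filtration n] (N n))
    (hN : ∀ n, ∀ᵐ ω ∂Pr, ‖N (n + 1) ω‖ ≤ K * (1 + ‖x n ω‖ + ‖y n ω‖))
    (hNc : ∀ n, Pr[N (n + 1) | h.filtration n] =ᵐ[Pr] 0) :
    IsMartingaleNoise Pr h.filtration (totalNoise P H Z N x y) := by
  classical
  set ℱ := h.filtration with hℱ
  have hmeas : ∀ n, Measurable[ℱ (n + 1)] (totalNoise P H Z N x y n) := by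
    intro n
    obtain ⟨mx, my⟩ := h.measurable_xy hf hg n
    have hle := ℱ.mono (Nat.le_succ n)
    have mx' : Measurable[ℱ (n + 1)] (x n) := mx.mono hle le_rfl
    have my' : Measurable[ℱ (n + 1)] (y n) := my.mono hle le_rfl
    have mZ : Measurable[ℱ (n + 1)] (Z (n + 1)) := measurable_history_Z (n + 1)
    have mZ' : Measurable[ℱ (n + 1)] (Z n) := (measurable_history_Z n).mono hle le_rfl
    refine (hNm (n + 1)).add ((measurable_comp_state hHc mx' my' mZ).sub ?_)
    exact measurable_comp_state (h := fun x y i => ∑ j, P i j • H x y j)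
      (fun i => continuous_finsetSum _ fun j _ => (hHc j).const_smul _) mx' my' mZ'
  have hmem : ∀ n, MemLp (totalNoise P H Z N x y n) 2 Pr := by
    intro n
    obtain ⟨lx, ly⟩ := h.memLp_xy hf hg hgrow hx0 hy0 n
    refine memLp_of_norm_le_size (C := K + 2 * B)
      ((hmeas n).mono (ℱ.le _) le_rfl).aestronglyMeasurable lx ly ?_
    filter_upwards [hN n] with ω hω
    exact norm_totalNoise_le hch hH hω
  refine ⟨fun n => (hmeas n).stronglyMeasurable, hmem, fun n => ?_⟩
  obtain ⟨lx, ly⟩ := h.memLp_xy hf hg hgrow hx0 hy0 n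
  obtain ⟨mx, my⟩ := h.measurable_xy hf hg n
  -- Write `H(x, y, Z_{n+1})` as a sum over the states of indicators times past-measurable factors.
  set I : S → Ω → ℝ := fun j => (Z (n + 1) ⁻¹' {j}).indicator fun _ => (1 : ℝ) with hI
  set W : S → Ω → E := fun j ω => H (x n ω) (y n ω) j with hW
  have hWm : ∀ j, Measurable[ℱ n] (W j) := fun j => (hHc j).measurable.comp (mx.prodMk my)
  have hWL : ∀ j, MemLp (W j) 2 Pr := fun j =>
    memLp_of_norm_le_size (C := B) ((hWm j).mono (ℱ.le n) le_rfl).aestronglyMeasurable lx ly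
      (Eventually.of_forall fun ω => hH _ _ _)
  have hIm : ∀ j, Measurable (I j) := fun j =>
    measurable_const.indicator (h.measurable_Z (n + 1) (measurableSet_singleton j))
  have hIint : ∀ j, Integrable (I j) Pr := fun j =>
    (integrable_const (1 : ℝ)).indicator (h.measurable_Z (n + 1) (measurableSet_singleton j))
  have hIW : ∀ j, Integrable (I j • W j) Pr := by
    intro j
    refine ((hWL j).integrable (by norm_num)).mono
      ((hIm j).aestronglyMeasurable.smul (hWL j).aestronglyMeasurable)
      (Eventually.of_forall fun ω => ?_)
    simp only [Pi.smul_apply', norm_smul]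
    refine mul_le_of_le_one_left (norm_nonneg _) ?_
    simp only [hI, Set.indicator_apply]
    split_ifs <;> simp
  set V : Ω → E := fun ω => ∑ j, P (Z n ω) j • W j ω with hV
  have hVm : StronglyMeasurable[ℱ n] V := by
    refine Measurable.stronglyMeasurable ?_
    exact measurable_comp_state (h := fun x y i => ∑ j, P i j • H x y j)
      (fun i => continuous_finsetSum _ fun j _ => (hHc j).const_smul _) mx my
      (measurable_history_Z n)
  have hVL : MemLp V 2 Pr := memLp_of_norm_le_size (C := B)
    (hVm.mono (ℱ.le n)).aestronglyMeasurable lx ly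
    (Eventually.of_forall fun ω =>
      norm_avg_le (hch.irreducible.nonneg _) (hch.row_sum _) (hH _ _))
  have hdecomp : totalNoise P H Z N x y n = N (n + 1) + (∑ j, I j • W j - V) := by
    funext ω
    simp only [totalNoise, Pi.add_apply, Pi.sub_apply, Finset.sum_apply, Pi.smul_apply', hV, hW]
    congr 2
    rw [Finset.sum_eq_single (Z (n + 1) ω)]
    · simp [hI]
    · intro j _ hj
      simp [hI, hj.symm]
    · simp
  have hNint : Integrable (N (n + 1)) Pr :=
    (memLp_of_norm_le_size ((hNm (n + 1)).mono (ℱ.le _) le_rfl).aestronglyMeasurable lx ly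
      (hN n)).integrable (by norm_num)
  have hsumint : Integrable (∑ j, I j • W j) Pr := integrable_finsetSum' _ fun j _ => hIW j
  have hVint := hVL.integrable (by norm_num : (1 : ENNReal) ≤ 2)
  rw [hdecomp]
  have hsum : Pr[∑ j, I j • W j | ℱ n] =ᵐ[Pr] V := by
    refine (condExp_finsetSum (fun j _ => hIW j) (ℱ n)).trans ?_
    have hj : ∀ j, Pr[I j • W j | ℱ n] =ᵐ[Pr] fun ω => P (Z n ω) j • W j ω := by
      intro j
      refine (condExp_smul_of_aestronglyMeasurable_right (hIint j) (hIW j)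
        (hWm j).stronglyMeasurable.aestronglyMeasurable).trans ?_
      filter_upwards [h.markov n j] with ω hω
      rw [Pi.smul_apply']
      exact congrArg (· • W j ω) hω
    filter_upwards [ae_all_iff.2 hj] with ω hω
    rw [Finset.sum_apply]
    exact Finset.sum_congr rfl fun j _ => hω j
  have hsub : Pr[∑ j, I j • W j - V | ℱ n] =ᵐ[Pr] 0 := by
    refine (condExp_sub hsumint hVint (ℱ n)).trans ?_
    rw [condExp_of_stronglyMeasurable (ℱ.le n) hVm hVint]
    filter_upwards [hsum] with ω hω
    simp [hω]
  refine (condExp_add hNint (hsumint.sub hVint) (ℱ n)).trans ?_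
  filter_upwards [hsub, hNc n] with ω h1 h2
  simp [h1, h2]

end

end TwoTimeScale

/-! ### Passage to mean-square norms -/

namespace TwoTimeScale

section

variable {Ω : Type*} [MeasurableSpace Ω] {Pr : Measure Ω}

theorem lpNorm_const_mul {r : ℝ} (hr : 0 ≤ r) (F : Ω → ℝ) :
    lpNorm (fun ω => r * F ω) 2 Pr = r * lpNorm F 2 Pr := by
  have h := lpNorm_const_smul (p := 2) r F Pr
  rw [coe_nnnorm, Real.norm_eq_abs, abs_of_nonneg hr] at h
  exact h

theorem lpNorm_mono_of_nonneg {F F' : Ω → ℝ} (hF' : MemLp F' 2 Pr) (h0 : ∀ ω, 0 ≤ F ω)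
    (h : ∀ᵐ ω ∂Pr, F ω ≤ F' ω) : lpNorm F 2 Pr ≤ lpNorm F' 2 Pr := by
  refine lpNorm_le_of_ae_le hF' ?_
  filter_upwards [h] with ω hω
  rw [Real.norm_eq_abs, abs_of_nonneg (h0 ω)]
  exact hω.trans (le_abs_self _)

theorem lpNorm_add_le_two {F F' : Ω → ℝ} (hF : MemLp F 2 Pr) :
    lpNorm (fun ω => F ω + F' ω) 2 Pr ≤ lpNorm F 2 Pr + lpNorm F' 2 Pr :=
  lpNorm_add_le hF (by norm_num)

theorem lpNorm_const_one_le [IsFiniteMeasure Pr] (hPr : Pr.real Set.univ ≤ 1) :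
    lpNorm (fun _ : Ω => (1 : ℝ)) 2 Pr ≤ 1 := by
  have h := lpNorm_one' (𝕜 := ℝ) (p := 2) (by norm_num) (by norm_num) Pr
  change lpNorm (1 : Ω → ℝ) 2 Pr ≤ 1
  rw [h]
  exact Real.rpow_le_one measureReal_nonneg hPr (by simp)

/-- By Minkowski's inequality, the error recursion passes from almost every path to mean-square
norms. The size `G` is increased by one, and the constant doubled, because a measure of mass less
than one need not give norm at least one to `G`. -/
theorem ErrorRecursion.lpNorm [IsFiniteMeasure Pr] (hPr : Pr.real Set.univ ≤ 1) {c C : ℝ}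
    {α β κ : ℕ → ℝ} {u v d G : ℕ → Ω → ℝ} (hc0 : 0 ≤ c) (hc1 : c ≤ 1) (hC : 1 ≤ C)
    (hα : ∀ n, 0 < α n) (hα1 : ∀ n, α n ≤ 1) (hβ : ∀ n, 0 < β n) (hκ : ∀ n, 0 ≤ κ n)
    (hu : ∀ n, MemLp (u n) 2 Pr) (hv : ∀ n, MemLp (v n) 2 Pr) (hd : ∀ n, MemLp (d n) 2 Pr)
    (hG : ∀ n, MemLp (G n) 2 Pr) (hu0 : ∀ n ω, 0 ≤ u n ω) (hv0 : ∀ n ω, 0 ≤ v n ω)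
    (hG0 : ∀ n ω, 0 ≤ G n ω)
    (h : ∀ᵐ ω ∂Pr, ErrorRecursion c C α β κ (fun n => u n ω) (fun n => v n ω) (fun n => d n ω)
      (fun n => G n ω)) :
    ErrorRecursion c (2 * C) α β κ (fun n => lpNorm (u n) 2 Pr) (fun n => lpNorm (v n) 2 Pr)
      (fun n => lpNorm (d n) 2 Pr) (fun n => 1 + lpNorm (G n) 2 Pr) := by
  have hC0 : 0 ≤ C := by linarith
  have hforce : ∀ n, MemLp (fun ω => d n ω + d (n + 1) ω + κ n * G n ω) 2 Pr := fun n =>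
    ((hd n).add (hd (n + 1))).add ((hG n).const_mul (κ n))
  have hforce_le : ∀ n, MeasureTheory.lpNorm (fun ω => d n ω + d (n + 1) ω + κ n * G n ω) 2 Pr
      ≤ MeasureTheory.lpNorm (d n) 2 Pr + MeasureTheory.lpNorm (d (n + 1)) 2 Pr
        + κ n * (1 + MeasureTheory.lpNorm (G n) 2 Pr) := by
    intro n
    have e1 := lpNorm_add_le_two (F' := fun ω => κ n * G n ω) ((hd n).add (hd (n + 1)))
    have e2 := lpNorm_add_le_two (F' := d (n + 1)) (hd n)
    rw [lpNorm_const_mul (hκ n)] at e1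
    have e3 := hκ n
    simp only [Pi.add_apply] at e1
    have e4 : MeasureTheory.lpNorm (d n + d (n + 1)) 2 Pr
        ≤ MeasureTheory.lpNorm (d n) 2 Pr + MeasureTheory.lpNorm (d (n + 1)) 2 Pr := e2
    linarith
  constructor
  · exact fun n => lpNorm_nonneg
  · exact fun n => lpNorm_nonneg
  · exact fun n => lpNorm_nonneg
  · intro n
    have : 0 ≤ MeasureTheory.lpNorm (G n) 2 Pr := lpNorm_nonneg
    linarith
  · intro n
    have hcα : 0 ≤ 1 - c * α n := by nlinarith [hα n, hα1 n]
    have hCα : 0 ≤ C * α n := mul_nonneg hC0 (hα n).le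
    have e1 := lpNorm_mono_of_nonneg (F' := fun ω => (1 - c * α n) * u n ω
        + C * α n * (d n ω + d (n + 1) ω + κ n * G n ω))
      (((hu n).const_mul _).add ((hforce n).const_mul _)) (hu0 (n + 1))
      (by filter_upwards [h] with ω hω using hω.u_step n)
    refine e1.trans ((lpNorm_add_le_two ((hu n).const_mul _)).trans ?_)
    rw [lpNorm_const_mul hcα, lpNorm_const_mul hCα]
    have e2 := mul_le_mul_of_nonneg_left (hforce_le n) hCα
    have e3 := (lpNorm_nonneg (f := fun ω => d n ω + d (n + 1) ω + κ n * G n ω) (p := 2)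
      (μ := Pr)).trans (hforce_le n)
    have e4 := mul_nonneg hCα e3
    linarith
  · intro n hβ1
    have hcβ : 0 ≤ 1 - c * β n := by nlinarith [hβ n]
    have hCβ : 0 ≤ C * β n := mul_nonneg hC0 (hβ n).le
    have e1 := lpNorm_mono_of_nonneg (F' := fun ω => (1 - c * β n) * v n ω
        + C * β n * (u n ω + (d n ω + d (n + 1) ω + κ n * G n ω)))
      (((hv n).const_mul _).add (((hu n).add (hforce n)).const_mul _)) (hv0 (n + 1))
      (by filter_upwards [h] with ω hω using (hω.v_step n hβ1).trans_eq (by ring))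
    refine e1.trans ((lpNorm_add_le_two ((hv n).const_mul _)).trans ?_)
    rw [lpNorm_const_mul hcβ, lpNorm_const_mul hCβ]
    have e0 := (lpNorm_add_le_two (F' := fun ω => d n ω + d (n + 1) ω + κ n * G n ω) (hu n)).trans
      (add_le_add le_rfl (hforce_le n))
    have e2 := mul_le_mul_of_nonneg_left e0 hCβ
    have e4 := mul_nonneg hCβ (lpNorm_nonneg.trans e0)
    linarith
  · intro n
    have e1 := lpNorm_mono_of_nonneg (F' := fun ω => C * (1 + (u n ω + (v n ω
        + (d n ω + κ n * G n ω)))))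
      (((memLp_const (1 : ℝ)).add ((hu n).add ((hv n).add ((hd n).add
        ((hG n).const_mul _))))).const_mul _) (hG0 n)
      (by filter_upwards [h] with ω hω using (hω.G_le n).trans_eq (by ring))
    rw [lpNorm_const_mul hC0] at e1
    have e2 := lpNorm_add_le_two (Pr := Pr) (F := fun _ => (1 : ℝ))
      (F' := fun ω => u n ω + (v n ω + (d n ω + κ n * G n ω))) (memLp_const _)
    have e3 := lpNorm_add_le_two (F' := fun ω => v n ω + (d n ω + κ n * G n ω)) (hu n)
    have e4 := lpNorm_add_le_two (F' := fun ω => d n ω + κ n * G n ω) (hv n)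
    have e5 := lpNorm_add_le_two (F' := fun ω => κ n * G n ω) (hd n)
    rw [lpNorm_const_mul (hκ n)] at e5
    have e6 := lpNorm_const_one_le hPr
    have e7 : MeasureTheory.lpNorm (fun ω => 1 + (u n ω + (v n ω + (d n ω + κ n * G n ω)))) 2 Pr
        ≤ 1 + MeasureTheory.lpNorm (u n) 2 Pr + MeasureTheory.lpNorm (v n) 2 Pr
          + MeasureTheory.lpNorm (d n) 2 Pr + κ n * (1 + MeasureTheory.lpNorm (G n) 2 Pr) := by
      linarith [hκ n]
    have e8 : 1 ≤ 1 + MeasureTheory.lpNorm (u n) 2 Pr + MeasureTheory.lpNorm (v n) 2 Pr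
          + MeasureTheory.lpNorm (d n) 2 Pr + κ n * (1 + MeasureTheory.lpNorm (G n) 2 Pr) := by
      have a1 : 0 ≤ MeasureTheory.lpNorm (u n) 2 Pr := lpNorm_nonneg
      have a2 : 0 ≤ MeasureTheory.lpNorm (v n) 2 Pr := lpNorm_nonneg
      have a3 : 0 ≤ MeasureTheory.lpNorm (d n) 2 Pr := lpNorm_nonneg
      have a4 : 0 ≤ κ n * (1 + MeasureTheory.lpNorm (G n) 2 Pr) :=
        mul_nonneg (hκ n) (add_nonneg zero_le_one lpNorm_nonneg)
      linarith
    have e9 := mul_le_mul_of_nonneg_left e7 hC0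
    nlinarith
  · intro n
    have e1 := lpNorm_mono_of_nonneg (F := fun ω => u n ω + v n ω)
      (F' := fun ω => C * (G n ω + d n ω)) (((hG n).add (hd n)).const_mul _)
      (fun ω => add_nonneg (hu0 n ω) (hv0 n ω)) (by filter_upwards [h] with ω hω using hω.uv_le n)
    have e2 := lpNorm_mono_of_nonneg (F := u n) (F' := fun ω => u n ω + v n ω) ((hu n).add (hv n))
      (hu0 n) (Eventually.of_forall fun ω => le_add_of_nonneg_right (hv0 n ω))
    have e3 := lpNorm_mono_of_nonneg (F := v n) (F' := fun ω => u n ω + v n ω) ((hu n).add (hv n))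
      (hv0 n) (Eventually.of_forall fun ω => le_add_of_nonneg_left (hu0 n ω))
    rw [lpNorm_const_mul hC0] at e1
    have e4 := mul_le_mul_of_nonneg_left (lpNorm_add_le_two (F' := d n) (hG n)) hC0
    linarith
  · intro n
    have e1 := lpNorm_mono_of_nonneg (F' := fun ω => C * G n ω) ((hG n).const_mul _)
      (hG0 (n + 1)) (by filter_upwards [h] with ω hω using hω.G_step n)
    rw [lpNorm_const_mul hC0] at e1
    have e2 : 0 ≤ MeasureTheory.lpNorm (G n) 2 Pr := lpNorm_nonneg
    nlinarith [mul_nonneg hC0 e2]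

end

end TwoTimeScale

/-! ### Analysis of square integrable schemes -/

namespace TwoTimeScale

set_option linter.unusedSectionVars false

section

variable {X Y S Ω : Type*} [MeasurableSpace X] [MeasurableSpace Y] [MeasurableSpace S]
  [NormedAddCommGroup X] [NormedSpace ℝ X] [FiniteDimensional ℝ X] [BorelSpace X]
  [NormedAddCommGroup Y] [NormedSpace ℝ Y] [FiniteDimensional ℝ Y] [BorelSpace Y]
  [Fintype S] [MeasurableSingletonClass S] [MeasurableSpace Ω]

/-- A two-time-scale iteration with square integrable initial values, together with its constants
and with matrices `Q`, `Q'` that solve the Poisson equation in `X` and in `Y`. The measure `Pr` may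
have mass less than one, so that the initial values can be localized. -/
structure IsRegularScheme (c q T lam mu K L α₀ β₀ a : ℝ) (P : Matrix S S ℝ) (π : S → ℝ)
    (Q Q' : Matrix S S ℝ) (f : X → Y → S → X) (g : X → Y → S → Y) (Pr : Measure Ω)
    (Z : ℕ → Ω → S) (M : ℕ → Ω → X) (M' : ℕ → Ω → Y) (x : ℕ → Ω → X) (y : ℕ → Ω → Y) :
    Prop where
  c_pos : 0 < c
  c_le_one : c ≤ 1
  lam_nonneg : 0 ≤ lam
  lam_le : lam ≤ 1 - c
  mu_nonneg : 0 ≤ mu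
  mu_le : mu ≤ 1 - c
  K_pos : 0 < K
  L_nonneg : 0 ≤ L
  α₀_pos : 0 < α₀
  α₀_lt_one : α₀ < 1
  β₀_pos : 0 < β₀
  half_lt_a : 1 / 2 < a
  a_lt_one : a < 1
  constBounds : ConstBounds c K L q α₀ β₀ T
  chain : IsIrreducibleChain P π
  poisson_f : ∀ (w : S → X) i,
    w i - ∑ j, π j • w j = (∑ k, Q i k • w k) - ∑ j, P i j • ∑ k, Q j k • w k
  poisson_g : ∀ (w : S → Y) i,
    w i - ∑ j, π j • w j = (∑ k, Q' i k • w k) - ∑ j, P i j • ∑ k, Q' j k • w k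
  entrySum_Q : entrySum Q ≤ q
  entrySum_Q' : entrySum Q' ≤ q
  system : IsContractiveSystem π lam mu K L f g
  iteration : IsIteration Pr P f g K (alphaStep α₀ a) (betaStep β₀) Z M M' x y
  mass_le : Pr.real Set.univ ≤ 1
  memLp_x : MemLp (x 0) 2 Pr
  memLp_y : MemLp (y 0) 2 Pr

namespace IsRegularScheme

variable {c q T lam mu K L α₀ β₀ a : ℝ} {P : Matrix S S ℝ} {π : S → ℝ} {Q Q' : Matrix S S ℝ}
  {f : X → Y → S → X} {g : X → Y → S → Y} {Pr : Measure Ω} {Z : ℕ → Ω → S} {M : ℕ → Ω → X}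
  {M' : ℕ → Ω → Y} {x : ℕ → Ω → X} {y : ℕ → Ω → Y}

theorem meanField (h : IsRegularScheme c q T lam mu K L α₀ β₀ a P π Q Q' f g Pr Z M M' x y) :
    MeanField c T (avg π f) (avg π g) (xStarOf π f) (yStar π f g) (poissonMap Q f)
      (poissonMap Q' g) :=
  h.system.meanField h.chain h.constBounds h.c_pos h.K_pos h.L_nonneg h.lam_nonneg h.mu_nonneg
    h.lam_le h.mu_le h.entrySum_Q h.entrySum_Q'

theorem stepBounds (h : IsRegularScheme c q T lam mu K L α₀ β₀ a P π Q Q' f g Pr Z M M' x y) :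
    StepBounds T (alphaStep α₀ a) (betaStep β₀) (stepRatio α₀ β₀ a) :=
  TwoTimeScale.stepBounds h.constBounds h.α₀_pos h.α₀_lt_one h.β₀_pos
    (by linarith [h.half_lt_a]) h.a_lt_one.le

theorem growth_f (h : IsRegularScheme c q T lam mu K L α₀ β₀ a P π Q Q' f g Pr Z M M' x y)
    (x : X) (y : Y) (i : S) : ‖f x y i‖ ≤ K * (1 + ‖x‖ + ‖y‖) := by
  linarith [h.system.growth x y i, norm_nonneg (g x y i)]

theorem growth_g (h : IsRegularScheme c q T lam mu K L α₀ β₀ a P π Q Q' f g Pr Z M M' x y)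
    (x : X) (y : Y) (i : S) : ‖g x y i‖ ≤ K * (1 + ‖x‖ + ‖y‖) := by
  linarith [h.system.growth x y i, norm_nonneg (f x y i)]

theorem continuous_f (h : IsRegularScheme c q T lam mu K L α₀ β₀ a P π Q Q' f g Pr Z M M' x y)
    (i : S) : Continuous fun w : X × Y => f w.1 w.2 i :=
  continuous_of_lipschitz_sum (h := fun x y => f x y i)
    fun x₁ x₂ y₁ y₂ => h.system.lipschitz_f x₁ x₂ y₁ y₂ i

theorem continuous_g (h : IsRegularScheme c q T lam mu K L α₀ β₀ a P π Q Q' f g Pr Z M M' x y)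
    (i : S) : Continuous fun w : X × Y => g w.1 w.2 i :=
  continuous_of_lipschitz_sum (h := fun x y => g x y i)
    fun x₁ x₂ y₁ y₂ => h.system.lipschitz_g x₁ x₂ y₁ y₂ i

theorem noise_x_le (h : IsRegularScheme c q T lam mu K L α₀ β₀ a P π Q Q' f g Pr Z M M' x y)
    (n : ℕ) : ∀ᵐ ω ∂Pr, ‖M (n + 1) ω‖ ≤ K * (1 + ‖x n ω‖ + ‖y n ω‖) := by
  filter_upwards [h.iteration.noise_growth n] with ω hω
  linarith [norm_nonneg (M' (n + 1) ω)]

theorem noise_y_le (h : IsRegularScheme c q T lam mu K L α₀ β₀ a P π Q Q' f g Pr Z M M' x y)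
    (n : ℕ) : ∀ᵐ ω ∂Pr, ‖M' (n + 1) ω‖ ≤ K * (1 + ‖x n ω‖ + ‖y n ω‖) := by
  filter_upwards [h.iteration.noise_growth n] with ω hω
  linarith [norm_nonneg (M (n + 1) ω)]

/-- Almost every path of the scheme is a path in the sense of `IsPath`. -/
theorem ae_isPath (h : IsRegularScheme c q T lam mu K L α₀ β₀ a P π Q Q' f g Pr Z M M' x y) :
    ∀ᵐ ω ∂Pr, IsPath T (alphaStep α₀ a) (betaStep β₀) (avg π f) (avg π g) (poissonMap Q f)
      (poissonMap Q' g) (fun n => x n ω) (fun n => y n ω) (fun n => Z n ω)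
      (fun n => totalNoise P (poissonMap Q f) Z M x y n ω)
      (fun n => totalNoise P (poissonMap Q' g) Z M' x y n ω) := by
  filter_upwards [ae_all_iff.2 h.noise_x_le, ae_all_iff.2 h.noise_y_le] with ω h1 h2
  refine ⟨fun n => ?_, fun n => ?_, fun n => ?_, fun n => ?_⟩
  · have e := h.poisson_f (f (x n ω) (y n ω)) (Z n ω)
    rw [sub_eq_iff_eq_add] at e
    rw [h.iteration.step_x n ω, e]
    congr 2
    simp only [totalNoise, poissonMap, avg]
    abel
  · have e := h.poisson_g (g (x n ω) (y n ω)) (Z n ω)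
    rw [sub_eq_iff_eq_add] at e
    rw [h.iteration.step_y n ω, e]
    congr 2
    simp only [totalNoise, poissonMap, avg]
    abel
  · refine (norm_totalNoise_le h.chain (B := q * K) (norm_poissonMap_le h.entrySum_Q h.K_pos.le
      le_rfl h.growth_f) (h1 n)).trans ?_
    exact mul_le_mul_of_nonneg_right h.constBounds.noise (by positivity)
  · refine (norm_totalNoise_le h.chain (B := q * K) (norm_poissonMap_le h.entrySum_Q' h.K_pos.le
      le_rfl h.growth_g) (h2 n)).trans ?_
    exact mul_le_mul_of_nonneg_right h.constBounds.noise (by positivity)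

variable [IsFiniteMeasure Pr]

theorem memLp_xy (h : IsRegularScheme c q T lam mu K L α₀ β₀ a P π Q Q' f g Pr Z M M' x y)
    (n : ℕ) : MemLp (x n) 2 Pr ∧ MemLp (y n) 2 Pr :=
  h.iteration.memLp_xy h.continuous_f h.continuous_g h.system.growth h.memLp_x h.memLp_y n

theorem memLp_size (h : IsRegularScheme c q T lam mu K L α₀ β₀ a P π Q Q' f g Pr Z M M' x y)
    (n : ℕ) : MemLp (fun ω => 1 + ‖x n ω‖ + ‖y n ω‖) 2 Pr :=
  ((memLp_const (1 : ℝ)).add (h.memLp_xy n).1.norm).add (h.memLp_xy n).2.norm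

variable [CompleteSpace X] [CompleteSpace Y]

theorem noise_x (h : IsRegularScheme c q T lam mu K L α₀ β₀ a P π Q Q' f g Pr Z M M' x y) :
    IsMartingaleNoise Pr h.iteration.filtration (totalNoise P (poissonMap Q f) Z M x y) :=
  h.iteration.isMartingaleNoise h.chain h.continuous_f h.continuous_g h.system.growth h.memLp_x
    h.memLp_y (fun i => continuous_of_lipschitz_sum (h := fun x y => poissonMap Q f x y i)
      fun x₁ x₂ y₁ y₂ => h.meanField.lip_Hf x₁ x₂ y₁ y₂ i)
    h.meanField.growth_Hf (fun n => measurable_history_M n) h.noise_x_le h.iteration.condExp_M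

theorem noise_y (h : IsRegularScheme c q T lam mu K L α₀ β₀ a P π Q Q' f g Pr Z M M' x y) :
    IsMartingaleNoise Pr h.iteration.filtration (totalNoise P (poissonMap Q' g) Z M' x y) :=
  h.iteration.isMartingaleNoise h.chain h.continuous_f h.continuous_g h.system.growth h.memLp_x
    h.memLp_y (fun i => continuous_of_lipschitz_sum (h := fun x y => poissonMap Q' g x y i)
      fun x₁ x₂ y₁ y₂ => h.meanField.lip_Hg x₁ x₂ y₁ y₂ i)
    h.meanField.growth_Hg (fun n => measurable_history_M' n) h.noise_y_le h.iteration.condExp_M'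

/-- The mean-square norm of the noise is controlled by that of the iterates. -/
theorem lpNorm_noise_le
    (h : IsRegularScheme c q T lam mu K L α₀ β₀ a P π Q Q' f g Pr Z M M' x y) (n : ℕ) :
    lpNorm (totalNoise P (poissonMap Q f) Z M x y n) 2 Pr
        ≤ T * (1 + lpNorm (fun ω => 1 + ‖x n ω‖ + ‖y n ω‖) 2 Pr) ∧
      lpNorm (totalNoise P (poissonMap Q' g) Z M' x y n) 2 Pr
        ≤ T * (1 + lpNorm (fun ω => 1 + ‖x n ω‖ + ‖y n ω‖) 2 Pr) := by
  have hT0 : 0 ≤ T := by linarith [h.constBounds.one_le]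
  have e : T * lpNorm (fun ω => 1 + ‖x n ω‖ + ‖y n ω‖) 2 Pr
      ≤ T * (1 + lpNorm (fun ω => 1 + ‖x n ω‖ + ‖y n ω‖) 2 Pr) := by linarith
  rw [← lpNorm_const_mul hT0] at e
  constructor
  · refine (lpNorm_le_of_ae_le ((h.memLp_size n).const_mul T) ?_).trans e
    filter_upwards [h.ae_isPath] with ω hω
    exact (hω.norm_ξ n).trans (le_abs_self _)
  · refine (lpNorm_le_of_ae_le ((h.memLp_size n).const_mul T) ?_).trans e
    filter_upwards [h.ae_isPath] with ω hω
    exact (hω.norm_ξ' n).trans (le_abs_self _)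

/-- The mean-square norms of the corrected errors and of the averaged noise satisfy the scalar
recursion, and they control the errors of the iterates. -/
theorem exists_lpNorm_recursion
    (h : IsRegularScheme c q T lam mu K L α₀ β₀ a P π Q Q' f g Pr Z M M' x y) :
    ∃ u v d G : ℕ → ℝ,
      ErrorRecursion c (2 * recConst T) (alphaStep α₀ a) (betaStep β₀)
        (fun n => alphaStep α₀ a n + stepRatio α₀ β₀ a n) u v d G ∧
      (∀ n, G n = 1 + lpNorm (fun ω => 1 + ‖x n ω‖ + ‖y n ω‖) 2 Pr) ∧
      (∀ n, d n ≤ lpNorm (runAvg (alphaStep α₀ a) (totalNoise P (poissonMap Q f) Z M x y) n) 2 Pr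
        + lpNorm (runAvg (alphaStep α₀ a) (totalNoise P (poissonMap Q' g) Z M' x y) n) 2 Pr) ∧
      ∀ n, lpNorm (fun ω => x n ω - xStar π f g) 2 Pr ≤ recConst T *
          (u n + v n + d n + (alphaStep α₀ a n + stepRatio α₀ β₀ a n) * G n) ∧
        lpNorm (fun ω => y n ω - yStar π f g) 2 Pr ≤ recConst T *
          (u n + v n + d n + (alphaStep α₀ a n + stepRatio α₀ β₀ a n) * G n) := by
  have hs := h.stepBounds
  have hm := h.meanField
  have hT := h.constBounds.one_le
  have hC1 := (le_recConst hT).1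
  have hC0 : 0 ≤ recConst T := by linarith
  set α := alphaStep α₀ a with hα
  set β := betaStep β₀ with hβ
  set ρ := stepRatio α₀ β₀ a with hρ
  set ξ := totalNoise P (poissonMap Q f) Z M x y with hξ
  set ξ' := totalNoise P (poissonMap Q' g) Z M' x y with hξ'
  set Hf := poissonMap Q f
  set Hg := poissonMap Q' g
  set xs := xStarOf π f
  set ys := yStar π f g
  have hβ0 : ∀ n, 0 < β n := fun n => by
    rw [hs.β_eq]; exact mul_pos (hs.ρ_pos n) (hs.α_pos n)
  set p : ℕ → Ω → X := fun n ω => correctedX α Hf (fun n => x n ω) (fun n => y n ω)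
    (fun n => Z n ω) (fun n => ξ n ω) n with hp
  set r : ℕ → Ω → Y := fun n ω => correctedY α β ρ Hg (fun n => x n ω) (fun n => y n ω)
    (fun n => Z n ω) (fun n => ξ' n ω) n with hr
  set D : ℕ → Ω → X := fun n ω => runAvg α (fun k => ξ k ω) n with hD
  set D' : ℕ → Ω → Y := fun n ω => runAvg α (fun k => ξ' k ω) n with hD'
  have hDeq : ∀ n, D n = runAvg α ξ n := fun n => funext fun ω => (runAvg_apply α ξ n ω).symm
  have hD'eq : ∀ n, D' n = runAvg α ξ' n := fun n => funext fun ω => (runAvg_apply α ξ' n ω).symm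
  have hDL : ∀ n, MemLp (D n) 2 Pr := fun n => by rw [hDeq]; exact h.noise_x.memLp_runAvg α n
  have hD'L : ∀ n, MemLp (D' n) 2 Pr := fun n => by rw [hD'eq]; exact h.noise_y.memLp_runAvg α n
  have hxm : ∀ n, Measurable (x n) := fun n =>
    (h.iteration.measurable_xy h.continuous_f h.continuous_g n).1.mono
      (h.iteration.filtration.le n) le_rfl
  have hym : ∀ n, Measurable (y n) := fun n =>
    (h.iteration.measurable_xy h.continuous_f h.continuous_g n).2.mono
      (h.iteration.filtration.le n) le_rfl
  have hHfL : ∀ n, MemLp (fun ω => Hf (x n ω) (y n ω) (Z n ω)) 2 Pr := fun n =>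
    memLp_of_norm_le_size (measurable_comp_state (fun i =>
      continuous_of_lipschitz_sum (h := fun x y => Hf x y i)
        fun x₁ x₂ y₁ y₂ => hm.lip_Hf x₁ x₂ y₁ y₂ i)
      (hxm n) (hym n) (h.iteration.measurable_Z n)).aestronglyMeasurable
      (h.memLp_xy n).1 (h.memLp_xy n).2 (Eventually.of_forall fun ω => hm.growth_Hf _ _ _)
  have hHgL : ∀ n, MemLp (fun ω => Hg (x n ω) (y n ω) (Z n ω)) 2 Pr := fun n =>
    memLp_of_norm_le_size (measurable_comp_state (fun i =>
      continuous_of_lipschitz_sum (h := fun x y => Hg x y i)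
        fun x₁ x₂ y₁ y₂ => hm.lip_Hg x₁ x₂ y₁ y₂ i)
      (hxm n) (hym n) (h.iteration.measurable_Z n)).aestronglyMeasurable
      (h.memLp_xy n).1 (h.memLp_xy n).2 (Eventually.of_forall fun ω => hm.growth_Hg _ _ _)
  have hpL : ∀ n, MemLp (p n) 2 Pr := fun n =>
    ((h.memLp_xy n).1.add ((hHfL n).const_smul (α n))).sub (hDL n)
  have hrL : ∀ n, MemLp (r n) 2 Pr := fun n =>
    ((h.memLp_xy n).2.add ((hHgL n).const_smul (β n))).sub ((hD'L n).const_smul (ρ n))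
  have hxsc : Continuous xs := by
    have : LipschitzWith ⟨T, by linarith⟩ xs := LipschitzWith.of_dist_le_mul fun y₁ y₂ => by
      rw [dist_eq_norm, dist_eq_norm]
      exact hm.lip_xs y₁ y₂
    exact this.continuous
  have hxsL : ∀ n, MemLp (fun ω => xs (r n ω)) 2 Pr := fun n => by
    have e1 : MemLp (fun ω => T * ‖r n ω - ys‖ + T) 2 Pr :=
      (((hrL n).sub (memLp_const ys)).norm.const_mul T).add (memLp_const T)
    refine e1.mono (hxsc.comp_aestronglyMeasurable (hrL n).aestronglyMeasurable)
      (Eventually.of_forall fun ω => ?_)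
    have e2 := norm_le_norm_add_norm_sub (xs ys) (xs (r n ω))
    have e3 := hm.lip_xs (r n ω) ys
    have e4 := hm.norm_xs
    rw [norm_sub_rev] at e2
    exact le_trans (by linarith) (le_abs_self _)
  have huL : ∀ n, MemLp (fun ω => ‖p n ω - xs (r n ω)‖) 2 Pr := fun n =>
    ((hpL n).sub (hxsL n)).norm
  have hvL : ∀ n, MemLp (fun ω => ‖r n ω - ys‖) 2 Pr := fun n =>
    ((hrL n).sub (memLp_const ys)).norm
  have hdL : ∀ n, MemLp (fun ω => ‖D n ω‖ + ‖D' n ω‖) 2 Pr := fun n =>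
    (hDL n).norm.add (hD'L n).norm
  have hκ0 : ∀ n, 0 ≤ α n + ρ n := fun n => (add_pos (hs.α_pos n) (hs.ρ_pos n)).le
  have hrec := ErrorRecursion.lpNorm h.mass_le (C := recConst T) h.c_pos.le h.c_le_one hC1
    hs.α_pos hs.α_le hβ0 hκ0 huL hvL hdL h.memLp_size
    (fun n ω => norm_nonneg _) (fun n ω => norm_nonneg _) (fun n ω => by positivity)
    (by filter_upwards [h.ae_isPath] with ω hω using hω.errorRecursion hm hs hT)
  refine ⟨_, _, _, _, hrec, fun n => rfl, fun n => ?_, fun n => ?_⟩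
  · refine (lpNorm_add_le_two (hDL n).norm).trans (le_of_eq ?_)
    rw [← hDeq, ← hD'eq]
    congr 1
    · exact lpNorm_norm (hDL n).aestronglyMeasurable 2
    · exact lpNorm_norm (hD'L n).aestronglyMeasurable 2
  · have herr : ∀ ω, ‖x n ω - xs ys‖ + ‖y n ω - ys‖ ≤ recConst T * (‖p n ω - xs (r n ω)‖
        + (‖r n ω - ys‖ + ((‖D n ω‖ + ‖D' n ω‖) + (α n + ρ n) * (1 + ‖x n ω‖ + ‖y n ω‖)))) :=
      fun ω => (norm_error_le (x := fun n => x n ω) (y := fun n => y n ω) (z := fun n => Z n ω)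
        (ξ := fun n => ξ n ω) (ξ' := fun n => ξ' n ω) hm hs hT n).trans_eq (by
          simp only [hp, hr, hD, hD']; ring)
    have hRL : MemLp (fun ω => recConst T * (‖p n ω - xs (r n ω)‖
        + (‖r n ω - ys‖ + ((‖D n ω‖ + ‖D' n ω‖) + (α n + ρ n) * (1 + ‖x n ω‖ + ‖y n ω‖))))) 2 Pr :=
      ((huL n).add ((hvL n).add ((hdL n).add ((h.memLp_size n).const_mul _)))).const_mul _
    have hR : lpNorm (fun ω => recConst T * (‖p n ω - xs (r n ω)‖
        + (‖r n ω - ys‖ + ((‖D n ω‖ + ‖D' n ω‖) + (α n + ρ n) * (1 + ‖x n ω‖ + ‖y n ω‖))))) 2 Pr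
        ≤ recConst T * (lpNorm (fun ω => ‖p n ω - xs (r n ω)‖) 2 Pr
          + lpNorm (fun ω => ‖r n ω - ys‖) 2 Pr + lpNorm (fun ω => ‖D n ω‖ + ‖D' n ω‖) 2 Pr
          + (α n + ρ n) * (1 + lpNorm (fun ω => 1 + ‖x n ω‖ + ‖y n ω‖) 2 Pr)) := by
      rw [lpNorm_const_mul hC0]
      refine mul_le_mul_of_nonneg_left ?_ hC0
      have e1 := lpNorm_add_le_two (F' := fun ω => ‖r n ω - ys‖ + ((‖D n ω‖ + ‖D' n ω‖)
        + (α n + ρ n) * (1 + ‖x n ω‖ + ‖y n ω‖))) (huL n)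
      have e2 := lpNorm_add_le_two (F' := fun ω => (‖D n ω‖ + ‖D' n ω‖)
        + (α n + ρ n) * (1 + ‖x n ω‖ + ‖y n ω‖)) (hvL n)
      have e3 := lpNorm_add_le_two (F' := fun ω => (α n + ρ n) * (1 + ‖x n ω‖ + ‖y n ω‖)) (hdL n)
      rw [lpNorm_const_mul (hκ0 n)] at e3
      linarith [hκ0 n]
    constructor
    · refine (lpNorm_le_of_ae_le hRL (Eventually.of_forall fun ω => ?_)).trans hR
      refine le_trans ?_ ((herr ω).trans (le_abs_self _))
      exact le_add_of_nonneg_right (norm_nonneg _)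
    · refine (lpNorm_le_of_ae_le hRL (Eventually.of_forall fun ω => ?_)).trans hR
      refine le_trans ?_ ((herr ω).trans (le_abs_self _))
      exact le_add_of_nonneg_left (norm_nonneg _)

end IsRegularScheme

end

end TwoTimeScale

/-! ### Almost sure convergence and mean-square rates -/

namespace TwoTimeScale

section

set_option linter.unusedSectionVars false

universe v w z t

variable {X : Type v} {Y : Type w} {S : Type z} {Ω : Type t}
  [MeasurableSpace X] [MeasurableSpace Y] [MeasurableSpace S]
  [NormedAddCommGroup X] [NormedSpace ℝ X] [FiniteDimensional ℝ X] [BorelSpace X]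
  [NormedAddCommGroup Y] [NormedSpace ℝ Y] [FiniteDimensional ℝ Y] [BorelSpace Y]
  [Fintype S] [MeasurableSingletonClass S] [MeasurableSpace Ω]
  {c q T lam mu K L α₀ β₀ a : ℝ} {P : Matrix S S ℝ} {π : S → ℝ} {Q Q' : Matrix S S ℝ}
  {f : X → Y → S → X} {g : X → Y → S → Y} {Pr : Measure Ω} {Z : ℕ → Ω → S} {M : ℕ → Ω → X}
  {M' : ℕ → Ω → Y} {x : ℕ → Ω → X} {y : ℕ → Ω → Y}

/-- `B` bounds the mean-square norm of the averaged noise at time `n`, in units of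
`decay (a / 2) n` and relative to the running maximum of the mean-square norms of the noise. -/
def IsNoiseConst (E : Type v) [NormedAddCommGroup E] [NormedSpace ℝ E] [CompleteSpace E]
    (α₀ a B : ℝ) : Prop :=
  0 ≤ B ∧ ∀ {Ω : Type t} {m0 : MeasurableSpace Ω} (μ : Measure Ω) [IsFiniteMeasure μ]
    (ℱ : Filtration ℕ m0) (ξ : ℕ → Ω → E), IsMartingaleNoise μ ℱ ξ →
    ∀ n b, (∀ k < n, lpNorm (ξ k) 2 μ ≤ b) → 0 ≤ b →
      lpNorm (runAvg (alphaStep α₀ a) ξ n) 2 μ ≤ B * decay (a / 2) n * b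

theorem tendsto_sum_alphaStep (hα₀ : 0 < α₀) (ha : a ≤ 1) :
    Tendsto (fun n => ∑ k ∈ Finset.range n, alphaStep α₀ a k) atTop atTop := by
  simp_rw [alphaStep_eq, ← Finset.mul_sum]
  exact (tendsto_sum_decay ha).const_mul_atTop hα₀

theorem tendsto_sum_betaStep (hβ₀ : 0 < β₀) :
    Tendsto (fun n => ∑ k ∈ Finset.range n, betaStep β₀ k) atTop atTop := by
  simp_rw [betaStep_eq, ← Finset.mul_sum]
  exact (tendsto_sum_decay le_rfl).const_mul_atTop hβ₀

theorem tendsto_betaStep (β₀ : ℝ) : Tendsto (betaStep β₀) atTop (𝓝 0) := by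
  rw [betaStep_eq]
  simpa using (tendsto_decay one_pos).const_mul β₀

theorem tendsto_alphaStep_add_stepRatio (α₀ β₀ : ℝ) (ha0 : 0 < a) (ha1 : a < 1) :
    Tendsto (fun n => alphaStep α₀ a n + stepRatio α₀ β₀ a n) atTop (𝓝 0) := by
  simp only [alphaStep_eq, stepRatio]
  simpa using ((tendsto_decay ha0).const_mul α₀).add
    ((tendsto_decay (sub_pos.2 ha1)).const_mul (β₀ / α₀))

namespace IsRegularScheme

variable [IsFiniteMeasure Pr] [CompleteSpace X] [CompleteSpace Y]

/-- The averaged noise, relative to the running maximum of the mean-square size of the iterates. -/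
theorem lpNorm_runAvg_le
    (h : IsRegularScheme c q T lam mu K L α₀ β₀ a P π Q Q' f g Pr Z M M' x y) {Bx By : ℝ}
    (hBx : IsNoiseConst.{v, t} X α₀ a Bx) (hBy : IsNoiseConst.{w, t} Y α₀ a By) (n : ℕ) (b : ℝ)
    (hb : ∀ k ≤ n, 1 + lpNorm (fun ω => 1 + ‖x k ω‖ + ‖y k ω‖) 2 Pr ≤ b) :
    lpNorm (runAvg (alphaStep α₀ a) (totalNoise P (poissonMap Q f) Z M x y) n) 2 Pr
      + lpNorm (runAvg (alphaStep α₀ a) (totalNoise P (poissonMap Q' g) Z M' x y) n) 2 Pr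
      ≤ (Bx + By) * T * decay (a / 2) n * b := by
  have hT0 : 0 ≤ T := by linarith [h.constBounds.one_le]
  have hb0 : 0 ≤ b := (add_nonneg zero_le_one lpNorm_nonneg).trans (hb 0 (Nat.zero_le n))
  have h1 := hBx.2 Pr _ _ h.noise_x n (T * b) (fun k hk => (h.lpNorm_noise_le k).1.trans
    (mul_le_mul_of_nonneg_left (hb k hk.le) hT0)) (mul_nonneg hT0 hb0)
  have h2 := hBy.2 Pr _ _ h.noise_y n (T * b) (fun k hk => (h.lpNorm_noise_le k).2.trans
    (mul_le_mul_of_nonneg_left (hb k hk.le) hT0)) (mul_nonneg hT0 hb0)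
  linarith

theorem ae_tendsto
    (h : IsRegularScheme c q T lam mu K L α₀ β₀ a P π Q Q' f g Pr Z M M' x y) {Bx By : ℝ}
    (hBx : IsNoiseConst.{v, t} X α₀ a Bx) (hBy : IsNoiseConst.{w, t} Y α₀ a By) :
    ∀ᵐ ω ∂Pr, Tendsto (fun n => x n ω) atTop (𝓝 (xStar π f g)) ∧
      Tendsto (fun n => y n ω) atTop (𝓝 (yStar π f g)) := by
  have hs := h.stepBounds
  have hm := h.meanField
  have hT := h.constBounds.one_le
  have hT0 : 0 ≤ T := by linarith
  have hC1 := (le_recConst hT).1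
  have ha0 : 0 < a := by linarith [h.half_lt_a]
  have hβ0 : ∀ n, 0 < betaStep β₀ n := fun n => by
    rw [hs.β_eq]; exact mul_pos (hs.ρ_pos n) (hs.α_pos n)
  have hκ0 : ∀ n, 0 ≤ alphaStep α₀ a n + stepRatio α₀ β₀ a n := fun n =>
    (add_pos (hs.α_pos n) (hs.ρ_pos n)).le
  have hκ := tendsto_alphaStep_add_stepRatio α₀ β₀ ha0 h.a_lt_one
  -- Second moments are bounded, so that the averaged noise vanishes almost surely.
  obtain ⟨u, v, d, G, hrec, hGeq, hd, -⟩ := h.exists_lpNorm_recursion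
  have hA : 0 ≤ (Bx + By) * T := mul_nonneg (add_nonneg hBx.1 hBy.1) hT0
  have hε : Tendsto (fun n => (Bx + By) * T * decay (a / 2) n) atTop (𝓝 0) := by
    simpa using (tendsto_decay (half_pos ha0)).const_mul ((Bx + By) * T)
  obtain ⟨B, -, hB⟩ := ErrorRecursion.exists_bound h.c_pos h.c_le_one
    (by linarith : 1 ≤ 2 * recConst T) hs.α_pos hs.α_le hβ0 (tendsto_betaStep β₀) hκ0 hκ
    (fun n => mul_nonneg hA (decay_pos _ n).le) hε
  have hbound := hB u v d G hrec fun n b hb => (hd n).trans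
    (h.lpNorm_runAvg_le hBx hBy n b fun k hk => (hGeq k).symm.le.trans (hb k hk))
  have hsq : Summable fun n => alphaStep α₀ a n ^ 2 := by
    simp_rw [alphaStep_eq, mul_pow, sq_decay]
    exact (summable_decay (by linarith [h.half_lt_a])).mul_left _
  have hξ := ae_tendsto_runAvg h.noise_x (fun n => (hs.α_pos n).le) hs.α_le
    (tendsto_sum_alphaStep h.α₀_pos h.a_lt_one.le) hsq (b := T * (B * G 0)) fun n =>
      (h.lpNorm_noise_le n).1.trans (mul_le_mul_of_nonneg_left (by rw [← hGeq]; exact hbound n) hT0)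
  have hξ' := ae_tendsto_runAvg h.noise_y (fun n => (hs.α_pos n).le) hs.α_le
    (tendsto_sum_alphaStep h.α₀_pos h.a_lt_one.le) hsq (b := T * (B * G 0)) fun n =>
      (h.lpNorm_noise_le n).2.trans (mul_le_mul_of_nonneg_left (by rw [← hGeq]; exact hbound n) hT0)
  filter_upwards [h.ae_isPath, hξ, hξ'] with ω hω h1 h2
  have h1' := h1.congr fun n => runAvg_apply _ _ n ω
  have h2' := h2.congr fun n => runAvg_apply _ _ n ω
  have hD := h1'.norm.add h2'.norm
  rw [norm_zero, norm_zero, add_zero] at hD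
  obtain ⟨tu, tv, tG⟩ := (hω.errorRecursion hm hs hT).tendsto_zero h.c_pos h.c_le_one hC1
    hs.α_pos hs.α_le (tendsto_sum_alphaStep h.α₀_pos h.a_lt_one.le) hβ0 (tendsto_betaStep β₀)
    (tendsto_sum_betaStep h.β₀_pos) hκ0 hκ hD
  have herr : Tendsto (fun n => ‖x n ω - xStar π f g‖ + ‖y n ω - yStar π f g‖) atTop (𝓝 0) := by
    refine squeeze_zero (fun n => by positivity)
      (fun n => norm_error_le (x := fun n => x n ω) (y := fun n => y n ω) (z := fun n => Z n ω)
        (ξ := fun n => totalNoise P (poissonMap Q f) Z M x y n ω)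
        (ξ' := fun n => totalNoise P (poissonMap Q' g) Z M' x y n ω) hm hs hT n) ?_
    simpa using (((tu.add tv).add hD).add tG).const_mul (recConst T)
  constructor
  · rw [tendsto_iff_norm_sub_tendsto_zero]
    exact squeeze_zero (fun n => norm_nonneg _)
      (fun n => le_add_of_nonneg_right (norm_nonneg _)) herr
  · rw [tendsto_iff_norm_sub_tendsto_zero]
    exact squeeze_zero (fun n => norm_nonneg _)
      (fun n => le_add_of_nonneg_left (norm_nonneg _)) herr

end IsRegularScheme

/-- The exponent of the rate: mean squares decay like `(n + 1) ^ (-2 s)`. -/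
def rateExponent (a : ℝ) : ℝ := min (a / 2) (1 - a)

/-- The mean-square rate, with a constant that does not depend on the maps, the probability space or
the noise. The condition on `β₀` lets the slow contraction beat the decrease of the rate. -/
theorem exists_meanSquare_rate (X : Type v) (Y : Type w)
    [MeasurableSpace X] [MeasurableSpace Y]
    [NormedAddCommGroup X] [NormedSpace ℝ X] [FiniteDimensional ℝ X] [BorelSpace X]
    [NormedAddCommGroup Y] [NormedSpace ℝ Y] [FiniteDimensional ℝ Y] [BorelSpace Y]
    [CompleteSpace X] [CompleteSpace Y]
    (hc : 0 < c) (hc1 : c ≤ 1) (hα₀ : 0 < α₀)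
    (hα1 : α₀ < 1) (hβ₀ : 1 ≤ c * β₀) (ha0 : 1 / 2 < a) (ha1 : a < 1)
    (hT : ConstBounds c K L q α₀ β₀ T) {Bx By : ℝ} (hBx : IsNoiseConst.{v, t} X α₀ a Bx)
    (hBy : IsNoiseConst.{w, t} Y α₀ a By) :
    ∃ B : ℝ, 1 ≤ B ∧ ∀ {S : Type z} {Ω : Type t} [MeasurableSpace S] [Fintype S]
      [MeasurableSingletonClass S] [MeasurableSpace Ω] {P : Matrix S S ℝ} {π : S → ℝ}
      {Q Q' : Matrix S S ℝ} {f : X → Y → S → X} {g : X → Y → S → Y} {Pr : Measure Ω}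
      [IsFiniteMeasure Pr] {Z : ℕ → Ω → S} {M : ℕ → Ω → X}
      {M' : ℕ → Ω → Y} {x : ℕ → Ω → X} {y : ℕ → Ω → Y},
      IsRegularScheme c q T lam mu K L α₀ β₀ a P π Q Q' f g Pr Z M M' x y → ∀ n,
        lpNorm (fun ω => x n ω - xStar π f g) 2 Pr
          ≤ B * (1 + lpNorm (fun ω => 1 + ‖x 0 ω‖ + ‖y 0 ω‖) 2 Pr) * decay (rateExponent a) n ∧
        lpNorm (fun ω => y n ω - yStar π f g) 2 Pr
          ≤ B * (1 + lpNorm (fun ω => 1 + ‖x 0 ω‖ + ‖y 0 ω‖) 2 Pr)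
            * decay (rateExponent a) n := by
  have hβ₀0 : 0 < β₀ := by
    by_contra hneg
    nlinarith
  set s := rateExponent a with hs_def
  have hs0 : 0 < s := lt_min (by linarith) (by linarith)
  have hsa : s ≤ a / 2 := min_le_left _ _
  have hsb : s ≤ 1 - a := min_le_right _ _
  have hT1 := hT.one_le
  have hT0 : 0 ≤ T := by linarith
  have hC1 := (le_recConst hT1).1
  have hst : StepBounds T (alphaStep α₀ a) (betaStep β₀) (stepRatio α₀ β₀ a) :=
    TwoTimeScale.stepBounds hT hα₀ hα1 hβ₀0 (by linarith) ha1.le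
  have hβ0 : ∀ n, 0 < betaStep β₀ n := fun n => by
    rw [hst.β_eq]; exact mul_pos (hst.ρ_pos n) (hst.α_pos n)
  have hρ₀ : 0 < β₀ / α₀ := by positivity
  have hA0 : 0 ≤ (Bx + By) * T := mul_nonneg (add_nonneg hBx.1 hBy.1) hT0
  obtain ⟨B, hB1, hB⟩ := ErrorRecursion.exists_rate (e := decay s)
    (A := (Bx + By) * T + (1 + β₀ / α₀)) (κ := fun n => alphaStep α₀ a n + stepRatio α₀ β₀ a n)
    hc hc1 (by linarith : 1 ≤ 2 * recConst T) hst.α_pos hst.α_le hβ0 (tendsto_betaStep β₀)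
    (decay_pos s) (decay_antitone hs0.le) (tendsto_decay hs0) (by positivity)
    (fun n => (add_pos (hst.α_pos n) (hst.ρ_pos n)).le)
    (fun n => by
      simp only [alphaStep_eq, stepRatio]
      have e1 := decay_le_decay (by linarith : s ≤ a) n
      have e2 := mul_le_mul_of_nonneg_left (decay_le_decay hsb n) hρ₀.le
      have e3 : α₀ * decay a n ≤ 1 * decay a n :=
        mul_le_mul_of_nonneg_right hα1.le (decay_pos a n).le
      have e4 := mul_nonneg hA0 (decay_pos s n).le
      linarith)
    (by
      filter_upwards [eventually_ratio (by positivity : 0 < c / 2 * α₀) hs0.le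
        (by linarith : s ≤ 1) ha1] with n hn
      rw [alphaStep_eq]
      simpa only [mul_assoc] using hn)
    (Eventually.of_forall fun n => by
      refine le_trans (mul_le_mul_of_nonneg_right ?_ (decay_pos s n).le)
        (decay_ratio hs0.le (by linarith) n)
      rw [betaStep_eq]
      have e1 : s * decay 1 n ≤ c / 2 * β₀ * decay 1 n :=
        mul_le_mul_of_nonneg_right (by linarith) (decay_pos 1 n).le
      linarith)
  have hB0 : 0 ≤ B := by linarith
  refine ⟨recConst T * B, by nlinarith, ?_⟩
  intro S Ω _ _ _ _ P π Q Q' f g Pr _ Z M M' x y h n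
  obtain ⟨u, v, d, G, hrec, hGeq, hd, herr⟩ := h.exists_lpNorm_recursion
  have hrate := hB u v d G hrec (fun n b hb => by
    have e1 := (hd n).trans
      (h.lpNorm_runAvg_le hBx hBy n b fun k hk => (hGeq k).symm.le.trans (hb k hk))
    have hb0 : 0 ≤ b := (zero_le_one.trans (hrec.one_le_G 0)).trans (hb 0 (Nat.zero_le n))
    refine e1.trans (mul_le_mul_of_nonneg_right ?_ hb0)
    have e2 := mul_le_mul_of_nonneg_left (decay_le_decay hsa n) hA0
    have e3 := mul_nonneg (by linarith : 0 ≤ 1 + β₀ / α₀) (decay_pos s n).le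
    linarith) n
  have e1 := mul_le_mul_of_nonneg_left hrate (by linarith : 0 ≤ recConst T)
  rw [hGeq 0] at e1
  obtain ⟨hx, hy⟩ := herr n
  constructor <;> linarith

/-- Restriction of an iteration to an event known at time zero. -/
theorem IsIteration.restrict [IsFiniteMeasure Pr] {α β : ℕ → ℝ}
    (h : IsIteration Pr P f g K α β Z M M' x y) {A : Set Ω}
    (hA : MeasurableSet[history (x 0) (y 0) Z M M' 0] A) :
    IsIteration (Pr.restrict A) P f g K α β Z M M' x y := by
  have hAn : ∀ n, MeasurableSet[h.filtration n] A := fun n =>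
    h.filtration.mono (Nat.zero_le n) A hA
  have hcX : CompleteSpace X := FiniteDimensional.complete ℝ X
  have hcY : CompleteSpace Y := FiniteDimensional.complete ℝ Y
  exact
    { h with
      markov := fun n j => by
        refine (condExp_restrict_ae_eq_restrict (h.filtration.le n) (hAn n) ?_).trans
          (ae_restrict_of_ae (h.markov n j))
        exact (integrable_const (1 : ℝ)).indicator
          (h.measurable_Z (n + 1) (measurableSet_singleton j))
      integrable_M := fun n => (h.integrable_M n).restrict
      integrable_M' := fun n => (h.integrable_M' n).restrict
      condExp_M := fun n =>
        (condExp_restrict_ae_eq_restrict (h.filtration.le n) (hAn n) (h.integrable_M n)).trans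
          (ae_restrict_of_ae (h.condExp_M n))
      condExp_M' := fun n =>
        (condExp_restrict_ae_eq_restrict (h.filtration.le n) (hAn n) (h.integrable_M' n)).trans
          (ae_restrict_of_ae (h.condExp_M' n))
      noise_growth := fun n => ae_restrict_of_ae (h.noise_growth n) }

end

end TwoTimeScale

end

theorem theorem1
    {X : Type uX} [NormedAddCommGroup X] [NormedSpace ℝ X] [FiniteDimensional ℝ X]
    [MeasurableSpace X] [BorelSpace X]
    {Y : Type uY} [NormedAddCommGroup Y] [NormedSpace ℝ Y] [FiniteDimensional ℝ Y]
    [MeasurableSpace Y] [BorelSpace Y]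
    (lam mu a : ℝ) (hlam0 : 0 ≤ lam) (hlam1 : lam < 1) (hmu0 : 0 ≤ mu) (hmu1 : mu < 1)
    (ha0 : 1 / 2 < a) (ha1 : a < 1) :
    -- almost sure convergence
    (∀ (α₀ β₀ : ℝ), 0 < α₀ → α₀ < 1 → 0 < β₀ →
      ∀ (S : Type uS) [Fintype S] [MeasurableSpace S] [MeasurableSingletonClass S]
        (P : Matrix S S ℝ) (π : S → ℝ), TwoTimeScale.IsIrreducibleChain P π →
      ∀ (K L : ℝ), 0 < K → 0 ≤ L →
      ∀ (f : X → Y → S → X) (g : X → Y → S → Y),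
        TwoTimeScale.IsContractiveSystem π lam mu K L f g →
      ∀ (Ω : Type uO) [MeasurableSpace Ω] (Pr : Measure Ω) [IsProbabilityMeasure Pr]
        (Z : ℕ → Ω → S) (M : ℕ → Ω → X) (M' : ℕ → Ω → Y) (x : ℕ → Ω → X) (y : ℕ → Ω → Y),
        TwoTimeScale.IsIteration Pr P f g K
          (TwoTimeScale.alphaStep α₀ a) (TwoTimeScale.betaStep β₀) Z M M' x y →
      ∀ᵐ ω ∂Pr,
        Tendsto (fun n => x n ω) atTop (𝓝 (TwoTimeScale.xStar π f g)) ∧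
        Tendsto (fun n => y n ω) atTop (𝓝 (TwoTimeScale.yStar π f g))) ∧
    -- mean square bounds
    (∃ C₃ : ℝ, 0 < C₃ ∧
      ∀ (α₀ β₀ : ℝ), 0 < α₀ → α₀ < 1 → C₃ ≤ β₀ →
      ∃ n₀ : ℕ,
      ∀ (S : Type uS) [Fintype S] [MeasurableSpace S] [MeasurableSingletonClass S]
        (P : Matrix S S ℝ) (π : S → ℝ), TwoTimeScale.IsIrreducibleChain P π →
      ∀ (K L R : ℝ), 0 < K → 0 ≤ L →
      ∃ C₁ C₂ C₄ : ℝ, 0 < C₁ ∧ 0 < C₂ ∧ 0 < C₄ ∧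
      ∀ (f : X → Y → S → X) (g : X → Y → S → Y),
        TwoTimeScale.IsContractiveSystem π lam mu K L f g →
      ∀ (Ω : Type uO) [MeasurableSpace Ω] (Pr : Measure Ω) [IsProbabilityMeasure Pr]
        (Z : ℕ → Ω → S) (M : ℕ → Ω → X) (M' : ℕ → Ω → Y) (x : ℕ → Ω → X) (y : ℕ → Ω → Y),
        TwoTimeScale.IsIteration Pr P f g K
          (TwoTimeScale.alphaStep α₀ a) (TwoTimeScale.betaStep β₀) Z M M' x y →
        MemLp (x 0) 2 Pr → MemLp (y 0) 2 Pr →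
        (∫ ω, ‖x 0 ω‖ ^ 2 ∂Pr) + (∫ ω, ‖y 0 ω‖ ^ 2 ∂Pr) ≤ R →
      ∀ n : ℕ, n₀ ≤ n →
        Integrable (fun ω => ‖x n ω - TwoTimeScale.xStar π f g‖ ^ 2) Pr ∧
        Integrable (fun ω => ‖y n ω - TwoTimeScale.yStar π f g‖ ^ 2) Pr ∧
        (∫ ω, ‖x n ω - TwoTimeScale.xStar π f g‖ ^ 2 ∂Pr) ≤
          C₁ * (TwoTimeScale.alphaStep α₀ a n +
            TwoTimeScale.betaStep β₀ n ^ 2 / TwoTimeScale.alphaStep α₀ a n ^ 2) ∧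
        (∫ ω, ‖y n ω - TwoTimeScale.yStar π f g‖ ^ 2 ∂Pr) ≤
          C₂ * (TwoTimeScale.alphaStep α₀ a n +
            TwoTimeScale.betaStep β₀ n ^ 2 / TwoTimeScale.alphaStep α₀ a n ^ 2) ∧
        (a = 2 / 3 →
          (∫ ω, ‖x n ω - TwoTimeScale.xStar π f g‖ ^ 2 ∂Pr) ≤
            C₄ * ((n : ℝ) + 1) ^ (-(2 / 3) : ℝ) ∧
          (∫ ω, ‖y n ω - TwoTimeScale.yStar π f g‖ ^ 2 ∂Pr) ≤
            C₄ * ((n : ℝ) + 1) ^ (-(2 / 3) : ℝ))) := by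
  have hcX : CompleteSpace X := FiniteDimensional.complete ℝ X
  have hcY : CompleteSpace Y := FiniteDimensional.complete ℝ Y
  set c : ℝ := min (1 - lam) (1 - mu) with hc_def
  have hc : 0 < c := lt_min (by linarith) (by linarith)
  have hc1 : c ≤ 1 := (min_le_left _ _).trans (by linarith)
  have hlamc : lam ≤ 1 - c := by linarith [min_le_left (1 - lam) (1 - mu)]
  have hmuc : mu ≤ 1 - c := by linarith [min_le_right (1 - lam) (1 - mu)]
  refine ⟨?_, 1 / c, by positivity, ?_⟩
  · intro α₀ β₀ hα₀ hα1 hβ₀ S _ _ _ P π hch K L hK hL f g hsys Ω _ Pr _ Z M M' x y hit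
    obtain ⟨Q, hQ⟩ := hch.exists_poisson
    obtain ⟨Q', hQ'⟩ := hch.exists_poisson
    have hq := TwoTimeScale.entrySum_nonneg Q
    have hq' := TwoTimeScale.entrySum_nonneg Q'
    obtain ⟨T, hT⟩ := TwoTimeScale.exists_constBounds (c := c) hc hK hL (add_nonneg hq hq') hα₀ hβ₀
    obtain ⟨Bx, hBx⟩ := TwoTimeScale.exists_lpNorm_runAvg_le X hα₀ hα1 (by linarith : 0 ≤ a) ha1
    obtain ⟨By, hBy⟩ := TwoTimeScale.exists_lpNorm_runAvg_le Y hα₀ hα1 (by linarith : 0 ≤ a) ha1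
    -- Localize to initial values of size at most `N`, which are square integrable.
    set A : ℕ → Set Ω := fun N => {ω | ‖x 0 ω‖ + ‖y 0 ω‖ ≤ N} with hA_def
    have hA : ∀ N, MeasurableSet[TwoTimeScale.history (x 0) (y 0) Z M M' 0] (A N) := fun N => by
      have e1 := measurable_norm.comp (TwoTimeScale.measurable_history_x₀ (x₀ := x 0)
        (y₀ := y 0) (Z := Z) (M := M) (M' := M') 0)
      have e2 := measurable_norm.comp (TwoTimeScale.measurable_history_y₀ (x₀ := x 0)
        (y₀ := y 0) (Z := Z) (M := M) (M' := M') 0)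
      exact (e1.add e2) measurableSet_Iic
    have hA' : ∀ N, MeasurableSet (A N) := fun N => hit.filtration.le 0 _ (hA N)
    have hreg : ∀ N, TwoTimeScale.IsRegularScheme c (TwoTimeScale.entrySum Q
        + TwoTimeScale.entrySum Q') T lam mu K L α₀ β₀ a P π Q Q' f g (Pr.restrict (A N))
        Z M M' x y := by
      intro N
      have hbx : ∀ᵐ ω ∂Pr.restrict (A N), ‖x 0 ω‖ ≤ N := by
        filter_upwards [ae_restrict_mem (hA' N)] with ω hω
        have : ‖x 0 ω‖ + ‖y 0 ω‖ ≤ N := hω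
        linarith [norm_nonneg (y 0 ω)]
      have hby : ∀ᵐ ω ∂Pr.restrict (A N), ‖y 0 ω‖ ≤ N := by
        filter_upwards [ae_restrict_mem (hA' N)] with ω hω
        have : ‖x 0 ω‖ + ‖y 0 ω‖ ≤ N := hω
        linarith [norm_nonneg (x 0 ω)]
      refine ⟨hc, hc1, hlam0, hlamc, hmu0, hmuc, hK, hL, hα₀, hα1, hβ₀, ha0, ha1, hT, hch, hQ _,
        hQ' _, by linarith, by linarith, hsys, hit.restrict (hA N), ?_, ?_, ?_⟩
      · rw [measureReal_restrict_apply_univ]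
        exact measureReal_le_one
      · exact MemLp.of_bound hit.measurable_x₀.aestronglyMeasurable N hbx
      · exact MemLp.of_bound hit.measurable_y₀.aestronglyMeasurable N hby
    have hae := fun N => (ae_restrict_iff' (hA' N)).1 ((hreg N).ae_tendsto hBx hBy)
    filter_upwards [ae_all_iff.2 hae] with ω hω
    obtain ⟨N, hN⟩ := exists_nat_ge (‖x 0 ω‖ + ‖y 0 ω‖)
    exact hω N hN
  · intro α₀ β₀ hα₀ hα1 hβ₀
    -- `c β₀ ≥ 1 ≥ 2 s`, where the rate decreases like `(n + 1) ^ (-s)`.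
    have hcβ : 1 ≤ c * β₀ := by rwa [div_le_iff₀' hc] at hβ₀
    have hβ₀0 : 0 < β₀ := lt_of_lt_of_le (by positivity) hβ₀
    refine ⟨0, ?_⟩
    intro S _ _ _ P π hch K L R hK hL
    obtain ⟨Q, hQ⟩ := hch.exists_poisson
    obtain ⟨Q', hQ'⟩ := hch.exists_poisson
    have hq := TwoTimeScale.entrySum_nonneg Q
    have hq' := TwoTimeScale.entrySum_nonneg Q'
    obtain ⟨T, hT⟩ := TwoTimeScale.exists_constBounds (c := c) hc hK hL (add_nonneg hq hq') hα₀
      hβ₀0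
    obtain ⟨Bx, hBx⟩ := TwoTimeScale.exists_lpNorm_runAvg_le X hα₀ hα1 (by linarith : 0 ≤ a) ha1
    obtain ⟨By, hBy⟩ := TwoTimeScale.exists_lpNorm_runAvg_le Y hα₀ hα1 (by linarith : 0 ≤ a) ha1
    obtain ⟨B, hB1, hB⟩ := TwoTimeScale.exists_meanSquare_rate (lam := lam) (mu := mu) X Y hc hc1
      hα₀ hα1 hcβ ha0 ha1 hT hBx hBy
    set W : ℝ := B * (2 + 2 * √|R|) with hW
    have hW0 : 0 < W := by positivity
    set ρ₀ : ℝ := β₀ / α₀ with hρ₀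
    have hρ₀0 : 0 < ρ₀ := by positivity
    set s := TwoTimeScale.rateExponent a with hs
    -- The square of the rate is one of the two terms of the bound, up to a constant.
    have hrate : ∀ n, TwoTimeScale.decay s n ^ 2 ≤ (1 / α₀ + 1 / ρ₀ ^ 2) *
        (TwoTimeScale.alphaStep α₀ a n +
          TwoTimeScale.betaStep β₀ n ^ 2 / TwoTimeScale.alphaStep α₀ a n ^ 2) := by
      intro n
      have hαn : 0 < TwoTimeScale.alphaStep α₀ a n := by
        rw [TwoTimeScale.alphaStep_eq]; exact mul_pos hα₀ (TwoTimeScale.decay_pos a n)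
      have e1 : TwoTimeScale.betaStep β₀ n ^ 2 / TwoTimeScale.alphaStep α₀ a n ^ 2
          = ρ₀ ^ 2 * TwoTimeScale.decay (2 * (1 - a)) n := by
        rw [TwoTimeScale.betaStep_eq_ratio_mul β₀ a hα₀.ne' n, mul_pow,
          mul_div_cancel_right₀ _ (pow_ne_zero 2 hαn.ne'), TwoTimeScale.stepRatio, mul_pow,
          TwoTimeScale.sq_decay]
      have e2 : TwoTimeScale.decay s n ^ 2
          ≤ TwoTimeScale.decay a n + TwoTimeScale.decay (2 * (1 - a)) n := by
        rw [TwoTimeScale.sq_decay, hs, TwoTimeScale.rateExponent]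
        have p1 := TwoTimeScale.decay_pos a n
        have p2 := TwoTimeScale.decay_pos (2 * (1 - a)) n
        rcases min_choice (a / 2) (1 - a) with hmin | hmin
        · rw [hmin, mul_div_cancel₀ a (two_ne_zero' ℝ)]
          linarith
        · rw [hmin]
          linarith
      have e3 : TwoTimeScale.alphaStep α₀ a n = α₀ * TwoTimeScale.decay a n := by
        rw [TwoTimeScale.alphaStep_eq]
      refine e2.trans ?_
      rw [e1, e3]
      have p1 := TwoTimeScale.decay_pos a n
      have p2 := TwoTimeScale.decay_pos (2 * (1 - a)) n
      have e4 : (1 / α₀ + 1 / ρ₀ ^ 2) * (α₀ * TwoTimeScale.decay a n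
          + ρ₀ ^ 2 * TwoTimeScale.decay (2 * (1 - a)) n)
          = TwoTimeScale.decay a n + TwoTimeScale.decay (2 * (1 - a)) n
            + (ρ₀ ^ 2 / α₀ * TwoTimeScale.decay (2 * (1 - a)) n
              + α₀ / ρ₀ ^ 2 * TwoTimeScale.decay a n) := by
        field_simp
        ring
      rw [e4]
      have : 0 ≤ ρ₀ ^ 2 / α₀ * TwoTimeScale.decay (2 * (1 - a)) n
          + α₀ / ρ₀ ^ 2 * TwoTimeScale.decay a n := by positivity
      linarith
    refine ⟨W ^ 2 * (1 / α₀ + 1 / ρ₀ ^ 2), W ^ 2 * (1 / α₀ + 1 / ρ₀ ^ 2), W ^ 2, by positivity,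
      by positivity, by positivity, ?_⟩
    intro f g hsys Ω _ Pr _ Z M M' x y hit hx0 hy0 hR n _
    have hreg : TwoTimeScale.IsRegularScheme c (TwoTimeScale.entrySum Q
        + TwoTimeScale.entrySum Q') T lam mu K L α₀ β₀ a P π Q Q' f g Pr Z M M' x y :=
      ⟨hc, hc1, hlam0, hlamc, hmu0, hmuc, hK, hL, hα₀, hα1, hβ₀0, ha0, ha1, hT, hch, hQ _,
        hQ' _, by linarith, by linarith, hsys, hit, measureReal_le_one, hx0, hy0⟩
    have hx0R : lpNorm (x 0) 2 Pr ≤ √|R| := by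
      refine TwoTimeScale.lpNorm_two_le_of_integral_le hx0 (Real.sqrt_nonneg _) ?_
      rw [Real.sq_sqrt (abs_nonneg R)]
      have : 0 ≤ ∫ ω, ‖y 0 ω‖ ^ 2 ∂Pr := integral_nonneg fun ω => by positivity
      linarith [le_abs_self R]
    have hy0R : lpNorm (y 0) 2 Pr ≤ √|R| := by
      refine TwoTimeScale.lpNorm_two_le_of_integral_le hy0 (Real.sqrt_nonneg _) ?_
      rw [Real.sq_sqrt (abs_nonneg R)]
      have : 0 ≤ ∫ ω, ‖x 0 ω‖ ^ 2 ∂Pr := integral_nonneg fun ω => by positivity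
      linarith [le_abs_self R]
    have hG0 : 1 + lpNorm (fun ω => 1 + ‖x 0 ω‖ + ‖y 0 ω‖) 2 Pr ≤ 2 + 2 * √|R| := by
      have e1 := TwoTimeScale.lpNorm_add_le_two (Pr := Pr) (F := fun ω => 1 + ‖x 0 ω‖)
        (F' := fun ω => ‖y 0 ω‖) ((memLp_const (1 : ℝ)).add hx0.norm)
      have e2 := TwoTimeScale.lpNorm_add_le_two (Pr := Pr) (F := fun _ => (1 : ℝ))
        (F' := fun ω => ‖x 0 ω‖) (memLp_const (1 : ℝ))
      have e3 := TwoTimeScale.lpNorm_const_one_le (Pr := Pr) measureReal_le_one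
      have e4 : lpNorm (fun ω => ‖x 0 ω‖) 2 Pr = lpNorm (x 0) 2 Pr :=
        lpNorm_norm hx0.aestronglyMeasurable 2
      have e5 : lpNorm (fun ω => ‖y 0 ω‖) 2 Pr = lpNorm (y 0) 2 Pr :=
        lpNorm_norm hy0.aestronglyMeasurable 2
      linarith
    have hdec := TwoTimeScale.decay_pos s n
    have hWle : B * (1 + lpNorm (fun ω => 1 + ‖x 0 ω‖ + ‖y 0 ω‖) 2 Pr)
        * TwoTimeScale.decay s n ≤ W * TwoTimeScale.decay s n := by
      rw [hW]; gcongr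
    obtain ⟨hx, hy⟩ := hB hreg n
    obtain ⟨lx, ly⟩ := hreg.memLp_xy n
    have lx' : MemLp (fun ω => x n ω - TwoTimeScale.xStar π f g) 2 Pr := lx.sub (memLp_const _)
    have ly' : MemLp (fun ω => y n ω - TwoTimeScale.yStar π f g) 2 Pr := ly.sub (memLp_const _)
    have ix := TwoTimeScale.integral_le_of_lpNorm_le lx' (hx.trans hWle)
    have iy := TwoTimeScale.integral_le_of_lpNorm_le ly' (hy.trans hWle)
    rw [mul_pow] at ix iy
    have hmain := mul_le_mul_of_nonneg_left (hrate n) (sq_nonneg W)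
    rw [← mul_assoc] at hmain
    refine ⟨lx'.integrable_norm_pow (by norm_num), ly'.integrable_norm_pow (by norm_num),
      ix.trans hmain, iy.trans hmain, ?_⟩
    intro ha
    have hdecay : TwoTimeScale.decay s n ^ 2 = ((n : ℝ) + 1) ^ (-(2 / 3) : ℝ) := by
      rw [TwoTimeScale.sq_decay, hs, TwoTimeScale.rateExponent, TwoTimeScale.decay, ha]
      norm_num
    rw [hdecay] at ix iy
    exact ⟨ix, iy⟩
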